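/- Let $n\ge 3$ be an integer, $\mathbb R^n_+=\{(x,t): x\in\mathbb R^{n-1},\ t>0\}$ and identify $\partial\mathbb R^n_+$ with $\mathbb R^{n-1}$. Let $\mathcal D$ be the set of all real functions $u\in L^1_{\rm loc}(\mathbb R^n_+)$ that vanish at infinity, i.e. $|\{(x,t)\in\mathbb R^n_+: |u(x,t)|>a\}|<\infty$ for every $a>0$, and whose weak gradient satisfies $|\nabla u|\in L^2(\mathbb R^n_+)$. Every $u\in\mathcal D$ has a trace on $\partial\mathbb R^n_+$, i.e. a function in $L^1_{\rm loc}(\mathbb R^{n-1})$, unique up to null sets and again denoted by $u$, such that for every $R>0$ $$\lim_{r\to0^+}\frac1r\int_0^r\int_{|x|<R}|u(x,t)-u(x)|\,dx\,dt=0 .$$ Let $2\le\beta<n$ be real. Then there is a positive constant $H(n,\beta)$ such that for every $u\in\mathcal D$ $$H(n,\beta)\int_{\partial\mathbb R^n_+}\frac{u^2}{|x|}\,dx+\frac{(\beta-2)^2}{4}\int_{\mathbb R^n_+}\frac{u^2}{|x|^2+t^2}\,dx\,dt\le\int_{\mathbb R^n_+}|\nabla u|^2\,dx\,dt ,$$ and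 the best (i.e. largest) value of the constant $H(n,\beta)$ for which this holds for all $u\in\mathcal D$ is $$H(n,\beta)=2\,\frac{\Gamma\left(\frac{n+\beta}{4}-\frac12\right)\Gamma\left(\frac{n-\beta}{4}+\frac12\right)}{\Gamma\left(\frac{n+\beta}{4}-1\right)\Gamma\left(\frac{n-\beta}{4}\right)} .$$ -/

import Mathlib

open MeasureTheory Set Filter Topology
open scoped ContDiff

/-- The space `ℝⁿ = ℝⁿ⁻¹ × ℝ` with points `p = (x, t)`. Lebesgue measure is the product measure.
The built-in norm of the product (a maximum) is equivalent to the Euclidean one; wherever the exact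
Euclidean length matters, it is written out as `‖x‖ ^ 2 + t ^ 2`. -/
abbrev SplitSpace (n : ℕ) : Type := EuclideanSpace ℝ (Fin (n - 1)) × ℝ

/-- The open upper half-space `ℝⁿ₊ = {(x, t) : t > 0}`. -/
def halfSpace (n : ℕ) : Set (SplitSpace n) := {p | 0 < p.2}

/-- `G` is the weak (distributional) gradient of `u` on the open half-space: for every test function
`φ ∈ C_c^∞(ℝⁿ₊)` and every direction `e`, `∫ u ∂ₑφ = - ∫ ⟨G, e⟩ φ`. -/
def IsWeakGradient (n : ℕ) (u : SplitSpace n → ℝ) (G : SplitSpace n → SplitSpace n) : Prop :=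
  LocallyIntegrableOn u (halfSpace n) volume ∧
  LocallyIntegrableOn G (halfSpace n) volume ∧
  ∀ φ : SplitSpace n → ℝ, ContDiff ℝ ∞ φ → HasCompactSupport φ → tsupport φ ⊆ halfSpace n →
    ∀ e : SplitSpace n,
      ∫ p in halfSpace n, u p * fderiv ℝ φ p e =
        - ∫ p in halfSpace n, (inner ℝ (G p).1 e.1 + (G p).2 * e.2) * φ p

/-- `u` vanishes at infinity: every level set `{|u| > a}`, `a > 0`, has finite measure. -/
def VanishesAtInfinity (n : ℕ) (u : SplitSpace n → ℝ) : Prop :=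
  ∀ a : ℝ, 0 < a → volume {p | p ∈ halfSpace n ∧ a < |u p|} < ⊤

/-- `u` is a real function on the half-space vanishing at infinity, with weak gradient `G`
and `|G| ∈ L²(ℝⁿ₊)`. -/
structure IsAdmissible (n : ℕ) (u : SplitSpace n → ℝ) (G : SplitSpace n → SplitSpace n) :
    Prop where
  weakGradient : IsWeakGradient n u G
  memLp : MemLp G 2 (volume.restrict (halfSpace n))
  vanishes : VanishesAtInfinity n u

/-- `v` is the trace of `u` on `∂ℝⁿ₊ = ℝⁿ⁻¹`: for every `R`,
`(1/r) ∫_{|x| < R} ∫_0^r |u(x,t) - v(x)| dt dx → 0` as `r → 0⁺`.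
This determines `v` up to null sets, does not change when `u` is modified on a null set, and gives
`v = u(·, 0)` when `u` is continuous up to the boundary. -/
def IsTrace (n : ℕ) (u : SplitSpace n → ℝ) (v : EuclideanSpace ℝ (Fin (n - 1)) → ℝ) : Prop :=
  LocallyIntegrable v volume ∧
  ∀ R : ℝ, Tendsto
    (fun r : ℝ =>
      (∫⁻ p in Metric.ball (0 : EuclideanSpace ℝ (Fin (n - 1))) R ×ˢ Ioo (0 : ℝ) r,
        ‖u p - v p.1‖ₑ) / ENNReal.ofReal r)
    (𝓝[>] 0) (𝓝 0)

/-- The constant `H(n, β)`. -/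
noncomputable def hardyTraceConst (n : ℕ) (β : ℝ) : ℝ :=
  2 * (Real.Gamma ((n + β) / 4 - 1 / 2) * Real.Gamma ((n - β) / 4 + 1 / 2)) /
    (Real.Gamma ((n + β) / 4 - 1) * Real.Gamma ((n - β) / 4))

/-! The proof compares `u` with a virtual ground state. Put `μ = (n - 2) / 2`, `a = (n + β) / 2 -
2`, ρ² = |x|² + t² and s = t / ρ. Integrating the Newtonian kernel |p + r eₙ|^(-2μ), whose poles lie
on the negative vertical axis, against r^(a-1) dr gives the harmonic function ρ^(a-2μ) g(s), where g
is `gegenbauerIntegral a μ`. Changing the power of ρ gives U = ρ^(-μ) g(s), which satisfies -ΔU = (μ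
- a)² U / ρ² with (μ - a)² = (β - 2)² / 4. On t = 0 its logarithmic normal derivative is -∂ₜU / U =
H / |x| with H = -g'(0) / g(0), a quotient of Gamma values (`profileRatio_zero`).

Inequality: the field F = -∇U / U (`calibration`) satisfies div F - |F|² = (μ - a)² / ρ²
(`div_calibration`), which is the Riccati form of the equation for g. Expanding |∇z + zF|² and
integrating div(z² F) gives an exact identity (`IsGreenTest.integral_grad`): the energy of z is the
boundary term, plus the bulk Hardy term, plus the integral of |∇z + zF|². Dropping the last integral
proves the inequality for test functions.

Extension to admissible `u`: above a positive height, `u` is mollified without increasing the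
energy. The values are truncated and a spatial cutoff is applied; both are removed by Fatou
(`inequality_at_height`). Since slices of `u` vary by at most |t - s| times the energy in squared L²
norm, a trace exists, and the height goes to zero along slices that converge almost everywhere to
the trace (`hardy_trace_inequality`).

Sharpness: z = χU, with χ a cutoff in log ρ at scale L, leaves the defect |U ∇χ|², of order L⁻² ρ⁻ⁿ.
Its integral is O(1/L), while the boundary integral of U² / |x| = const · |x|^(-(n-1)) grows like L
(`le_profileRatio_of_hardy`). -/

/-! ### The radial profile -/

/-- `∫₀^∞ r^(c-1) (1 + 2 s r + r²)^(-μ) dr`, an integral of Gegenbauer type. -/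
noncomputable def gegenbauerIntegral (c μ s : ℝ) : ℝ :=
  ∫ r in Ioi (0 : ℝ), r ^ (c - 1) * (1 + 2 * s * r + r ^ 2) ^ (-μ)

/-- Since 1 + 2s₀r + r² = (1 + s₀)(1 + r²) - s₀(r - 1)². This dominates the integrands uniformly in
s ≥ s₀ as long as s₀ > -1. -/
lemma quadratic_lower_bound {s₀ s r : ℝ} (hs : s₀ ≤ s) (hs₀ : s₀ ≤ 0) (hr : 0 ≤ r) :
    (1 + s₀) * (1 + r ^ 2) ≤ 1 + 2 * s * r + r ^ 2 := by
  nlinarith [mul_le_mul_of_nonneg_right hs hr, mul_nonneg (neg_nonneg.2 hs₀) (sq_nonneg (r - 1))]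

lemma quadratic_pos {s r : ℝ} (hs : -1 < s) (hr : 0 ≤ r) : 0 < 1 + 2 * s * r + r ^ 2 := by
  have h := quadratic_lower_bound (min_le_left s 0) (min_le_right s 0) hr
  have : (0 : ℝ) < 1 + min s 0 := by
    rcases min_cases s 0 with h | h <;> linarith [h.1]
  exact lt_of_lt_of_le (by positivity) h

lemma continuousOn_gegenbauer_integrand (c μ : ℝ) {s : ℝ} (hs : -1 < s) :
    ContinuousOn (fun r : ℝ => r ^ (c - 1) * (1 + 2 * s * r + r ^ 2) ^ (-μ)) (Ioi 0) := by
  refine ContinuousOn.mul ?_ ?_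
  · exact continuousOn_id.rpow_const fun x hx => Or.inl (ne_of_gt hx)
  · refine ContinuousOn.rpow_const (by fun_prop) fun x hx => Or.inl ?_
    exact (quadratic_pos hs (le_of_lt hx)).ne'

/-- The integrand is at most r^(c-1) on (0, 1] and r^(c-1-2μ) beyond 1, so 0 < c handles the origin
and c < 2μ handles infinity. -/
lemma integrableOn_gegenbauer_zero {c μ : ℝ} (hc : 0 < c) (hcμ : c < 2 * μ) :
    IntegrableOn (fun r : ℝ => r ^ (c - 1) * (1 + r ^ 2) ^ (-μ)) (Ioi 0) := by
  have hcont : ContinuousOn (fun r : ℝ => r ^ (c - 1) * (1 + r ^ 2) ^ (-μ)) (Ioi 0) := by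
    simpa using continuousOn_gegenbauer_integrand c μ (s := 0) (by norm_num)
  have hμ : 0 < μ := by linarith
  rw [← Ioc_union_Ioi_eq_Ioi (zero_le_one (α := ℝ))]
  refine IntegrableOn.union ?_ ?_
  · have h1 : IntegrableOn (fun r : ℝ => r ^ (c - 1)) (Ioc 0 1) :=
      (intervalIntegrable_iff_integrableOn_Ioc_of_le zero_le_one).1
        (intervalIntegral.intervalIntegrable_rpow' (by linarith))
    refine Integrable.mono' h1
      ((hcont.mono Ioc_subset_Ioi_self).aestronglyMeasurable measurableSet_Ioc) ?_
    refine (ae_restrict_iff' measurableSet_Ioc).2 (ae_of_all _ fun r hr => ?_)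
    have h2 : (1 + r ^ 2) ^ (-μ) ≤ 1 :=
      Real.rpow_le_one_of_one_le_of_nonpos (by nlinarith) (by linarith)
    have h3 : 0 ≤ r ^ (c - 1) := Real.rpow_nonneg hr.1.le _
    have h4 : 0 ≤ (1 + r ^ 2) ^ (-μ) := by positivity
    rw [Real.norm_of_nonneg (by positivity)]
    nlinarith
  · have h1 : IntegrableOn (fun r : ℝ => r ^ (c - 1 - 2 * μ)) (Ioi 1) :=
      integrableOn_Ioi_rpow_of_lt (by linarith) one_pos
    refine Integrable.mono' h1
      ((hcont.mono (Ioi_subset_Ioi zero_le_one)).aestronglyMeasurable measurableSet_Ioi) ?_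
    refine (ae_restrict_iff' measurableSet_Ioi).2 (ae_of_all _ fun r (hr : 1 < r) => ?_)
    have hr0 : 0 < r := by linarith
    have h2 : (1 + r ^ 2) ^ (-μ) ≤ (r ^ 2) ^ (-μ) :=
      Real.rpow_le_rpow_of_nonpos (by positivity) (by linarith) (by linarith)
    have h3 : (r ^ 2) ^ (-μ) = r ^ (- (2 * μ)) := by
      rw [← Real.rpow_natCast, ← Real.rpow_mul hr0.le]; congr 1; push_cast; ring
    rw [Real.norm_of_nonneg (by positivity), show c - 1 - 2 * μ = (c - 1) + (-(2 * μ)) by ring,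
      Real.rpow_add hr0, ← h3]
    gcongr

lemma gegenbauer_integrand_le {c μ s₀ s r : ℝ} (hμ : 0 < μ) (hs₁ : -1 < s₀) (hs₀ : s₀ ≤ 0)
    (hs : s₀ ≤ s) (hr : 0 < r) :
    r ^ (c - 1) * (1 + 2 * s * r + r ^ 2) ^ (-μ) ≤
      (1 + s₀) ^ (-μ) * (r ^ (c - 1) * (1 + r ^ 2) ^ (-μ)) := by
  have h1 := quadratic_lower_bound hs hs₀ hr.le
  have h2 : (0 : ℝ) < 1 + s₀ := by linarith
  have h3 : (1 + 2 * s * r + r ^ 2) ^ (-μ) ≤ ((1 + s₀) * (1 + r ^ 2)) ^ (-μ) :=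
    Real.rpow_le_rpow_of_nonpos (by positivity) h1 (by linarith)
  rw [Real.mul_rpow h2.le (by positivity)] at h3
  calc _ ≤ r ^ (c - 1) * ((1 + s₀) ^ (-μ) * (1 + r ^ 2) ^ (-μ)) := by gcongr
    _ = _ := by ring

lemma integrableOn_gegenbauer {c μ s : ℝ} (hc : 0 < c) (hcμ : c < 2 * μ) (hs : -1 < s) :
    IntegrableOn (fun r : ℝ => r ^ (c - 1) * (1 + 2 * s * r + r ^ 2) ^ (-μ)) (Ioi 0) := by
  refine Integrable.mono' ((integrableOn_gegenbauer_zero hc hcμ).const_mul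
    ((1 + min s 0) ^ (-μ)))
    ((continuousOn_gegenbauer_integrand c μ hs).aestronglyMeasurable measurableSet_Ioi) ?_
  refine (ae_restrict_iff' measurableSet_Ioi).2 (ae_of_all _ fun r (hr : 0 < r) => ?_)
  have := quadratic_pos hs hr.le
  rw [Real.norm_of_nonneg (by positivity)]
  exact gegenbauer_integrand_le (by linarith) (lt_min hs (by norm_num)) (min_le_right _ _)
    (min_le_left _ _) hr

lemma gegenbauerIntegral_pos {c μ s : ℝ} (hc : 0 < c) (hcμ : c < 2 * μ) (hs : -1 < s) :
    0 < gegenbauerIntegral c μ s := by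
  unfold gegenbauerIntegral
  rw [setIntegral_pos_iff_support_of_nonneg_ae _ (integrableOn_gegenbauer hc hcμ hs)]
  · have : Ioi (0 : ℝ) ⊆ Function.support (fun r : ℝ =>
        r ^ (c - 1) * (1 + 2 * s * r + r ^ 2) ^ (-μ)) := fun r (hr : 0 < r) => by
      have := quadratic_pos hs hr.le
      exact ne_of_gt (by positivity)
    rw [inter_eq_right.2 this]; simp
  · refine (ae_restrict_iff' measurableSet_Ioi).2 (ae_of_all _ fun r (hr : 0 < r) => ?_)
    have := quadratic_pos hs hr.le
    show 0 ≤ _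
    positivity

lemma hasDerivAt_gegenbauerIntegral {c μ s : ℝ} (hc : 0 < c) (hcμ : c < 2 * μ) (hs : -1 < s) :
    HasDerivAt (gegenbauerIntegral c μ) (-(2 * μ) * gegenbauerIntegral (c + 1) (μ + 1) s) s := by
  have hμ : 0 < μ := by linarith
  -- A point strictly between -1 and s and not above 0: the domination is then uniform on the
  -- neighbourhood (s₀, ∞) of s.
  set s₀ : ℝ := min ((s - 1) / 2) 0
  have h0 : s₀ ≤ 0 := min_le_right _ _
  have h1 : -1 < s₀ := lt_min (by linarith) (by norm_num)
  have h2 : s₀ < s := lt_of_le_of_lt (min_le_left _ _) (by linarith)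
  have h3 := (hasDerivAt_integral_of_dominated_loc_of_deriv_le (μ := volume.restrict (Ioi 0))
    (F := fun (s r : ℝ) => r ^ (c - 1) * (1 + 2 * s * r + r ^ 2) ^ (-μ)) (x₀ := s)
    (F' := fun (s r : ℝ) => -(2 * μ) * (r ^ (c + 1 - 1) * (1 + 2 * s * r + r ^ 2) ^ (-(μ + 1))))
    (bound := fun r => (2 * μ) * ((1 + s₀) ^ (-(μ + 1)) *
      (r ^ (c + 1 - 1) * (1 + r ^ 2) ^ (-(μ + 1))))) (Ioi_mem_nhds h2) ?_ ?_ ?_ ?_ ?_ ?_).2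
  · rw [integral_const_mul] at h3
    exact h3
  · filter_upwards [Ioi_mem_nhds hs] with x hx
    exact (continuousOn_gegenbauer_integrand c μ hx).aestronglyMeasurable measurableSet_Ioi
  · exact integrableOn_gegenbauer hc hcμ hs
  · exact ((continuousOn_gegenbauer_integrand (c + 1) (μ + 1) hs).aestronglyMeasurable
      measurableSet_Ioi).const_mul _
  · refine (ae_restrict_iff' measurableSet_Ioi).2 (ae_of_all _ fun r (hr : 0 < r) x hx => ?_)
    have := quadratic_pos (h1.trans hx) hr.le
    rw [norm_mul, norm_neg, Real.norm_of_nonneg (by positivity : 0 ≤ 2 * μ),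
      Real.norm_of_nonneg (by positivity)]
    gcongr 2 * μ * ?_
    exact gegenbauer_integrand_le (by linarith) h1 h0 (le_of_lt hx) hr
  · exact ((integrableOn_gegenbauer_zero (by linarith) (by linarith)).const_mul _).const_mul _
  · refine (ae_restrict_iff' measurableSet_Ioi).2 (ae_of_all _ fun r (hr : 0 < r) x hx => ?_)
    have hq := quadratic_pos (h1.trans hx) hr.le
    have h4 : HasDerivAt (fun s : ℝ => 1 + 2 * s * r + r ^ 2) (2 * r) x := by
      have := (((hasDerivAt_id x).const_mul 2).mul_const r).const_add 1 |>.add_const (r ^ 2)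
      simpa using this
    have h5 := (h4.rpow_const (p := -μ) (Or.inl hq.ne')).const_mul (r ^ (c - 1))
    refine h5.congr_deriv ?_
    have : r ^ (c + 1 - 1) = r ^ (c - 1) * r := by
      rw [show c + 1 - 1 = (c - 1) + 1 by ring, Real.rpow_add hr, Real.rpow_one]
    rw [this, show -μ - 1 = -(μ + 1) by ring]
    ring

/-- One factor 1 + 2sr + r² is split off the power and expanded. -/
lemma gegenbauerIntegral_split {c μ s : ℝ} (hc : 0 < c) (hcμ : c < 2 * μ) (hs : -1 < s) :
    gegenbauerIntegral c μ s = gegenbauerIntegral c (μ + 1) s +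
      2 * s * gegenbauerIntegral (c + 1) (μ + 1) s + gegenbauerIntegral (c + 2) (μ + 1) s := by
  have i0 := integrableOn_gegenbauer (μ := μ + 1) hc (by linarith) hs
  have i1 := (integrableOn_gegenbauer (c := c + 1) (μ := μ + 1) (by linarith) (by linarith)
    hs).const_mul (2 * s)
  have i2 := integrableOn_gegenbauer (c := c + 2) (μ := μ + 1) (by linarith) (by linarith) hs
  have i01 : IntegrableOn (fun r : ℝ => r ^ (c - 1) * (1 + 2 * s * r + r ^ 2) ^ (-(μ + 1)) +
      2 * s * (r ^ (c + 1 - 1) * (1 + 2 * s * r + r ^ 2) ^ (-(μ + 1)))) (Ioi 0) := i0.add i1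
  unfold gegenbauerIntegral
  rw [← integral_const_mul, ← integral_add i0 i1, ← integral_add i01 i2]
  refine setIntegral_congr_fun measurableSet_Ioi fun r (hr : 0 < r) => ?_
  have hq := quadratic_pos hs hr.le
  have e1 : r ^ (c + 1 - 1) = r ^ (c - 1) * r := by
    rw [show c + 1 - 1 = (c - 1) + 1 by ring, Real.rpow_add hr, Real.rpow_one]
  have e2 : r ^ (c + 2 - 1) = r ^ (c - 1) * r ^ 2 := by
    rw [show c + 2 - 1 = (c - 1) + 2 by ring, Real.rpow_add hr]; norm_num
  have e3 : (1 + 2 * s * r + r ^ 2) ^ (-μ) =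
      (1 + 2 * s * r + r ^ 2) ^ (-(μ + 1)) * (1 + 2 * s * r + r ^ 2) := by
    rw [show -μ = -(μ + 1) + 1 by ring, Real.rpow_add hq, Real.rpow_one]
  rw [e1, e2, e3]; ring

/-- Integrates the r-derivative of r^c (1 + 2sr + r²)^(-μ) over (0, ∞); the boundary values vanish
at 0 because c > 0 and at infinity because c < 2μ. -/
lemma gegenbauerIntegral_by_parts {c μ s : ℝ} (hc : 0 < c) (hcμ : c < 2 * μ) (hs : -1 < s) :
    c * gegenbauerIntegral c μ s = 2 * μ * (s * gegenbauerIntegral (c + 1) (μ + 1) s +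
      gegenbauerIntegral (c + 2) (μ + 1) s) := by
  have hμ : 0 < μ := by linarith
  have i0 := (integrableOn_gegenbauer hc hcμ hs).const_mul c
  have i1 := (integrableOn_gegenbauer (c := c + 1) (μ := μ + 1) (by linarith) (by linarith)
    hs).const_mul s
  have i2 := integrableOn_gegenbauer (c := c + 2) (μ := μ + 1) (by linarith) (by linarith) hs
  have i12 : IntegrableOn (fun r : ℝ =>
      s * (r ^ (c + 1 - 1) * (1 + 2 * s * r + r ^ 2) ^ (-(μ + 1))) +
      r ^ (c + 2 - 1) * (1 + 2 * s * r + r ^ 2) ^ (-(μ + 1))) (Ioi 0) := i1.add i2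
  have i3 := i12.const_mul (2 * μ)
  have key := integral_Ioi_of_hasDerivAt_of_tendsto (a := 0) (m := 0)
    (f := fun r : ℝ => r ^ c * (1 + 2 * s * r + r ^ 2) ^ (-μ)) ?_ ?_ (i0.sub i3) ?_
  · rw [Real.zero_rpow hc.ne', zero_mul, sub_zero] at key
    simp only [Pi.sub_apply] at key
    rw [integral_sub i0 i3, integral_const_mul, integral_const_mul] at key
    rw [integral_add i1 i2, integral_const_mul] at key
    unfold gegenbauerIntegral
    linarith
  · refine ContinuousWithinAt.mul ?_ ?_
    · exact (Real.continuousAt_rpow_const _ _ (Or.inr hc.le)).continuousWithinAt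
    · refine ContinuousWithinAt.rpow_const (by fun_prop) (Or.inl (by norm_num))
  · intro r (hr : 0 < r)
    have hq := quadratic_pos hs hr.le
    have h4 : HasDerivAt (fun r : ℝ => 1 + 2 * s * r + r ^ 2) (2 * s + 2 * r) r := by
      have := (((hasDerivAt_id' r).const_mul (2 * s)).const_add 1).fun_add ((hasDerivAt_id' r).fun_pow 2)
      simpa using this
    have h5 := (Real.hasDerivAt_rpow_const (p := c) (Or.inl hr.ne')).mul
      (h4.rpow_const (p := -μ) (Or.inl hq.ne'))
    refine h5.congr_deriv ?_
    have e0 : r ^ c = r ^ (c - 1) * r := by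
      nth_rewrite 1 [show c = (c - 1) + 1 by ring]; rw [Real.rpow_add hr, Real.rpow_one]
    have e1 : r ^ (c + 1 - 1) = r ^ (c - 1) * r := by rw [← e0]; congr 1; ring
    have e2 : r ^ (c + 2 - 1) = r ^ (c - 1) * r ^ 2 := by
      rw [show c + 2 - 1 = (c - 1) + 2 by ring, Real.rpow_add hr]; norm_num
    simp only [Pi.sub_apply]
    rw [e1, e2, e0, show -μ - 1 = -(μ + 1) by ring]
    ring
  · have hs₀ : -1 < min s 0 := lt_min hs (by norm_num)
    have h1 : Tendsto (fun r : ℝ => (1 + min s 0) ^ (-μ) * r ^ (-(2 * μ - c))) atTop (𝓝 0) := by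
      simpa using (tendsto_rpow_neg_atTop (show 0 < 2 * μ - c by linarith)).const_mul
        ((1 + min s 0) ^ (-μ))
    refine squeeze_zero' ?_ ?_ h1
    · filter_upwards [Ioi_mem_atTop 0] with r (hr : 0 < r)
      have hq := quadratic_pos hs hr.le
      positivity
    · filter_upwards [Ioi_mem_atTop 0] with r (hr : 0 < r)
      have h := gegenbauer_integrand_le (c := c + 1) hμ hs₀ (min_le_right s 0) (min_le_left _ _) hr
      rw [show c + 1 - 1 = c by ring] at h
      refine h.trans ?_
      have h2 : (1 + r ^ 2) ^ (-μ) ≤ (r ^ 2) ^ (-μ) :=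
        Real.rpow_le_rpow_of_nonpos (by positivity) (by linarith) (by linarith)
      have h3 : (r ^ 2) ^ (-μ) = r ^ (- (2 * μ)) := by
        rw [← Real.rpow_natCast, ← Real.rpow_mul hr.le]; congr 1; push_cast; ring
      have h6 : 0 < 1 + min s 0 := by linarith
      rw [show -(2 * μ - c) = c + (-(2 * μ)) by ring, Real.rpow_add hr, ← h3]
      gcongr

/-- The image of `gegenbauerIntegral_by_parts` under r ↦ 1/r, which exchanges c and 2μ - c. The two
relations together yield the differential equation in s. -/
lemma gegenbauerIntegral_by_parts' {c μ s : ℝ} (hc : 0 < c) (hcμ : c < 2 * μ) (hs : -1 < s) :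
    (2 * μ - c) * gegenbauerIntegral c μ s = 2 * μ * (gegenbauerIntegral c (μ + 1) s +
      s * gegenbauerIntegral (c + 1) (μ + 1) s) := by
  linear_combination 2 * μ * gegenbauerIntegral_split hc hcμ hs -
    gegenbauerIntegral_by_parts hc hcμ hs

/-- The Gegenbauer differential equation. -/
lemma gegenbauerIntegral_ode {a μ s : ℝ} (ha : 0 < a) (haμ : a < 2 * μ) (hs : -1 < s) :
    (1 - s ^ 2) * (4 * μ * (μ + 1) * gegenbauerIntegral (a + 2) (μ + 2) s) +
      (2 * μ + 1) * s * (2 * μ * gegenbauerIntegral (a + 1) (μ + 1) s) -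
      a * (2 * μ - a) * gegenbauerIntegral a μ s = 0 := by
  have h1 := gegenbauerIntegral_by_parts' ha haμ hs
  have h2 := gegenbauerIntegral_by_parts (c := a) (μ := μ + 1) ha (by linarith) hs
  have h3 := gegenbauerIntegral_by_parts' (c := a + 1) (μ := μ + 1) (by linarith) (by linarith) hs
  rw [show μ + 1 + 1 = μ + 2 by ring] at h2 h3
  rw [show a + 1 + 1 = a + 2 by ring] at h3
  linear_combination (-a) * h1 - 2 * μ * h2 + 2 * μ * s * h3

/-- Γ(μ)(1 + r²)^(-μ) is the integral of y^(μ-1) e^(-(1+r²)y) over y > 0. Exchanging the order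
leaves a Gaussian moment in r and then a Gamma integral in y. -/
lemma gegenbauerIntegral_zero {c μ : ℝ} (hc : 0 < c) (hcμ : c < 2 * μ) :
    gegenbauerIntegral c μ 0 =
      Real.Gamma (c / 2) * Real.Gamma (μ - c / 2) / (2 * Real.Gamma μ) := by
  have hμ : 0 < μ := by linarith
  set K : ℝ → ℝ → ℝ := fun r y => r ^ (c - 1) * (y ^ (μ - 1) * Real.exp (-((1 + r ^ 2) * y)))
    with hK
  have hr : ∀ r : ℝ, 0 < r → ∫ y in Ioi 0, K r y =
      Real.Gamma μ * (r ^ (c - 1) * (1 + r ^ 2) ^ (-μ)) := fun r hr => by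
    have h0 : (0 : ℝ) < 1 + r ^ 2 := by positivity
    simp only [hK]
    rw [integral_const_mul, Real.integral_rpow_mul_exp_neg_mul_Ioi hμ h0, one_div,
      Real.inv_rpow h0.le, Real.rpow_neg h0.le]
    ring
  have hnonneg : ∀ r y : ℝ, 0 < r → 0 < y → 0 ≤ K r y := fun r y hr hy => by
    simp only [hK]; positivity
  have hy : ∀ y : ℝ, 0 < y → ∫ r in Ioi 0, K r y =
      (1 / 2 * Real.Gamma (c / 2)) * (y ^ (μ - c / 2 - 1) * Real.exp (-(1 * y))) := fun y hy => by
    have h1 := integral_rpow_mul_exp_neg_mul_rpow (p := 2) (q := c - 1) (b := y) two_pos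
      (by linarith) hy
    have h2 : ∀ r : ℝ, K r y = (y ^ (μ - 1) * Real.exp (-(1 * y))) *
        (r ^ (c - 1) * Real.exp (-y * r ^ (2 : ℝ))) := fun r => by
      have : Real.exp (-((1 + r ^ 2) * y)) = Real.exp (-(1 * y)) * Real.exp (-y * r ^ (2 : ℝ)) := by
        rw [← Real.exp_add]; congr 1; norm_num; ring
      simp only [hK]; rw [this]; ring
    simp_rw [h2]
    rw [integral_const_mul, h1, show μ - c / 2 - 1 = (μ - 1) + (-(c - 1 + 1) / 2) by ring,
      Real.rpow_add hy, show (c - 1 + 1) / 2 = c / 2 by ring]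
    ring
  have hint : Integrable (Function.uncurry K)
      ((volume.restrict (Ioi 0)).prod (volume.restrict (Ioi 0))) := by
    have hm : AEStronglyMeasurable (Function.uncurry K)
        ((volume.restrict (Ioi 0)).prod (volume.restrict (Ioi 0))) := by
      apply Measurable.aestronglyMeasurable
      simp only [hK, Function.uncurry_def]; fun_prop
    rw [integrable_prod_iff hm]
    constructor
    · refine (ae_restrict_iff' measurableSet_Ioi).2 (ae_of_all _ fun r (hr' : 0 < r) => ?_)
      -- A non-integrable function has Bochner integral 0, so the nonzero value computed in `hr`
      -- already gives integrability.
      refine Integrable.of_integral_ne_zero ?_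
      show ∫ y in Ioi 0, K r y ≠ 0
      rw [hr r hr']
      have := Real.Gamma_pos_of_pos hμ
      positivity
    · refine ((integrableOn_gegenbauer_zero hc hcμ).const_mul (Real.Gamma μ)).congr ?_
      refine (ae_restrict_iff' measurableSet_Ioi).2 (ae_of_all _ fun r (hr' : 0 < r) => ?_)
      refine (hr r hr').symm.trans ?_
      exact setIntegral_congr_fun measurableSet_Ioi fun y hy =>
        (Real.norm_of_nonneg (hnonneg r y hr' hy)).symm
  have hswap := integral_integral_swap hint
  rw [setIntegral_congr_fun measurableSet_Ioi hr, setIntegral_congr_fun measurableSet_Ioi hy,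
    integral_const_mul, integral_const_mul,
    Real.integral_rpow_mul_exp_neg_mul_Ioi (by linarith) one_pos] at hswap
  have hG := Real.Gamma_pos_of_pos hμ
  rw [eq_div_iff (by positivity)]
  unfold gegenbauerIntegral
  simp only [mul_zero, zero_mul, add_zero]
  simp only [div_one, Real.one_rpow, one_mul] at hswap
  linarith

lemma gegenbauerIntegral_antitoneOn {c μ : ℝ} (hc : 0 < c) (hcμ : c < 2 * μ) {s : ℝ}
    (hs : 0 ≤ s) : gegenbauerIntegral c μ s ≤ gegenbauerIntegral c μ 0 := by
  refine setIntegral_mono_on (integrableOn_gegenbauer hc hcμ (by linarith))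
    (integrableOn_gegenbauer hc hcμ (by norm_num)) measurableSet_Ioi fun r (hr : 0 < r) => ?_
  gcongr ?_ * ?_
  refine Real.rpow_le_rpow_of_nonpos (by norm_num; positivity) ?_ (by linarith)
  have : 0 ≤ s * r := by positivity
  nlinarith

/-! ### The logarithmic derivative of the profile -/

/-- `-g'/g` for `g = gegenbauerIntegral a μ`. -/
noncomputable def profileRatio (a μ s : ℝ) : ℝ :=
  2 * μ * gegenbauerIntegral (a + 1) (μ + 1) s / gegenbauerIntegral a μ s

/-- By induction on k: differentiation stays in the family, and 0 < c < 2μ is preserved by (c, μ) ↦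
(c + 1, μ + 1). -/
lemma contDiffAt_gegenbauerIntegral {c μ s : ℝ} (hc : 0 < c) (hcμ : c < 2 * μ) (hs : -1 < s)
    (k : ℕ) : ContDiffAt ℝ k (gegenbauerIntegral c μ) s := by
  suffices h : ContDiffOn ℝ k (gegenbauerIntegral c μ) (Ioi (-1)) from
    h.contDiffAt (Ioi_mem_nhds hs)
  clear hs s
  induction k generalizing c μ with
  | zero =>
    exact contDiffOn_zero.2 fun s hs =>
      (hasDerivAt_gegenbauerIntegral hc hcμ hs).continuousAt.continuousWithinAt
  | succ k ih =>
    have h1 : ContDiffOn ℝ k (fun s => -(2 * μ) * gegenbauerIntegral (c + 1) (μ + 1) s)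
      (Ioi (-1)) := contDiffOn_const.mul (ih (by linarith) (by linarith))
    have := (contDiffOn_succ_iff_deriv_of_isOpen (𝕜 := ℝ) (n := (k : WithTop ℕ∞))
      (f := gegenbauerIntegral c μ) isOpen_Ioi).2
      ⟨fun s hs => (hasDerivAt_gegenbauerIntegral hc hcμ hs).differentiableAt.differentiableWithinAt,
        by simp, h1.congr fun s hs => (hasDerivAt_gegenbauerIntegral hc hcμ hs).deriv⟩
    exact_mod_cast this

lemma contDiffAt_profileRatio {a μ s : ℝ} (ha : 0 < a) (haμ : a < 2 * μ) (hs : -1 < s)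
    (k : ℕ) : ContDiffAt ℝ k (profileRatio a μ) s :=
  (contDiffAt_const.mul (contDiffAt_gegenbauerIntegral (by linarith) (by linarith) hs k)).div
    (contDiffAt_gegenbauerIntegral ha haμ hs k) (gegenbauerIntegral_pos ha haμ hs).ne'

lemma profileRatio_pos {a μ s : ℝ} (ha : 0 < a) (haμ : a < 2 * μ) (hs : -1 < s) :
    0 < profileRatio a μ s := by
  have h1 := gegenbauerIntegral_pos ha haμ hs
  have h2 := gegenbauerIntegral_pos (c := a + 1) (μ := μ + 1) (by linarith) (by linarith) hs
  have : 0 < μ := by linarith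
  unfold profileRatio; positivity

/-- The Riccati equation. -/
lemma profileRatio_riccati {a μ s : ℝ} (ha : 0 < a) (haμ : a < 2 * μ) (hs : -1 < s) :
    ∃ q' : ℝ, HasDerivAt (profileRatio a μ) q' s ∧
      (1 - s ^ 2) * (q' - profileRatio a μ s ^ 2) - (2 * μ + 1) * s * profileRatio a μ s =
        -(a * (2 * μ - a)) := by
  have h0 := gegenbauerIntegral_pos ha haμ hs
  have h1 := hasDerivAt_gegenbauerIntegral ha haμ hs
  have h2 := hasDerivAt_gegenbauerIntegral (c := a + 1) (μ := μ + 1) (by linarith) (by linarith) hs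
  have h3 := gegenbauerIntegral_ode ha haμ hs
  rw [show a + 1 + 1 = a + 2 by ring, show μ + 1 + 1 = μ + 2 by ring] at h2
  refine ⟨_, (h2.const_mul (2 * μ)).div h1 h0.ne', ?_⟩
  unfold profileRatio
  field_simp
  linear_combination (-(gegenbauerIntegral a μ s)) * h3

lemma profileRatio_zero {a μ : ℝ} (ha : 0 < a) (haμ : a < 2 * μ) :
    profileRatio a μ 0 =
      2 * (Real.Gamma ((a + 1) / 2) * Real.Gamma (μ - a / 2 + 1 / 2)) /
        (Real.Gamma (a / 2) * Real.Gamma (μ - a / 2)) := by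
  have hμ : 0 < μ := by linarith
  unfold profileRatio
  rw [gegenbauerIntegral_zero ha haμ, gegenbauerIntegral_zero (by linarith) (by linarith),
    Real.Gamma_add_one hμ.ne', show μ + 1 - (a + 1) / 2 = μ - a / 2 + 1 / 2 by ring]
  have h1 := Real.Gamma_pos_of_pos hμ
  have h2 := Real.Gamma_pos_of_pos (show 0 < a / 2 by linarith)
  have h3 := Real.Gamma_pos_of_pos (show 0 < μ - a / 2 by linarith)
  field_simp

/-- With these parameters 2μ - a = (n - β) / 2 and (μ - a)² = (β - 2)² / 4, so β < n is exactly the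
convergence condition a < 2μ. -/
lemma profileRatio_eq_hardyTraceConst {n : ℕ} {β : ℝ} (hn : 3 ≤ n) (hβ : 2 ≤ β)
    (hβn : β < (n : ℝ)) :
    profileRatio ((n + β) / 2 - 2) (((n : ℝ) - 2) / 2) 0 = hardyTraceConst n β := by
  have hn' : (3 : ℝ) ≤ n := by exact_mod_cast hn
  rw [profileRatio_zero (by linarith) (by linarith), hardyTraceConst]
  congr 3 <;> congr 1 <;> ring

/-! ### The divergence theorem above a horizontal hyperplane -/

section Divergence

variable {m : ℕ}

lemma integral_fderiv_apply_eq_zero {V : Type*} [NormedAddCommGroup V] [NormedSpace ℝ V]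
    [FiniteDimensional ℝ V] [MeasurableSpace V] [BorelSpace V] {ν : Measure V}
    [ν.IsAddHaarMeasure] {f : V → ℝ} (hf : ContDiff ℝ 1 f) (hc : HasCompactSupport f) (v : V) :
    ∫ x, fderiv ℝ f x v ∂ν = 0 := by
  have h1 : Continuous fun x => fderiv ℝ f x v := (hf.continuous_fderiv one_ne_zero).clm_apply
    continuous_const
  have h2 : HasCompactSupport fun x => fderiv ℝ f x v := hc.fderiv_apply (𝕜 := ℝ) v
  have h := integral_mul_fderiv_eq_neg_fderiv_mul_of_integrable (μ := ν) (𝕜 := ℝ)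
    (f := fun _ : V => (1 : ℝ)) (g := f) (v := v) (by simp)
    (by simpa using h1.integrable_of_hasCompactSupport h2)
    (by simpa using hf.continuous.integrable_of_hasCompactSupport hc)
    (fun _ _ => by fun_prop) (fun x _ => hf.differentiable one_ne_zero x)
  simpa using h

/-- The integrand is the divergence of h(x) x, a sum of coordinate derivatives of compactly
supported C¹ functions. -/
lemma integral_div_smul_id_eq_zero {h : EuclideanSpace ℝ (Fin m) → ℝ} (hh : ContDiff ℝ 1 h)
    (hc : HasCompactSupport h) : ∫ x, (m * h x + fderiv ℝ h x x) = 0 := by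
  have hd : Differentiable ℝ h := hh.differentiable one_ne_zero
  have hcf : Continuous (fderiv ℝ h) := hh.continuous_fderiv one_ne_zero
  let e : Fin m → EuclideanSpace ℝ (Fin m) := fun i => EuclideanSpace.single i 1
  have hcoord : ∀ i, ContDiff ℝ 1 fun x : EuclideanSpace ℝ (Fin m) => x i := fun i =>
    (EuclideanSpace.proj (𝕜 := ℝ) i).contDiff
  have hi : ∀ i x, fderiv ℝ (fun x => h x * x i) x (e i) = h x + x i * fderiv ℝ h x (e i) := by
    intro i x
    have h1 : HasFDerivAt (fun x : EuclideanSpace ℝ (Fin m) => x i)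
      (EuclideanSpace.proj (𝕜 := ℝ) i) x := (EuclideanSpace.proj (𝕜 := ℝ) i).hasFDerivAt
    rw [((hd x).hasFDerivAt.fun_mul h1).fderiv]
    simp [e]
  have hsum : ∀ x, m * h x + fderiv ℝ h x x = ∑ i, fderiv ℝ (fun x => h x * x i) x (e i) := by
    intro x
    simp_rw [hi, Finset.sum_add_distrib, Finset.sum_const, Finset.card_univ, Fintype.card_fin,
      nsmul_eq_mul]
    congr 1
    have hx := congrArg (fderiv ℝ h x) ((EuclideanSpace.basisFun (Fin m) ℝ).sum_repr x)
    rw [← hx, map_sum]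
    refine Finset.sum_congr rfl fun i _ => ?_
    rw [map_smul, EuclideanSpace.basisFun_apply, EuclideanSpace.basisFun_repr, smul_eq_mul]
  simp_rw [hsum]
  rw [integral_finsetSum]
  · exact Finset.sum_eq_zero fun i _ => integral_fderiv_apply_eq_zero (hh.mul (hcoord i))
      hc.mul_right _
  · intro i _
    have hci : ContDiff ℝ 1 fun x => h x * x i := hh.mul (hcoord i)
    exact ((hci.continuous_fderiv one_ne_zero).clm_apply
      continuous_const).integrable_of_hasCompactSupport
      ((hc.mul_right (f' := fun x : EuclideanSpace ℝ (Fin m) => x i)).fderiv_apply (𝕜 := ℝ) _)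

lemma integrableOn_of_hasCompactSupport {V : Type*} [TopologicalSpace V] [T2Space V] [MeasurableSpace V]
    [OpensMeasurableSpace V] {ν : Measure V} [IsFiniteMeasureOnCompacts ν] {f : V → ℝ} {S : Set V}
    (hS : IsClosed S) (hf : ContinuousOn f S) (hc : HasCompactSupport f) : IntegrableOn f S ν :=
  ((hf.mono inter_subset_left).integrableOn_compact (hc.isCompact.inter_left hS)).of_forall_sdiff_eq_zero
    hS.measurableSet fun _ hx => image_eq_zero_of_notMem_tsupport fun h => hx.2 ⟨hx.1, h⟩

/-- The open upper half-space above height `τ`. -/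
def aboveHeight (m : ℕ) (τ : ℝ) : Set (EuclideanSpace ℝ (Fin m) × ℝ) := {p | τ < p.2}

lemma measurableSet_aboveHeight (τ : ℝ) : MeasurableSet (aboveHeight m τ) :=
  measurableSet_lt measurable_const measurable_snd

lemma restrict_aboveHeight (τ : ℝ) :
    (volume : Measure (EuclideanSpace ℝ (Fin m) × ℝ)).restrict (aboveHeight m τ) =
      (volume : Measure (EuclideanSpace ℝ (Fin m))).prod (volume.restrict (Ioi τ)) := by
  have : aboveHeight m τ = univ ×ˢ Ioi τ := by ext; simp [aboveHeight]
  rw [this, Measure.volume_eq_prod, ← Measure.prod_restrict, Measure.restrict_univ]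

lemma isClosed_atLeastHeight (τ : ℝ) :
    IsClosed {p : EuclideanSpace ℝ (Fin m) × ℝ | τ ≤ p.2} :=
  isClosed_le continuous_const continuous_snd

lemma integrableOn_aboveHeight {f : EuclideanSpace ℝ (Fin m) × ℝ → ℝ} {τ : ℝ}
    (hf : ∀ p, τ ≤ p.2 → ContinuousAt f p) (hc : HasCompactSupport f) :
    IntegrableOn f (aboveHeight m τ) :=
  (integrableOn_of_hasCompactSupport (isClosed_atLeastHeight τ)
    (fun p hp => (hf p hp).continuousWithinAt) hc).mono_set fun _ (hp : τ < _) => hp.le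

lemma ContDiffAt.continuousAt_fderiv_apply {V : Type*} [NormedAddCommGroup V] [NormedSpace ℝ V]
    {f : V → ℝ} {p : V} (hf : ContDiffAt ℝ 1 f p) {v : V → V} (hv : ContinuousAt v p) :
    ContinuousAt (fun p => fderiv ℝ f p (v p)) p :=
  ((hf.fderiv_right (m := 0) (by norm_num)).continuousAt).clm_apply hv

variable {f : EuclideanSpace ℝ (Fin m) × ℝ → ℝ} {τ : ℝ}

lemma hasCompactSupport_slice_left (hc : HasCompactSupport f) (t : ℝ) :
    HasCompactSupport fun x => f (x, t) :=
  HasCompactSupport.intro (hc.isCompact.image continuous_fst) fun _ hx =>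
    image_eq_zero_of_notMem_tsupport fun h => hx ⟨_, h, rfl⟩

lemma hasCompactSupport_slice_right (hc : HasCompactSupport f) (x : EuclideanSpace ℝ (Fin m)) :
    HasCompactSupport fun t => f (x, t) :=
  HasCompactSupport.intro (hc.isCompact.image continuous_snd) fun _ ht =>
    image_eq_zero_of_notMem_tsupport fun h => ht ⟨_, h, rfl⟩

/-- Fubini reduces to horizontal slices, where the field f(x, t) x has no boundary. The vertical
part, treated next, produces the whole boundary term. -/
lemma integral_horizontal_div_eq_zero (hf : ∀ p, τ ≤ p.2 → ContDiffAt ℝ 1 f p)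
    (hc : HasCompactSupport f) :
    ∫ p in aboveHeight m τ, (m * f p + fderiv ℝ f p (p.1, 0)) = 0 := by
  have hint : IntegrableOn (fun p => m * f p + fderiv ℝ f p (p.1, 0)) (aboveHeight m τ) := by
    refine integrableOn_aboveHeight (fun p hp => ?_) ?_
    · exact (continuousAt_const.mul (hf p hp).continuousAt).add
        ((hf p hp).continuousAt_fderiv_apply (by fun_prop))
    · refine hc.mul_left.add (hc.fderiv (𝕜 := ℝ) |>.mono' ?_)
      exact subset_closure.trans' fun p hp h => hp (by simp [h])
  unfold IntegrableOn at hint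
  rw [restrict_aboveHeight] at hint ⊢
  rw [integral_prod_symm _ hint]
  rw [setIntegral_congr_fun (g := fun _ => (0 : ℝ)) measurableSet_Ioi, integral_zero]
  intro t (ht : τ < t)
  have hslice : ContDiff ℝ 1 fun x => f (x, t) := by
    rw [contDiff_iff_contDiffAt]
    intro x
    exact (hf (x, t) ht.le).comp x (f := fun x => (x, t))
      (contDiff_id.prodMk contDiff_const).contDiffAt
  refine Eq.trans ?_ (integral_div_smul_id_eq_zero hslice (hasCompactSupport_slice_left hc t))
  refine integral_congr_ae (ae_of_all _ fun x => ?_)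
  have h1 : HasFDerivAt (fun x : EuclideanSpace ℝ (Fin m) => (x, t))
    (ContinuousLinearMap.inl ℝ _ ℝ) x := (hasFDerivAt_id x).prodMk (hasFDerivAt_const t x)
  have h2 := ((hf (x, t) ht.le).differentiableAt one_ne_zero).hasFDerivAt.comp x h1
  simp only
  rw [show (fun x => f (x, t)) = f ∘ fun x => (x, t) from rfl, h2.fderiv]
  simp

lemma integral_vertical_deriv (hf : ∀ p, τ ≤ p.2 → ContDiffAt ℝ 1 f p)
    (hc : HasCompactSupport f) :
    ∫ p in aboveHeight m τ, fderiv ℝ f p (0, 1) = - ∫ x, f (x, τ) := by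
  have hcd : HasCompactSupport fun p => fderiv ℝ f p (0, 1) := hc.fderiv_apply (𝕜 := ℝ) _
  have hcont : ∀ p, τ ≤ p.2 → ContinuousAt (fun p => fderiv ℝ f p (0, 1)) p := fun p hp =>
    (hf p hp).continuousAt_fderiv_apply continuousAt_const
  have hint : IntegrableOn (fun p => fderiv ℝ f p (0, 1)) (aboveHeight m τ) :=
    integrableOn_aboveHeight hcont hcd
  unfold IntegrableOn at hint
  rw [restrict_aboveHeight] at hint ⊢
  rw [integral_prod _ hint, ← integral_neg]
  refine integral_congr_ae (ae_of_all _ fun x => ?_)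
  have hline : ∀ t, HasDerivAt (fun t : ℝ => (x, t)) ((0, 1) : EuclideanSpace ℝ (Fin m) × ℝ) t :=
    fun t => (hasDerivAt_const t x).prodMk (hasDerivAt_id t)
  have hcs := hasCompactSupport_slice_right hc x
  have h := integral_Ioi_of_hasDerivAt_of_tendsto (a := τ) (m := 0) (f := fun t => f (x, t))
    (f' := fun t => fderiv ℝ f (x, t) (0, 1)) ?_ ?_ ?_ ?_
  · simpa using h
  · exact ((hf (x, τ) le_rfl).continuousAt.comp (f := fun t => (x, t))
      (by fun_prop)).continuousWithinAt
  · intro t (ht : τ < t)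
    exact ((hf (x, t) ht.le).differentiableAt one_ne_zero).hasFDerivAt.comp_hasDerivAt t (hline t)
  · refine (integrableOn_of_hasCompactSupport isClosed_Ici (fun t ht => ?_)
      (hasCompactSupport_slice_right hcd x)).mono_set Ioi_subset_Ici_self
    exact ((hcont (x, t) ht).comp (f := fun t => (x, t)) (by fun_prop)).continuousWithinAt
  · refine (hcs.is_zero_at_infty).mono_left ?_
    exact atTop_le_cocompact

end Divergence

/-! ### The calibrating vector field -/

section Field

variable {V : Type*} [NormedAddCommGroup V]

/-- The squared Euclidean length `‖x‖² + t²`. -/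
def sqLen (p : V × ℝ) : ℝ := ‖p.1‖ ^ 2 + p.2 ^ 2

/-- The cosine `t / √(‖x‖² + t²)` of the angle to the vertical axis. -/
noncomputable def cosAngle (p : V × ℝ) : ℝ := p.2 / √(sqLen p)

/-- The calibrating field is `(horizontalCoeff p • p.1, verticalCoeff p)`. -/
noncomputable def horizontalCoeff (a μ : ℝ) (p : V × ℝ) : ℝ :=
  (μ - profileRatio a μ (cosAngle p) * cosAngle p) / sqLen p

/-- The vertical component of the calibrating field. -/
noncomputable def verticalCoeff (a μ : ℝ) (p : V × ℝ) : ℝ :=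
  μ * p.2 / sqLen p + profileRatio a μ (cosAngle p) * (1 - cosAngle p ^ 2) / √(sqLen p)

lemma sqLen_pos {p : V × ℝ} (hp : p ≠ 0) : 0 < sqLen p := by
  unfold sqLen
  by_cases h : p.1 = 0
  · have h2 : p.2 ≠ 0 := fun h2 => hp (Prod.ext h h2)
    positivity
  · have : 0 < ‖p.1‖ := norm_pos_iff.2 h
    positivity

lemma cosAngle_sq_le_one (p : V × ℝ) : cosAngle p ^ 2 ≤ 1 := by
  have h : 0 ≤ sqLen p := by unfold sqLen; positivity
  unfold cosAngle
  rw [div_pow, Real.sq_sqrt h]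
  refine div_le_one_of_le₀ ?_ h
  unfold sqLen; nlinarith [sq_nonneg ‖p.1‖]

lemma cosAngle_nonneg {p : V × ℝ} (hp : 0 ≤ p.2) : 0 ≤ cosAngle p :=
  div_nonneg hp (Real.sqrt_nonneg _)

variable {a μ : ℝ} {p : V × ℝ}

lemma verticalCoeff_nonneg (ha : 0 < a) (haμ : a < 2 * μ) (ht : 0 ≤ p.2) :
    0 ≤ verticalCoeff a μ p := by
  have h : 0 ≤ sqLen p := by unfold sqLen; positivity
  have hs : -1 < cosAngle p := by linarith [cosAngle_nonneg ht]
  have hq := profileRatio_pos ha haμ hs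
  have hμ : 0 < μ := by linarith
  have := sub_nonneg.2 (cosAngle_sq_le_one p)
  unfold verticalCoeff
  positivity

lemma verticalCoeff_boundary (x : V) :
    verticalCoeff a μ (x, 0) = profileRatio a μ 0 / ‖x‖ := by
  simp [verticalCoeff, cosAngle, sqLen]

variable [InnerProductSpace ℝ V]

lemma contDiff_sqLen {k : WithTop ℕ∞} : ContDiff ℝ k (sqLen : V × ℝ → ℝ) :=
  ((contDiff_norm_sq ℝ).comp contDiff_fst).add (contDiff_snd.pow 2)

lemma contDiffAt_cosAngle {k : WithTop ℕ∞} {p : V × ℝ} (hp : p ≠ 0) :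
    ContDiffAt ℝ k cosAngle p := by
  have h := sqLen_pos hp
  exact contDiff_snd.contDiffAt.div (contDiff_sqLen.contDiffAt.sqrt h.ne') (Real.sqrt_pos.2 h).ne'

lemma contDiffAt_horizontalCoeff (ha : 0 < a) (haμ : a < 2 * μ) (hp : p ≠ 0) (ht : 0 ≤ p.2) :
    ContDiffAt ℝ 1 (horizontalCoeff a μ) p := by
  have h := sqLen_pos hp
  have hs : -1 < cosAngle p := by linarith [cosAngle_nonneg ht]
  have hq : ContDiffAt ℝ 1 (fun p : V × ℝ => profileRatio a μ (cosAngle p)) p :=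
    (contDiffAt_profileRatio ha haμ hs 1).comp p (contDiffAt_cosAngle hp)
  exact (contDiffAt_const.sub (hq.mul (contDiffAt_cosAngle hp))).div contDiff_sqLen.contDiffAt h.ne'

lemma contDiffAt_verticalCoeff (ha : 0 < a) (haμ : a < 2 * μ) (hp : p ≠ 0) (ht : 0 ≤ p.2) :
    ContDiffAt ℝ 1 (verticalCoeff a μ) p := by
  have h := sqLen_pos hp
  have hs : -1 < cosAngle p := by linarith [cosAngle_nonneg ht]
  have hq : ContDiffAt ℝ 1 (fun p : V × ℝ => profileRatio a μ (cosAngle p)) p :=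
    (contDiffAt_profileRatio ha haμ hs 1).comp p (contDiffAt_cosAngle hp)
  have hc := contDiffAt_cosAngle (k := 1) hp
  exact ((contDiffAt_const.mul contDiff_snd.contDiffAt).div contDiff_sqLen.contDiffAt h.ne').add
    ((hq.mul (contDiffAt_const.sub (hc.pow 2))).div (contDiff_sqLen.contDiffAt.sqrt h.ne')
      (Real.sqrt_pos.2 h).ne')

/-- This and the next two lemmas differentiate the field along a line, with N, T, S standing for ρ²,
t and s on that line; directional derivatives thereby reduce to one-variable calculus. -/
lemma hasDerivAt_cosAngle_line {N T : ℝ → ℝ} {N' T' : ℝ} (hN : HasDerivAt N N' 0)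
    (hT : HasDerivAt T T' 0) (h0 : 0 < N 0) :
    HasDerivAt (fun l => T l / √(N l)) (T' / √(N 0) - T 0 * N' / (2 * N 0 * √(N 0))) 0 := by
  have h1 := Real.sqrt_pos.2 h0
  refine (hT.fun_div (hN.sqrt h0.ne') h1.ne').congr_deriv ?_
  have h2 : √(N 0) ^ 2 = N 0 := Real.sq_sqrt h0.le
  field_simp
  rw [h2]
  field_simp

lemma hasDerivAt_horizontal_line {N S q : ℝ → ℝ} {N' S' q' μ : ℝ} (hN : HasDerivAt N N' 0)
    (hS : HasDerivAt S S' 0) (h0 : 0 < N 0) (hq : HasDerivAt q q' (S 0)) :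
    HasDerivAt (fun l => (μ - q (S l) * S l) / N l)
      ((-(q' * S' * S 0 + q (S 0) * S') * N 0 - (μ - q (S 0) * S 0) * N') / N 0 ^ 2) 0 :=
  (((hq.comp 0 hS).fun_mul hS).const_sub μ).fun_div hN h0.ne'

lemma hasDerivAt_vertical_line {N T S q : ℝ → ℝ} {N' T' S' q' μ : ℝ} (hN : HasDerivAt N N' 0)
    (hT : HasDerivAt T T' 0) (hS : HasDerivAt S S' 0) (h0 : 0 < N 0)
    (hq : HasDerivAt q q' (S 0)) :
    HasDerivAt (fun l => μ * T l / N l + q (S l) * (1 - S l ^ 2) / √(N l))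
      ((μ * T' * N 0 - μ * T 0 * N') / N 0 ^ 2 +
        ((q' * S' * (1 - S 0 ^ 2) - 2 * q (S 0) * S 0 * S') / √(N 0) -
          q (S 0) * (1 - S 0 ^ 2) * N' / (2 * N 0 * √(N 0)))) 0 := by
  have h1 := Real.sqrt_pos.2 h0
  refine (((hT.const_mul μ).fun_div hN h0.ne').fun_add ((((hq.comp 0 hS).fun_mul
    ((hS.fun_pow 2).const_sub 1))).fun_div (hN.sqrt h0.ne') h1.ne')).congr_deriv ?_
  have h2 : √(N 0) ^ 2 = N 0 := Real.sq_sqrt h0.le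
  simp only [Function.comp]
  congr 1
  rw [h2]
  field_simp
  rw [h2]
  ring

/-- The pointwise identity `div F - |F|² = (μ - a)² / (‖x‖² + t²)` in dimension `2 μ + 2`. -/
lemma div_calibration (ha : 0 < a) (haμ : a < 2 * μ) (hp : p ≠ 0) (ht : 0 ≤ p.2) :
    (2 * μ + 1) * horizontalCoeff a μ p + fderiv ℝ (horizontalCoeff a μ) p (p.1, 0) +
      fderiv ℝ (verticalCoeff a μ) p (0, 1) =
    horizontalCoeff a μ p ^ 2 * ‖p.1‖ ^ 2 + verticalCoeff a μ p ^ 2 + (μ - a) ^ 2 / sqLen p := by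
  have hN := sqLen_pos hp
  have hs : -1 < cosAngle p := by linarith [cosAngle_nonneg ht]
  obtain ⟨q', hq', hric⟩ := profileRatio_riccati ha haμ hs
  have hρ := Real.sqrt_pos.2 hN
  have hρ2 : sqLen p = √(sqLen p) ^ 2 := (Real.sq_sqrt hN.le).symm
  have hline : ∀ v : V × ℝ, HasDerivAt (fun l : ℝ => p + l • v) v 0 := fun v => by
    simpa using ((hasDerivAt_id (0 : ℝ)).smul_const v).const_add p
  have ht2 : p.2 = √(sqLen p) * cosAngle p := by
    unfold cosAngle; field_simp
  have hx2 : ‖p.1‖ ^ 2 = √(sqLen p) ^ 2 * (1 - cosAngle p ^ 2) := by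
    have : ‖p.1‖ ^ 2 = sqLen p - p.2 ^ 2 := by unfold sqLen; ring
    rw [this, ht2, hρ2]
    simp only [Real.sqrt_sq hρ.le]; ring
  have hA : fderiv ℝ (horizontalCoeff a μ) p (p.1, 0) =
      ((q' * cosAngle p + profileRatio a μ (cosAngle p)) * (cosAngle p * (1 - cosAngle p ^ 2)) -
        2 * (μ - profileRatio a μ (cosAngle p) * cosAngle p) * (1 - cosAngle p ^ 2)) /
          √(sqLen p) ^ 2 := by
    have hd : HasDerivAt (fun l : ℝ => horizontalCoeff a μ (p + l • ((p.1, 0) : V × ℝ)))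
        (fderiv ℝ (horizontalCoeff a μ) p (p.1, 0)) 0 := by
      refine HasFDerivAt.comp_hasDerivAt (l := horizontalCoeff a μ)
        (f := fun l : ℝ => p + l • ((p.1, 0) : V × ℝ)) 0 ?_ (hline _)
      simpa using ((contDiffAt_horizontalCoeff ha haμ hp ht).differentiableAt one_ne_zero).hasFDerivAt
    have hN1 : HasDerivAt (fun l : ℝ => sqLen (p + l • ((p.1, 0) : V × ℝ))) (2 * ‖p.1‖ ^ 2) 0 := by
      have : (fun l : ℝ => sqLen (p + l • ((p.1, 0) : V × ℝ))) =
          fun l => (1 + l) ^ 2 * ‖p.1‖ ^ 2 + p.2 ^ 2 := by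
        funext l
        simp only [sqLen, Prod.fst_add, Prod.smul_fst, Prod.snd_add, Prod.smul_snd, smul_zero,
          add_zero]
        rw [show p.1 + l • p.1 = (1 + l) • p.1 by rw [add_smul, one_smul], norm_smul, mul_pow,
          Real.norm_eq_abs, sq_abs]
      rw [this]
      have h := ((((hasDerivAt_id' (0 : ℝ)).const_add 1).fun_pow 2).mul_const (‖p.1‖ ^ 2)).add_const
        (p.2 ^ 2)
      simpa using h
    have hT1 : HasDerivAt (fun l : ℝ => (p + l • ((p.1, 0) : V × ℝ)).2) 0 0 := by
      simpa using hasDerivAt_const (0 : ℝ) p.2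
    have hs1 : HasDerivAt (fun l : ℝ => cosAngle (p + l • ((p.1, 0) : V × ℝ))) _ 0 :=
      hasDerivAt_cosAngle_line hN1 hT1 (by simpa using hN)
    have hA1 := hasDerivAt_horizontal_line (q := profileRatio a μ) (μ := μ) hN1 hs1
      (by simpa using hN) (by simpa using hq')
    rw [hd.unique hA1]
    simp only [zero_smul, add_zero]
    generalize profileRatio a μ (cosAngle p) = q at *
    rw [hx2, ht2, hρ2]
    simp only [Real.sqrt_sq hρ.le]
    generalize √(sqLen p) = ρ at *
    generalize cosAngle p = s at *
    field_simp
    ring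
  have hB : fderiv ℝ (verticalCoeff a μ) p (0, 1) =
      (μ - 2 * μ * cosAngle p ^ 2 + (q' * (1 - cosAngle p ^ 2) -
        2 * profileRatio a μ (cosAngle p) * cosAngle p) * (1 - cosAngle p ^ 2) -
        profileRatio a μ (cosAngle p) * (1 - cosAngle p ^ 2) * cosAngle p) / √(sqLen p) ^ 2 := by
    have hd : HasDerivAt (fun l : ℝ => verticalCoeff a μ (p + l • ((0, 1) : V × ℝ)))
        (fderiv ℝ (verticalCoeff a μ) p (0, 1)) 0 := by
      refine HasFDerivAt.comp_hasDerivAt (l := verticalCoeff a μ)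
        (f := fun l : ℝ => p + l • ((0, 1) : V × ℝ)) 0 ?_ (hline _)
      simpa using ((contDiffAt_verticalCoeff ha haμ hp ht).differentiableAt one_ne_zero).hasFDerivAt
    have hT1 : HasDerivAt (fun l : ℝ => (p + l • ((0, 1) : V × ℝ)).2) 1 0 := by
      simpa using (hasDerivAt_id' (0 : ℝ)).const_add p.2
    have hN1 : HasDerivAt (fun l : ℝ => sqLen (p + l • ((0, 1) : V × ℝ))) (2 * p.2) 0 := by
      have := (hT1.fun_pow 2).const_add (‖p.1‖ ^ 2)
      simpa [sqLen] using this
    have hs1 : HasDerivAt (fun l : ℝ => cosAngle (p + l • ((0, 1) : V × ℝ))) _ 0 :=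
      hasDerivAt_cosAngle_line hN1 hT1 (by simpa using hN)
    have hB1 := hasDerivAt_vertical_line (q := profileRatio a μ) (μ := μ) hN1 hT1 hs1
      (by simpa using hN) (by simpa using hq')
    rw [hd.unique hB1]
    simp only [zero_smul, add_zero]
    generalize profileRatio a μ (cosAngle p) = q at *
    rw [ht2, hρ2]
    simp only [Real.sqrt_sq hρ.le]
    generalize √(sqLen p) = ρ at *
    generalize cosAngle p = s at *
    field_simp
    ring
  rw [hA, hB, hx2, horizontalCoeff, verticalCoeff, ht2, hρ2]
  simp only [Real.sqrt_sq hρ.le]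
  generalize profileRatio a μ (cosAngle p) = q at *
  generalize √(sqLen p) = ρ at *
  generalize cosAngle p = s at *
  field_simp
  -- Everything is now rational in ρ, s, q and q', and what remains is a multiple of the Riccati
  -- equation.
  linear_combination hric

end Field

/-! ### Green's identity with the calibrating field -/

section Green

variable {m : ℕ}

/-- The classical Euclidean gradient on `ℝᵐ × ℝ`. -/
noncomputable def grad (z : EuclideanSpace ℝ (Fin m) × ℝ → ℝ) (p : EuclideanSpace ℝ (Fin m) × ℝ) :
    EuclideanSpace ℝ (Fin m) × ℝ :=
  ((InnerProductSpace.toDual ℝ _).symm (fderiv ℝ z p ∘L ContinuousLinearMap.inl ℝ _ _),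
    fderiv ℝ z p (0, 1))

/-- The calibrating field, minus the logarithmic gradient of the virtual ground state. -/
noncomputable def calibration (a μ : ℝ) (p : EuclideanSpace ℝ (Fin m) × ℝ) :
    EuclideanSpace ℝ (Fin m) × ℝ :=
  (horizontalCoeff a μ p • p.1, verticalCoeff a μ p)

variable {z : EuclideanSpace ℝ (Fin m) × ℝ → ℝ} {a μ τ : ℝ}

lemma inner_grad_fst (z : EuclideanSpace ℝ (Fin m) × ℝ → ℝ) (p : EuclideanSpace ℝ (Fin m) × ℝ)
    (x : EuclideanSpace ℝ (Fin m)) : inner ℝ (grad z p).1 x = fderiv ℝ z p (x, 0) := by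
  simp [grad]

lemma fderiv_eq_grad (z : EuclideanSpace ℝ (Fin m) × ℝ → ℝ) (p e : EuclideanSpace ℝ (Fin m) × ℝ) :
    fderiv ℝ z p e = inner ℝ (grad z p).1 e.1 + (grad z p).2 * e.2 := by
  rw [inner_grad_fst]
  have : e = (e.1, 0) + e.2 • ((0, 1) : EuclideanSpace ℝ (Fin m) × ℝ) := by ext <;> simp
  conv_lhs => rw [this]
  rw [map_add, map_smul, smul_eq_mul, mul_comm]; rfl

lemma continuousAt_grad {p : EuclideanSpace ℝ (Fin m) × ℝ} (hz : ContDiffAt ℝ 1 z p) :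
    ContinuousAt (grad z) p := by
  have h : ContinuousAt (fderiv ℝ z) p := (hz.fderiv_right (m := 0) (by norm_num)).continuousAt
  refine ContinuousAt.prodMk ?_ (h.clm_apply continuousAt_const)
  exact (LinearIsometryEquiv.continuous _).continuousAt.comp (h.clm_comp continuousAt_const)

lemma grad_eq_zero_of_notMem {p : EuclideanSpace ℝ (Fin m) × ℝ} (hp : p ∉ tsupport z) :
    grad z p = 0 := by
  have : fderiv ℝ z p = 0 := by
    rw [(notMem_tsupport_iff_eventuallyEq.1 hp).fderiv_eq]
    exact fderiv_const_apply (0 : ℝ)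
  simp [grad, this]

/-- The coefficients of the field are singular at the origin. Off the support of z the product is
locally zero, so only their regularity on the support matters. -/
lemma contDiffAt_sq_mul {c : EuclideanSpace ℝ (Fin m) × ℝ → ℝ} {p : EuclideanSpace ℝ (Fin m) × ℝ}
    (hz : ContDiffAt ℝ 1 z p) (hc : p ∈ tsupport z → ContDiffAt ℝ 1 c p) :
    ContDiffAt ℝ 1 (fun p => z p ^ 2 * c p) p := by
  by_cases hp : p ∈ tsupport z
  · exact (hz.pow 2).mul (hc hp)
  · refine (contDiffAt_const (c := (0 : ℝ))).congr_of_eventuallyEq ?_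
    filter_upwards [notMem_tsupport_iff_eventuallyEq.1 hp] with x hx
    simp [hx]

lemma hasCompactSupport_sq_mul (hc : HasCompactSupport z) (c : EuclideanSpace ℝ (Fin m) × ℝ → ℝ) :
    HasCompactSupport fun p => z p ^ 2 * c p :=
  hc.mono fun p hp h => hp (by simp [h])

/-- Data common to the applications of Green's identity at height `τ`. -/
structure IsGreenTest (τ : ℝ) (z : EuclideanSpace ℝ (Fin m) × ℝ → ℝ) : Prop where
  nonneg : 0 ≤ τ
  compact : HasCompactSupport z
  smooth : ∀ p : EuclideanSpace ℝ (Fin m) × ℝ, τ ≤ p.2 → ContDiffAt ℝ 1 z p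
  ne_zero : ∀ p ∈ tsupport z, τ ≤ p.2 → p ≠ 0

namespace IsGreenTest

variable (h : IsGreenTest τ z) (ha : 0 < a) (haμ : a < 2 * μ)
include h

lemma integrableOn_grad : IntegrableOn (fun p => sqLen (grad z p)) (aboveHeight m τ) := by
  refine integrableOn_aboveHeight (fun p hp => ?_) (h.compact.mono' fun p hp => ?_)
  · exact ((contDiff_sqLen (k := 0)).continuous.continuousAt).comp
      (continuousAt_grad (h.smooth p hp))
  · by_contra hp'
    exact hp (by simp [grad_eq_zero_of_notMem hp', sqLen])

lemma integrableOn_sq_div : IntegrableOn (fun p => z p ^ 2 / sqLen p) (aboveHeight m τ) := by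
  simp_rw [div_eq_mul_inv]
  refine integrableOn_aboveHeight (fun p hp => ?_) (hasCompactSupport_sq_mul h.compact _)
  exact (contDiffAt_sq_mul (h.smooth p hp) fun hs => contDiff_sqLen.contDiffAt.inv
    (sqLen_pos (h.ne_zero p hs hp)).ne').continuousAt

include ha haμ

lemma contDiffAt_horizontal {p : EuclideanSpace ℝ (Fin m) × ℝ} (hp : τ ≤ p.2) :
    ContDiffAt ℝ 1 (fun p => z p ^ 2 * horizontalCoeff a μ p) p :=
  contDiffAt_sq_mul (h.smooth p hp) fun hs =>
    contDiffAt_horizontalCoeff ha haμ (h.ne_zero p hs hp) (h.nonneg.trans hp)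

lemma contDiffAt_vertical {p : EuclideanSpace ℝ (Fin m) × ℝ} (hp : τ ≤ p.2) :
    ContDiffAt ℝ 1 (fun p => z p ^ 2 * verticalCoeff a μ p) p :=
  contDiffAt_sq_mul (h.smooth p hp) fun hs =>
    contDiffAt_verticalCoeff ha haμ (h.ne_zero p hs hp) (h.nonneg.trans hp)

lemma integrable_boundary : Integrable fun x => z (x, τ) ^ 2 * verticalCoeff a μ (x, τ) := by
  refine Continuous.integrable_of_hasCompactSupport (continuous_iff_continuousAt.2 fun x => ?_)
    (hasCompactSupport_slice_left (hasCompactSupport_sq_mul h.compact (verticalCoeff a μ)) τ)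
  exact (h.contDiffAt_vertical ha haμ (p := (x, τ)) le_rfl).continuousAt.comp
    (f := fun x => (x, τ)) (by fun_prop)

lemma integral_divergence :
    ∫ p in aboveHeight m τ, ((m * (z p ^ 2 * horizontalCoeff a μ p) +
      fderiv ℝ (fun p => z p ^ 2 * horizontalCoeff a μ p) p (p.1, 0)) +
      fderiv ℝ (fun p => z p ^ 2 * verticalCoeff a μ p) p (0, 1)) =
      - ∫ x, z (x, τ) ^ 2 * verticalCoeff a μ (x, τ) := by
  have hA : ∀ p : EuclideanSpace ℝ (Fin m) × ℝ, τ ≤ p.2 → _ := fun p hp =>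
    h.contDiffAt_horizontal ha haμ hp
  have hB : ∀ p : EuclideanSpace ℝ (Fin m) × ℝ, τ ≤ p.2 → _ := fun p hp =>
    h.contDiffAt_vertical ha haμ hp
  have cA := hasCompactSupport_sq_mul h.compact (horizontalCoeff a μ)
  have cB := hasCompactSupport_sq_mul h.compact (verticalCoeff a μ)
  rw [integral_add, integral_horizontal_div_eq_zero hA cA, integral_vertical_deriv hB cB, zero_add]
  · refine integrableOn_aboveHeight (fun p hp => ?_) ?_
    · exact (continuousAt_const.mul (hA p hp).continuousAt).add
        ((hA p hp).continuousAt_fderiv_apply (by fun_prop))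
    · refine cA.mul_left.add (cA.fderiv (𝕜 := ℝ) |>.mono' ?_)
      exact subset_closure.trans' fun p hp h => hp (by simp [h])
  · exact integrableOn_aboveHeight (fun p hp => (hB p hp).continuousAt_fderiv_apply
      continuousAt_const) (cB.fderiv_apply (𝕜 := ℝ) _)

/-- Completing the square: |∇z + zF|² = |∇z|² + div(z²F) - z²(div F - |F|²), with the last bracket
given by `div_calibration`. Off the support of z both sides vanish. -/
lemma pointwise (hm : (m : ℝ) = 2 * μ + 1) {p : EuclideanSpace ℝ (Fin m) × ℝ} (hp : τ ≤ p.2) :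
    sqLen (grad z p + z p • calibration a μ p) =
      sqLen (grad z p) + ((m * (z p ^ 2 * horizontalCoeff a μ p) +
        fderiv ℝ (fun p => z p ^ 2 * horizontalCoeff a μ p) p (p.1, 0)) +
        fderiv ℝ (fun p => z p ^ 2 * verticalCoeff a μ p) p (0, 1)) -
      (μ - a) ^ 2 * (z p ^ 2 / sqLen p) := by
  by_cases hs : p ∈ tsupport z
  · have hp0 := h.ne_zero p hs hp
    have hz := ((h.smooth p hp).differentiableAt one_ne_zero).hasFDerivAt
    have hA := ((contDiffAt_horizontalCoeff ha haμ hp0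
      (h.nonneg.trans hp)).differentiableAt one_ne_zero).hasFDerivAt
    have hB := ((contDiffAt_verticalCoeff ha haμ hp0
      (h.nonneg.trans hp)).differentiableAt one_ne_zero).hasFDerivAt
    have hdiv := div_calibration ha haμ hp0 (h.nonneg.trans hp)
    have hz2 : HasFDerivAt (fun p => z p ^ 2) ((2 * z p) • fderiv ℝ z p) p := by
      refine (hz.pow 2).congr_fderiv ?_
      simp
    rw [(hz2.fun_mul hA).fderiv, (hz2.fun_mul hB).fderiv]
    have e2 : (grad z p).2 = fderiv ℝ z p (0, 1) := rfl
    simp only [sqLen, calibration, Prod.fst_add, Prod.snd_add, Prod.smul_fst, Prod.smul_snd,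
      smul_eq_mul]
    rw [norm_add_sq_real, inner_smul_right, inner_smul_right, inner_grad_fst, e2, hm,
      norm_smul, norm_smul, mul_pow, mul_pow, Real.norm_eq_abs, Real.norm_eq_abs, sq_abs, sq_abs]
    simp only [add_apply, smul_apply, smul_eq_mul]
    rw [sqLen] at hdiv
    linear_combination (- z p ^ 2) * hdiv
  · have h0 : z p = 0 := image_eq_zero_of_notMem_tsupport hs
    have hev := notMem_tsupport_iff_eventuallyEq.1 hs
    have h1 : ∀ c : EuclideanSpace ℝ (Fin m) × ℝ → ℝ, fderiv ℝ (fun p => z p ^ 2 * c p) p = 0 := by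
      intro c
      have : (fun p => z p ^ 2 * c p) =ᶠ[𝓝 p] fun _ => (0 : ℝ) := by
        filter_upwards [hev] with x hx
        simp [hx]
      rw [this.fderiv_eq]
      exact fderiv_const_apply (0 : ℝ)
    rw [h1, h1]
    simp [h0]

/-- Green's identity. -/
theorem integral_grad (hm : (m : ℝ) = 2 * μ + 1) :
    IntegrableOn (fun p => sqLen (grad z p + z p • calibration a μ p)) (aboveHeight m τ) ∧
    ∫ p in aboveHeight m τ, sqLen (grad z p) =
      (∫ x, z (x, τ) ^ 2 * verticalCoeff a μ (x, τ)) +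
      (μ - a) ^ 2 * (∫ p in aboveHeight m τ, z p ^ 2 / sqLen p) +
      ∫ p in aboveHeight m τ, sqLen (grad z p + z p • calibration a μ p) := by
  have hA : ∀ p : EuclideanSpace ℝ (Fin m) × ℝ, τ ≤ p.2 → _ := fun p hp =>
    h.contDiffAt_horizontal ha haμ hp
  have hB : ∀ p : EuclideanSpace ℝ (Fin m) × ℝ, τ ≤ p.2 → _ := fun p hp =>
    h.contDiffAt_vertical ha haμ hp
  have cA := hasCompactSupport_sq_mul h.compact (horizontalCoeff a μ)
  have cB := hasCompactSupport_sq_mul h.compact (verticalCoeff a μ)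
  have hI : IntegrableOn (fun p => (m * (z p ^ 2 * horizontalCoeff a μ p) +
      fderiv ℝ (fun p => z p ^ 2 * horizontalCoeff a μ p) p (p.1, 0)) +
      fderiv ℝ (fun p => z p ^ 2 * verticalCoeff a μ p) p (0, 1)) (aboveHeight m τ) := by
    refine integrableOn_aboveHeight (fun p hp => ?_) ?_
    · exact ((continuousAt_const.mul (hA p hp).continuousAt).add
        ((hA p hp).continuousAt_fderiv_apply (by fun_prop))).add
        ((hB p hp).continuousAt_fderiv_apply continuousAt_const)
    · refine (cA.mul_left.add (cA.fderiv (𝕜 := ℝ) |>.mono' ?_)).add (cB.fderiv_apply (𝕜 := ℝ) _)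
      exact subset_closure.trans' fun p hp h => hp (by simp [h])
  have hIg := h.integrableOn_grad
  have hIz := h.integrableOn_sq_div.const_mul ((μ - a) ^ 2)
  have hcongr : EqOn (fun p => sqLen (grad z p + z p • calibration a μ p)) _ (aboveHeight m τ) :=
    fun p (hp : τ < p.2) => h.pointwise ha haμ hm hp.le
  refine ⟨IntegrableOn.congr_fun ((hIg.add hI).sub hIz) hcongr.symm
    (measurableSet_aboveHeight τ), ?_⟩
  rw [setIntegral_congr_fun (measurableSet_aboveHeight τ) hcongr, integral_sub _ hIz,
    integral_add hIg hI, h.integral_divergence ha haμ, integral_const_mul]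
  · ring
  · exact hIg.add hI

end IsGreenTest

end Green

/-! ### Mollification above a positive height -/

section Mollify

/-- A function on the half-space need not be integrable near the boundary; restricting it to a
closed set inside makes convolution on the whole space meaningful. -/
lemma LocallyIntegrableOn.indicator_of_isClosed {X E : Type*} [TopologicalSpace X] [T2Space X]
    [LocallyCompactSpace X] [MeasurableSpace X] [OpensMeasurableSpace X] [NormedAddCommGroup E]
    {ν : Measure X} {f : X → E} {U S : Set X} (hf : LocallyIntegrableOn f U ν) (hS : IsClosed S)
    (hSU : S ⊆ U) : LocallyIntegrable (S.indicator f) ν := by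
  rw [locallyIntegrable_iff]
  intro K hK
  rw [IntegrableOn, integrable_indicator_iff hS.measurableSet, IntegrableOn,
    Measure.restrict_restrict hS.measurableSet]
  exact hf.integrableOn_compact_subset (inter_subset_left.trans hSU) (hK.inter_left hS)

lemma inner_le_half_sqLen {V : Type*} [NormedAddCommGroup V] [InnerProductSpace ℝ V]
    (v w : V × ℝ) : inner ℝ v.1 w.1 + v.2 * w.2 ≤ sqLen v / 2 + sqLen w / 2 := by
  have h1 := real_inner_le_norm v.1 w.1
  unfold sqLen
  nlinarith [sq_nonneg (‖v.1‖ - ‖w.1‖), sq_nonneg (v.2 - w.2)]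

lemma sqLen_nonneg {V : Type*} [NormedAddCommGroup V] (v : V × ℝ) : 0 ≤ sqLen v := by
  unfold sqLen; positivity

lemma sqLen_le_two_mul_norm_sq {V : Type*} [NormedAddCommGroup V] (v : V × ℝ) :
    sqLen v ≤ 2 * ‖v‖ ^ 2 := by
  have h1 := norm_fst_le v
  have h2 := norm_snd_le v
  rw [Real.norm_eq_abs] at h2
  unfold sqLen
  nlinarith [norm_nonneg v.1, abs_nonneg v.2, sq_abs v.2]

lemma norm_sq_le_sqLen {V : Type*} [NormedAddCommGroup V] (v : V × ℝ) :
    ‖v‖ ^ 2 ≤ sqLen v := by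
  unfold sqLen
  rw [Prod.norm_def, Real.norm_eq_abs]
  rcases max_cases ‖v.1‖ |v.2| with h | h <;> rw [h.1]
  · nlinarith [sq_nonneg v.2]
  · rw [sq_abs]; nlinarith [sq_nonneg ‖v.1‖]

variable {n : ℕ} {u : SplitSpace n → ℝ} {G : SplitSpace n → SplitSpace n}

instance isAddHaarMeasure_volume_splitSpace :
    (volume : Measure (SplitSpace n)).IsAddHaarMeasure := by
  rw [Measure.volume_eq_prod]; infer_instance

lemma measurableSet_halfSpace : MeasurableSet (halfSpace n) := measurableSet_aboveHeight 0

lemma isOpen_halfSpace : IsOpen (halfSpace n) := isOpen_lt continuous_const continuous_snd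

lemma integrableOn_sqLen_of_memLp (hG : MemLp G 2 (volume.restrict (halfSpace n))) :
    IntegrableOn (fun p => sqLen (G p)) (halfSpace n) := by
  refine Integrable.mono' ((hG.integrable_norm_pow two_ne_zero).const_mul 2) ?_
    (ae_of_all _ fun p => ?_)
  · exact (hG.1.fst.norm.pow 2).add (hG.1.snd.pow 2)
  · rw [Real.norm_of_nonneg (sqLen_nonneg _)]
    exact sqLen_le_two_mul_norm_sq _

/-- Mollification of the restriction of `u` to `{t ≥ τ / 4}`. -/
noncomputable def mollify (u : SplitSpace n → ℝ) (τ : ℝ) (φ : ContDiffBump (0 : SplitSpace n)) :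
    SplitSpace n → ℝ :=
  MeasureTheory.convolution (φ.normed volume) ({p : SplitSpace n | τ / 4 ≤ p.2}.indicator u)
    (ContinuousLinearMap.lsmul ℝ ℝ) volume

variable {τ : ℝ} {φ : ContDiffBump (0 : SplitSpace n)}

lemma locallyIntegrable_cutoff (hu : LocallyIntegrableOn u (halfSpace n)) (hτ : 0 < τ) :
    LocallyIntegrable ({p : SplitSpace n | τ / 4 ≤ p.2}.indicator u) :=
  LocallyIntegrableOn.indicator_of_isClosed hu (isClosed_atLeastHeight _)
    fun p (hp : τ / 4 ≤ p.2) => show 0 < p.2 by linarith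

lemma contDiff_mollify (hu : LocallyIntegrableOn u (halfSpace n)) (hτ : 0 < τ) :
    ContDiff ℝ 1 (mollify u τ φ) := by
  have := (φ.hasCompactSupport_normed (μ := volume)).contDiff_convolution_left (μ := volume)
    (n := 1) (ContinuousLinearMap.lsmul ℝ ℝ) φ.contDiff_normed (locallyIntegrable_cutoff hu hτ)
  exact_mod_cast this

/-- The derivative falls on the kernel, and y ↦ φ(p - y) is a legitimate test function for the weak
gradient. Its support lies at heights at least τ/2, where the cutoff at height τ/4 has no effect. -/
lemma fderiv_mollify (h : IsWeakGradient n u G) (hτ : 0 < τ) (hφ : φ.rOut ≤ τ / 2)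
    {p : SplitSpace n} (hp : τ ≤ p.2) (e : SplitSpace n) :
    fderiv ℝ (mollify u τ φ) p e =
      ∫ y in halfSpace n, (inner ℝ (G y).1 e.1 + (G y).2 * e.2) * φ.normed volume (p - y) := by
  set ψ : SplitSpace n → ℝ := fun y => φ.normed volume (p - y) with hψ
  have hφd : ContDiff ℝ ∞ (φ.normed volume) := φ.contDiff_normed
  have hψd : ContDiff ℝ ∞ ψ := hφd.comp (contDiff_const.sub contDiff_id)
  have hzero : ∀ y : SplitSpace n, y.2 < τ / 2 → p - y ∉ tsupport (φ.normed volume) := by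
    intro y hy hmem
    rw [φ.tsupport_normed_eq, mem_closedBall_zero_iff] at hmem
    have h1 := (norm_snd_le (p - y)).trans hmem
    rw [Prod.snd_sub, Real.norm_eq_abs] at h1
    linarith [le_abs_self (p.2 - y.2)]
  have hψs : tsupport ψ ⊆ {y | τ / 2 ≤ y.2} := by
    refine closure_minimal (fun y hy => ?_) (isClosed_atLeastHeight _)
    by_contra hlt
    exact hy (image_eq_zero_of_notMem_tsupport (f := φ.normed volume) (hzero y (not_le.1 hlt)))
  have hψc : HasCompactSupport ψ :=
    φ.hasCompactSupport_normed.comp_homeomorph (Homeomorph.subLeft p)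
  have hψf : ∀ y, fderiv ℝ ψ y e = - fderiv ℝ (φ.normed volume) (p - y) e := fun y => by
    have h1 : HasFDerivAt (fun y => p - y) (-ContinuousLinearMap.id ℝ (SplitSpace n)) y := by
      simpa using (hasFDerivAt_id y).const_sub p
    have h2 := ((hφd.differentiable (by simp)) (p - y)).hasFDerivAt.comp y h1
    rw [show ψ = φ.normed volume ∘ fun y => p - y from rfl, h2.fderiv]
    simp
  have hw := h.2.2 ψ hψd hψc (hψs.trans fun y (hy : τ / 2 ≤ y.2) =>
    show 0 < y.2 by linarith) e
  have hcu := locallyIntegrable_cutoff h.1 hτ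
  have hder := φ.hasCompactSupport_normed.hasFDerivAt_convolution_right
    (ContinuousLinearMap.lsmul ℝ ℝ).flip hcu (φ.contDiff_normed (μ := (volume : Measure (SplitSpace n))) (n := 1)) p
  rw [convolution_flip] at hder
  have hfd : fderiv ℝ (mollify u τ φ) p e = _ := congrArg (fun L => L e) hder.fderiv
  rw [hfd, convolution_precompR_apply _ hcu (φ.hasCompactSupport_normed.fderiv (𝕜 := ℝ))
    (φ.contDiff_normed (μ := (volume : Measure (SplitSpace n))) (n := 1) |>.continuous_fderiv one_ne_zero), convolution_def]
  simp only [ContinuousLinearMap.flip_apply, ContinuousLinearMap.lsmul_apply, smul_eq_mul]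
  have h3 : ∫ y in halfSpace n, u y * fderiv ℝ ψ y e =
      - ∫ y, fderiv ℝ (φ.normed volume) (p - y) e *
        ({p : SplitSpace n | τ / 4 ≤ p.2}.indicator u) y := by
    rw [← integral_indicator measurableSet_halfSpace, ← integral_neg]
    refine integral_congr_ae (ae_of_all _ fun y => ?_)
    simp only [indicator]
    by_cases hy : y.2 < τ / 2
    · have h0 : fderiv ℝ (φ.normed volume) (p - y) = 0 := by
        rw [(notMem_tsupport_iff_eventuallyEq.1 (hzero y hy)).fderiv_eq]
        exact fderiv_const_apply (0 : ℝ)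
      rw [hψf, h0]; simp
    · have h1 : y ∈ halfSpace n := show 0 < y.2 by linarith [not_lt.1 hy]
      have h2 : y ∈ {p : SplitSpace n | τ / 4 ≤ p.2} := show τ / 4 ≤ y.2 by linarith [not_lt.1 hy]
      rw [if_pos h1, if_pos h2, hψf]; ring
  linarith

lemma integrableOn_sqLen_mul_normed (hG : MemLp G 2 (volume.restrict (halfSpace n)))
    (p : SplitSpace n) :
    IntegrableOn (fun y => sqLen (G y) * φ.normed volume (p - y)) (halfSpace n) := by
  obtain ⟨C, hC⟩ := φ.hasCompactSupport_normed.exists_bound_of_continuous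
    (φ.continuous_normed (μ := volume))
  exact (integrableOn_sqLen_of_memLp hG).mul_bdd
    (φ.continuous_normed.comp (continuous_const.sub continuous_id)).aestronglyMeasurable
    (ae_of_all _ fun y => hC (p - y))

/-- Jensen's inequality, obtained by testing the gradient g against itself: |g|² = ∫ ⟨G, g⟩φ ≤ ½ ∫
|G|²φ + ½ |g|² ∫ φ with ∫ φ ≤ 1, and the last term is absorbed. -/
lemma sqLen_grad_mollify_le (h : IsWeakGradient n u G)
    (hG : MemLp G 2 (volume.restrict (halfSpace n))) (hτ : 0 < τ) (hφ : φ.rOut ≤ τ / 2)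
    {p : SplitSpace n} (hp : τ ≤ p.2) :
    sqLen (grad (mollify u τ φ) p) ≤
      ∫ y in halfSpace n, sqLen (G y) * φ.normed volume (p - y) := by
  set g := grad (mollify u τ φ) p with hg
  have h1 : sqLen g = ∫ y in halfSpace n,
      (inner ℝ (G y).1 g.1 + (G y).2 * g.2) * φ.normed volume (p - y) := by
    rw [← fderiv_mollify h hτ hφ hp, fderiv_eq_grad, ← hg, real_inner_self_eq_norm_sq, sqLen]; ring
  have hφc : Continuous fun y => φ.normed volume (p - y) :=
    φ.continuous_normed.comp (continuous_const.sub continuous_id)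
  have hφn : ∀ y, 0 ≤ φ.normed volume (p - y) := fun y => φ.nonneg_normed _
  have hφi : Integrable fun y => φ.normed volume (p - y) :=
    (integrable_comp_sub_left (φ.normed volume) p).2 φ.integrable_normed
  have hφ1 : ∫ y in halfSpace n, φ.normed volume (p - y) ≤ 1 := by
    refine (setIntegral_le_integral hφi (ae_of_all _ hφn)).trans_eq ?_
    rw [integral_sub_left_eq_self (φ.normed volume) volume p, φ.integral_normed]
  have hi1 := integrableOn_sqLen_mul_normed (φ := φ) hG p
  have hi2 : IntegrableOn (fun y => sqLen g * φ.normed volume (p - y)) (halfSpace n) :=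
    (hφi.const_mul _).integrableOn
  have hle : sqLen g ≤ ∫ y in halfSpace n,
      (1 / 2 * (sqLen (G y) * φ.normed volume (p - y)) +
        1 / 2 * (sqLen g * φ.normed volume (p - y))) := by
    refine h1.trans_le ?_
    have hi3 := (hi1.const_mul (1 / 2)).add (hi2.const_mul (1 / 2))
    refine integral_mono_ae (hi3.mono' ?_ (ae_of_all _ fun y => ?_)) hi3
      (ae_of_all _ fun y => ?_)
    · exact ((hG.1.fst.inner aestronglyMeasurable_const).add (hG.1.snd.mul_const _)).mul
        hφc.aestronglyMeasurable
    · rw [norm_mul, Real.norm_of_nonneg (hφn y), Pi.add_apply, ← mul_assoc, ← mul_assoc, ← add_mul,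
        Real.norm_eq_abs]
      refine mul_le_mul_of_nonneg_right (abs_le'.2 ⟨?_, ?_⟩) (hφn y)
      · linarith [inner_le_half_sqLen (G y) g]
      · have := inner_le_half_sqLen (G y) (-g)
        simp only [Prod.fst_neg, Prod.snd_neg, inner_neg_right, sqLen, norm_neg] at this
        unfold sqLen; linarith
    · have := mul_le_mul_of_nonneg_right (inner_le_half_sqLen (G y) g) (hφn y)
      linarith
  rw [integral_add (hi1.const_mul _) (hi2.const_mul _), integral_const_mul, integral_const_mul,
    integral_const_mul] at hle
  nlinarith [sqLen_nonneg g]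

lemma lintegral_sqLen_grad_mollify_le (h : IsWeakGradient n u G)
    (hG : MemLp G 2 (volume.restrict (halfSpace n))) (hτ : 0 < τ) (hφ : φ.rOut ≤ τ / 2) :
    ∫⁻ p in aboveHeight (n - 1) τ, ENNReal.ofReal (sqLen (grad (mollify u τ φ) p)) ≤
      ∫⁻ p in halfSpace n, ENNReal.ofReal (sqLen (G p)) := by
  have hφn : ∀ p y, 0 ≤ φ.normed volume (p - y) := fun p y => φ.nonneg_normed _
  have hGm : AEMeasurable (fun y => ENNReal.ofReal (sqLen (G y)))
      (volume.restrict (halfSpace n)) :=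
    (integrableOn_sqLen_of_memLp hG).1.aemeasurable.ennreal_ofReal
  calc ∫⁻ p in aboveHeight (n - 1) τ, ENNReal.ofReal (sqLen (grad (mollify u τ φ) p))
      ≤ ∫⁻ p in aboveHeight (n - 1) τ, ∫⁻ y in halfSpace n,
          ENNReal.ofReal (sqLen (G y)) * ENNReal.ofReal (φ.normed volume (p - y)) := by
        refine setLIntegral_mono' (measurableSet_aboveHeight τ) fun p (hp : τ < p.2) => ?_
        refine (ENNReal.ofReal_le_ofReal (sqLen_grad_mollify_le h hG hτ hφ hp.le)).trans ?_
        rw [ofReal_integral_eq_lintegral_ofReal (integrableOn_sqLen_mul_normed hG p)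
          (ae_of_all _ fun y => mul_nonneg (sqLen_nonneg _) (hφn p y))]
        simp_rw [ENNReal.ofReal_mul (sqLen_nonneg _)]
        rfl
    _ ≤ ∫⁻ p, ∫⁻ y in halfSpace n,
          ENNReal.ofReal (sqLen (G y)) * ENNReal.ofReal (φ.normed volume (p - y)) :=
        setLIntegral_le_lintegral _ _
    _ = ∫⁻ y in halfSpace n, ∫⁻ p,
          ENNReal.ofReal (sqLen (G y)) * ENNReal.ofReal (φ.normed volume (p - y)) := by
        refine lintegral_lintegral_swap ?_
        refine hGm.comp_snd.mul (Measurable.aemeasurable ?_)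
        exact ((φ.continuous_normed (μ := volume)).comp
          (continuous_fst.sub continuous_snd)).measurable.ennreal_ofReal
    _ = ∫⁻ y in halfSpace n, ENNReal.ofReal (sqLen (G y)) := by
        refine lintegral_congr fun y => ?_
        rw [lintegral_const_mul']
        · rw [lintegral_sub_right_eq_self (fun p => ENNReal.ofReal (φ.normed volume p)) y,
            ← ofReal_integral_eq_lintegral_ofReal φ.integrable_normed
              (ae_of_all _ φ.nonneg_normed), φ.integral_normed]
          simp
        · exact ENNReal.ofReal_ne_top

/-- Smooth approximation above a positive height. -/
lemma exists_smooth_approximation (h : IsWeakGradient n u G)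
    (hG : MemLp G 2 (volume.restrict (halfSpace n))) (hτ : 0 < τ) :
    ∃ w : ℕ → SplitSpace n → ℝ, (∀ k, ContDiff ℝ 1 (w k)) ∧
      (∀ᵐ p : SplitSpace n, τ < p.2 → Tendsto (fun k => w k p) atTop (𝓝 (u p))) ∧
      ∀ k, ∫⁻ p in aboveHeight (n - 1) τ, ENNReal.ofReal (sqLen (grad (w k) p)) ≤
        ∫⁻ p in halfSpace n, ENNReal.ofReal (sqLen (G p)) := by
  have hpos : ∀ k : ℕ, 0 < τ / 2 / (k + 1) := fun k => by positivity
  -- The radii shrink to 0 and stay below τ/2; the fixed ratio of outer to inner radius is what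
  -- almost everywhere convergence of the mollifications requires.
  let φ : ℕ → ContDiffBump (0 : SplitSpace n) := fun k =>
    ⟨τ / 2 / (k + 1) / 2, τ / 2 / (k + 1), half_pos (hpos k), half_lt_self (hpos k)⟩
  have hr : ∀ k, (φ k).rOut ≤ τ / 2 := fun k =>
    div_le_self (half_pos hτ).le (by linarith [Nat.cast_nonneg (α := ℝ) k])
  refine ⟨fun k => mollify u τ (φ k), fun k => contDiff_mollify h.1 hτ, ?_,
    fun k => lintegral_sqLen_grad_mollify_le h hG hτ (hr k)⟩
  have hlim : Tendsto (fun k => (φ k).rOut) atTop (𝓝 0) := by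
    have := (tendsto_one_div_add_atTop_nhds_zero_nat (𝕜 := ℝ)).const_mul (τ / 2)
    simpa [φ, div_eq_mul_inv] using this
  have hK : ∀ᶠ k in atTop, (φ k).rOut ≤ 2 * (φ k).rIn := Eventually.of_forall fun k =>
    show τ / 2 / (k + 1) ≤ 2 * (τ / 2 / (k + 1) / 2) by linarith
  filter_upwards [ContDiffBump.ae_convolution_tendsto_right_of_locallyIntegrable (μ := volume)
    hlim hK (locallyIntegrable_cutoff h.1 hτ)] with p hp hpτ
  have hmem : p ∈ {p : SplitSpace n | τ / 4 ≤ p.2} := show τ / 4 ≤ p.2 by linarith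
  rwa [indicator_of_mem hmem] at hp

end Mollify

/-! ### Horizontal slices and the existence of the trace -/

section Slices

lemma lintegral_le_of_tendsto_ae {α : Type*} [MeasurableSpace α] {ν : Measure α}
    {f : ℕ → α → ENNReal} {g : α → ENNReal} {A : ℕ → ENNReal} {B : ENNReal}
    (hf : ∀ k, AEMeasurable (f k) ν) (hlim : ∀ᵐ x ∂ν, Tendsto (fun k => f k x) atTop (𝓝 (g x)))
    (hA : ∀ k, ∫⁻ x, f k x ∂ν ≤ A k) (hB : Tendsto A atTop (𝓝 B)) : ∫⁻ x, g x ∂ν ≤ B :=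
  calc ∫⁻ x, g x ∂ν = ∫⁻ x, liminf (fun k => f k x) atTop ∂ν :=
        lintegral_congr_ae (hlim.mono fun _ hx => hx.liminf_eq.symm)
    _ ≤ liminf (fun k => ∫⁻ x, f k x ∂ν) atTop := lintegral_liminf_le' hf
    _ ≤ liminf A atTop := liminf_le_liminf (Eventually.of_forall hA)
    _ = B := hB.liminf_eq

lemma exists_mem_Ioo_of_ae {P : ℝ → Prop} (h : ∀ᵐ t, P t) {a b : ℝ} (hab : a < b) :
    ∃ t ∈ Ioo a b, P t := by
  have hne : (ae (volume.restrict (Ioo a b))).NeBot := by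
    rw [ae_neBot, Ne, Measure.restrict_eq_zero, Real.volume_Ioo, ENNReal.ofReal_eq_zero]
    linarith
  exact ((ae_restrict_mem measurableSet_Ioo).and (ae_restrict_of_ae h)).exists

lemma ae_ae_slice {m : ℕ} {P : EuclideanSpace ℝ (Fin m) × ℝ → Prop} (h : ∀ᵐ p, P p) :
    ∀ᵐ t : ℝ, ∀ᵐ x : EuclideanSpace ℝ (Fin m), P (x, t) := by
  have h1 : ∀ᵐ q ∂((volume : Measure ℝ).prod (volume : Measure (EuclideanSpace ℝ (Fin m)))),
      P q.swap := by
    rw [Measure.volume_eq_prod] at h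
    exact Measure.measurePreserving_swap.quasiMeasurePreserving.ae h
  exact Measure.ae_ae_of_ae_prod h1

/-- Cauchy–Schwarz, read off from the nonnegativity of the integral of ((t - s) f' - (f t - f s))².
-/
lemma sq_sub_le_mul_integral_sq {f f' : ℝ → ℝ} {s t : ℝ} (hst : s ≤ t)
    (hf : ∀ x, HasDerivAt f (f' x) x) (hc : Continuous f') :
    (f t - f s) ^ 2 ≤ (t - s) * ∫ x in s..t, f' x ^ 2 := by
  have hi : ∀ {g : ℝ → ℝ}, Continuous g → IntervalIntegrable g volume s t := fun hg =>
    hg.intervalIntegrable _ _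
  have h1 : ∫ x in s..t, f' x = f t - f s :=
    intervalIntegral.integral_eq_sub_of_hasDerivAt (fun x _ => hf x) (hi hc)
  have h2 : 0 ≤ ∫ x in s..t, ((t - s) * f' x - (f t - f s)) ^ 2 :=
    intervalIntegral.integral_nonneg hst fun x _ => sq_nonneg _
  have h3 : ∫ x in s..t, ((t - s) * f' x - (f t - f s)) ^ 2 =
      (t - s) ^ 2 * (∫ x in s..t, f' x ^ 2) - 2 * (t - s) * (f t - f s) * (f t - f s) +
        (t - s) * (f t - f s) ^ 2 := by
    have : ∀ x, ((t - s) * f' x - (f t - f s)) ^ 2 = (t - s) ^ 2 * f' x ^ 2 -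
        (2 * (t - s) * (f t - f s)) * f' x + (f t - f s) ^ 2 := fun x => by ring
    simp_rw [this]
    rw [intervalIntegral.integral_add ((hi (by fun_prop)).sub (hi (by fun_prop)))
      (hi continuous_const), intervalIntegral.integral_sub (hi (by fun_prop)) (hi (by fun_prop)),
      intervalIntegral.integral_const_mul, intervalIntegral.integral_const_mul, h1]
    simp
  rcases hst.eq_or_lt with rfl | hlt
  · simp
  · have h4 : 0 < t - s := sub_pos.2 hlt
    have h5 : 0 ≤ (t - s) * ((t - s) * (∫ x in s..t, f' x ^ 2) - (f t - f s) ^ 2) := by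
      rw [h3] at h2; linarith
    linarith [nonneg_of_mul_nonneg_right h5 h4]

variable {n : ℕ} {u : SplitSpace n → ℝ} {G : SplitSpace n → SplitSpace n}

lemma lintegral_sq_slice_sub_le_of_smooth {m : ℕ} {w : EuclideanSpace ℝ (Fin m) × ℝ → ℝ}
    (hw : ContDiff ℝ 1 w) {τ s t : ℝ} (hs : τ ≤ s) (hst : s ≤ t) :
    ∫⁻ x, ENNReal.ofReal ((w (x, t) - w (x, s)) ^ 2) ≤
      ENNReal.ofReal (t - s) * ∫⁻ p in aboveHeight m τ, ENNReal.ofReal (sqLen (grad w p)) := by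
  have hcg : Continuous (grad w) := continuous_iff_continuousAt.2 fun p =>
    continuousAt_grad hw.contDiffAt
  have hcs : Continuous fun p => sqLen (grad w p) :=
    (contDiff_sqLen (k := 0)).continuous.comp hcg
  rw [restrict_aboveHeight, lintegral_prod _ hcs.measurable.ennreal_ofReal.aemeasurable,
    ← lintegral_const_mul _ (by
      exact Measurable.lintegral_prod_right' hcs.measurable.ennreal_ofReal)]
  refine lintegral_mono fun x => ?_
  have hc2 : Continuous fun r => (grad w (x, r)).2 := by fun_prop
  have h1 := sq_sub_le_mul_integral_sq (f := fun r => w (x, r)) (f' := fun r => (grad w (x, r)).2)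
    hst (fun r => ?_) hc2
  · refine (ENNReal.ofReal_le_ofReal h1).trans ?_
    rw [ENNReal.ofReal_mul (sub_nonneg.2 hst)]
    gcongr
    have hc3 : Continuous fun r => (grad w (x, r)).2 ^ 2 := hc2.pow 2
    rw [intervalIntegral.integral_of_le hst, ofReal_integral_eq_lintegral_ofReal
      (hc3.integrableOn_Icc.mono_set Ioc_subset_Icc_self) (ae_of_all _ fun r => sq_nonneg _)]
    refine (lintegral_mono_set (show Ioc s t ⊆ Ioi τ from fun r hr => hs.trans_lt hr.1)).trans ?_
    refine lintegral_mono fun r => ENNReal.ofReal_le_ofReal ?_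
    simp only [sqLen]
    nlinarith [sq_nonneg ‖(grad w (x, r)).1‖]
  · exact ((hw.differentiable one_ne_zero (x, r)).hasFDerivAt).comp_hasDerivAt r
      ((hasDerivAt_const r x).prodMk (hasDerivAt_id r))

/-- The set of heights at which the slices of `u` behave well. -/
lemma exists_good_heights (h : IsWeakGradient n u G)
    (hG : MemLp G 2 (volume.restrict (halfSpace n))) :
    ∃ D : Set ℝ, (∀ᵐ t, t ∈ D) ∧
      (∀ t ∈ D, 0 < t → AEStronglyMeasurable (fun x => u (x, t)) volume) ∧
      ∀ s ∈ D, ∀ t ∈ D, 0 < s → 0 < t →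
        ∫⁻ x, ENNReal.ofReal ((u (x, t) - u (x, s)) ^ 2) ≤
          ENNReal.ofReal |t - s| * ∫⁻ p in halfSpace n, ENNReal.ofReal (sqLen (G p)) := by
  have hpos : ∀ k : ℕ, (0 : ℝ) < 1 / (k + 1) := fun k => Nat.one_div_pos_of_nat
  choose w hw hlim hbound using fun k : ℕ => exists_smooth_approximation h hG (hpos k)
  -- The k-th sequence approximates above height 1 / (k + 1). A height is good if all sequences
  -- reaching below it converge almost everywhere on its slice.
  set D : Set ℝ := {t | ∀ k : ℕ, ∀ᵐ x, (1 : ℝ) / (k + 1) < t →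
    Tendsto (fun j => w k j (x, t)) atTop (𝓝 (u (x, t)))} with hD
  have hslice : ∀ (k j : ℕ) (t : ℝ), Continuous fun x => w k j (x, t) := fun k j t =>
    (hw k j).continuous.comp (by fun_prop)
  refine ⟨D, ?_, ?_, ?_⟩
  · simp only [hD, mem_ofPred_eq]
    rw [ae_all_iff]
    exact fun k => ae_ae_slice (hlim k)
  · intro t ht ht0
    obtain ⟨k, hk⟩ := exists_nat_one_div_lt ht0
    refine aestronglyMeasurable_of_tendsto_ae atTop (f := fun j x => w k j (x, t))
      (fun j => (hslice k j t).aestronglyMeasurable) ?_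
    filter_upwards [ht k] with x hx using hx hk
  · have key : ∀ s ∈ D, ∀ t ∈ D, 0 < s → s ≤ t →
        ∫⁻ x, ENNReal.ofReal ((u (x, t) - u (x, s)) ^ 2) ≤
          ENNReal.ofReal (t - s) * ∫⁻ p in halfSpace n, ENNReal.ofReal (sqLen (G p)) := by
      intro s hs t ht hs0 hst
      obtain ⟨k, hk⟩ := exists_nat_one_div_lt hs0
      refine lintegral_le_of_tendsto_ae
        (f := fun j x => ENNReal.ofReal ((w k j (x, t) - w k j (x, s)) ^ 2))
        (fun j => Continuous.aemeasurable ?_) ?_ (fun j => ?_) tendsto_const_nhds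
      · exact ENNReal.continuous_ofReal.comp (((hslice k j t).sub (hslice k j s)).pow 2)
      · filter_upwards [hs k, ht k] with x hx hx'
        exact ENNReal.tendsto_ofReal (((hx' (hk.trans_le hst)).sub (hx hk)).pow 2)
      · refine (lintegral_sq_slice_sub_le_of_smooth (hw k j) hk.le hst).trans ?_
        exact mul_le_mul_right (hbound k j) _
    intro s hs t ht hs0 ht0
    rcases le_total s t with hst | hst
    · rw [abs_of_nonneg (sub_nonneg.2 hst)]
      exact key s hs t ht hs0 hst
    · rw [abs_sub_comm, abs_of_nonneg (sub_nonneg.2 hst)]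
      refine Eq.trans_le (lintegral_congr fun x => ?_) (key t ht s hs ht0 hst)
      congr 1; ring

lemma ae_locallyIntegrable_slice (hu : LocallyIntegrableOn u (halfSpace n)) {a b : ℝ} (ha : 0 < a) :
    ∀ᵐ t, t ∈ Icc a b → LocallyIntegrable fun x => u (x, t) := by
  have h1 : ∀ N : ℕ, ∀ᵐ t ∂(volume.restrict (Icc a b)),
      IntegrableOn (fun x => u (x, t)) (Metric.closedBall 0 N) := by
    intro N
    have hint : IntegrableOn u (Metric.closedBall (0 : EuclideanSpace ℝ (Fin (n - 1))) N ×ˢ Icc a b) :=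
      hu.integrableOn_compact_subset (fun p hp => ha.trans_le hp.2.1)
        ((isCompact_closedBall _ _).prod isCompact_Icc)
    rw [IntegrableOn, Measure.volume_eq_prod, ← Measure.prod_restrict] at hint
    exact hint.prod_left_ae
  have h2 := (ae_restrict_iff' measurableSet_Icc).1 (ae_all_iff.2 h1)
  filter_upwards [h2] with t ht htab x
  obtain ⟨N, hN⟩ := exists_nat_gt ‖x‖
  exact ⟨Metric.closedBall 0 N, Metric.closedBall_mem_nhds_of_mem (by simpa using hN), ht htab N⟩

lemma aestronglyMeasurable_sub_trace (hu : LocallyIntegrableOn u (halfSpace n))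
    {v : EuclideanSpace ℝ (Fin (n - 1)) → ℝ} (hv : AEStronglyMeasurable v volume)
    {S : Set (EuclideanSpace ℝ (Fin (n - 1)))} {r : ℝ} :
    AEStronglyMeasurable (fun p : SplitSpace n => u p - v p.1)
      ((volume.restrict S).prod (volume.restrict (Ioo 0 r))) := by
  have h1 := hu.aestronglyMeasurable
  rw [Measure.prod_restrict, ← Measure.volume_eq_prod]
  refine (h1.mono_set fun p hp => hp.2.1).sub ?_
  have h2 : AEStronglyMeasurable (fun p : SplitSpace n => v p.1) volume := by
    rw [Measure.volume_eq_prod]; exact hv.comp_fst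
  exact h2.restrict

/-- Every admissible function has a trace. -/
theorem exists_trace (h : IsAdmissible n u G) : ∃ v, IsTrace n u v := by
  obtain ⟨hw, hG, -⟩ := h
  obtain ⟨D, hDae, hDm, hD⟩ := exists_good_heights hw hG
  set A := ∫⁻ p in halfSpace n, ENNReal.ofReal (sqLen (G p)) with hA
  have hAtop : A ≠ ⊤ := by
    rw [hA, ← ofReal_integral_eq_lintegral_ofReal (integrableOn_sqLen_of_memLp hG)
      (ae_of_all _ fun p => sqLen_nonneg _)]
    exact ENNReal.ofReal_ne_top
  obtain ⟨t₀, ⟨ht₀, ht₀'⟩, ht₀D, ht₀i⟩ := exists_mem_Ioo_of_ae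
    (hDae.and (ae_locallyIntegrable_slice hw.1 (a := 1) (b := 2) one_pos)) one_lt_two
  have ht₀pos : 0 < t₀ := one_pos.trans ht₀
  have hpow : ∀ j : ℕ, (0 : ℝ) < (1 / 4) ^ j := fun j => by positivity
  -- Good heights in (0, 4⁻ʲ): the square root in the slice estimate turns 4⁻ʲ into the summable
  -- 2⁻ʲ.
  choose t htmem htD using fun j : ℕ => exists_mem_Ioo_of_ae hDae (hpow j)
  have htpos : ∀ j, 0 < t j := fun j => (htmem j).1
  have htlim : Tendsto t atTop (𝓝 0) :=
    squeeze_zero (fun j => (htpos j).le) (fun j => (htmem j).2.le)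
      (tendsto_pow_atTop_nhds_zero_of_lt_one (by norm_num) (by norm_num))
  have hnorm : ∀ s ∈ D, ∀ t ∈ D, 0 < s → 0 < t →
      eLpNorm (fun x => u (x, t) - u (x, s)) 2 volume ≤ (ENNReal.ofReal |t - s| * A) ^ (1 / 2 : ℝ) := by
    intro s hs t ht hs0 ht0
    rw [eLpNorm_eq_lintegral_rpow_enorm_toReal two_ne_zero ENNReal.ofNat_ne_top]
    simp only [ENNReal.toReal_ofNat]
    refine ENNReal.rpow_le_rpow (Eq.trans_le (lintegral_congr fun x => ?_)
      (hD s hs t ht hs0 ht0)) (by norm_num)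
    rw [← ofReal_norm, Real.norm_eq_abs, ENNReal.ofReal_rpow_of_nonneg (abs_nonneg _) (by norm_num)]
    norm_num
  -- Slices need not lie in L², only their differences do, so a locally integrable reference slice
  -- at height `t₀` is subtracted.
  let f : ℕ → EuclideanSpace ℝ (Fin (n - 1)) → ℝ := fun j x => u (x, t j) - u (x, t₀)
  have hfm : ∀ j, MemLp (f j) 2 volume := fun j =>
    ⟨(hDm _ (htD j) (htpos j)).sub (hDm _ ht₀D ht₀pos),
      (hnorm _ ht₀D _ (htD j) ht₀pos (htpos j)).trans_lt (ENNReal.rpow_lt_top_of_nonneg (by norm_num)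
        (ENNReal.mul_ne_top ENNReal.ofReal_ne_top hAtop))⟩
  set K := A ^ (1 / 2 : ℝ) with hK
  have hKtop : K ≠ ⊤ := (ENNReal.rpow_lt_top_of_nonneg (by norm_num) hAtop).ne
  -- `K + 1` in place of `K` makes the Cauchy estimate strict even when the energy is zero.
  have hB : ∑' N : ℕ, (1 / 2 : ENNReal) ^ N * (K + 1) ≠ ⊤ := by
    rw [ENNReal.tsum_mul_right]
    refine ENNReal.mul_ne_top ?_ (by simpa using hKtop)
    simp
  have hcau : ∀ N i j : ℕ, N ≤ i → N ≤ j →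
      eLpNorm (f i - f j) 2 volume < (1 / 2 : ENNReal) ^ N * (K + 1) := by
    intro N i j hi hj
    have e1 : f i - f j = fun x => u (x, t i) - u (x, t j) := by
      funext x; simp [f]
    rw [e1]
    have h1 : |t i - t j| ≤ (1 / 4) ^ N := by
      have hi' := pow_le_pow_of_le_one (by norm_num : (0 : ℝ) ≤ 1 / 4) (by norm_num) hi
      have hj' := pow_le_pow_of_le_one (by norm_num : (0 : ℝ) ≤ 1 / 4) (by norm_num) hj
      rw [abs_le]
      constructor <;> linarith [(htmem i).1, (htmem i).2, (htmem j).1, (htmem j).2]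
    calc _ ≤ (ENNReal.ofReal |t i - t j| * A) ^ (1 / 2 : ℝ) :=
          hnorm _ (htD j) _ (htD i) (htpos j) (htpos i)
      _ ≤ (ENNReal.ofReal ((1 / 4) ^ N) * A) ^ (1 / 2 : ℝ) := by gcongr
      _ = (1 / 2) ^ N * K := by
        rw [ENNReal.mul_rpow_of_nonneg _ _ (by norm_num), hK]
        congr 1
        rw [ENNReal.ofReal_rpow_of_nonneg (by positivity) (by norm_num)]
        have : (((1 : ℝ) / 4) ^ N) ^ (1 / 2 : ℝ) = (1 / 2) ^ N := by
          rw [← Real.sqrt_eq_rpow, show ((1 : ℝ) / 4) ^ N = ((1 / 2) ^ N) ^ 2 by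
            rw [← pow_mul, mul_comm, pow_mul]; norm_num]
          exact Real.sqrt_sq (by positivity)
        rw [this, ENNReal.ofReal_pow (by norm_num), ENNReal.ofReal_div_of_pos two_pos]
        simp
      _ < (1 / 2) ^ N * (K + 1) := by
        refine ENNReal.mul_lt_mul_right ?_ ?_ (ENNReal.lt_add_right hKtop one_ne_zero)
        · simp
        · simp
  obtain ⟨v₀, hv₀m, hv₀⟩ := Lp.cauchy_complete_eLpNorm (p := 2) (by norm_num) hfm hB hcau
  set v : EuclideanSpace ℝ (Fin (n - 1)) → ℝ := fun x => u (x, t₀) + v₀ x with hv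
  have hvi : LocallyIntegrable v := (ht₀i ⟨ht₀.le, ht₀'.le⟩).add
    (hv₀m.locallyIntegrable (by norm_num))
  obtain ⟨ns, hns, hae⟩ := (tendstoInMeasure_of_tendsto_eLpNorm (by norm_num)
    (fun j => (hfm j).1) hv₀m.1 hv₀).exists_seq_tendsto_ae
  have hdiff : ∀ r ∈ D, 0 < r → ∫⁻ x, ENNReal.ofReal ((u (x, r) - v x) ^ 2) ≤
      ENNReal.ofReal r * A := by
    intro r hr hr0
    refine lintegral_le_of_tendsto_ae
      (f := fun j x => ENNReal.ofReal ((u (x, r) - u (x, t (ns j))) ^ 2))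
      (A := fun j => ENNReal.ofReal |r - t (ns j)| * A)
      (fun j => ?_) ?_ (fun j => hD _ (htD _) _ hr (htpos _) hr0) ?_
    · exact (((hDm _ hr hr0).sub (hDm _ (htD _) (htpos _))).pow 2).aemeasurable.ennreal_ofReal
    · filter_upwards [hae] with x hx
      refine ENNReal.tendsto_ofReal ((tendsto_const_nhds.sub ?_).pow 2)
      have := hx.const_add (u (x, t₀))
      simpa [f, hv] using this
    · refine ENNReal.Tendsto.mul_const (ENNReal.tendsto_ofReal ?_) (Or.inr hAtop)
      have := (tendsto_const_nhds (x := r)).sub (htlim.comp hns.tendsto_atTop) |>.abs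
      simpa [abs_of_pos hr0] using this
  refine ⟨v, hvi, fun R => ?_⟩
  set V := volume (Metric.ball (0 : EuclideanSpace ℝ (Fin (n - 1))) R) with hV
  have hVtop : V ≠ ⊤ := measure_ball_lt_top.ne
  have hbound : ∀ r : ℝ, 0 < r →
      (∫⁻ p in Metric.ball (0 : EuclideanSpace ℝ (Fin (n - 1))) R ×ˢ Ioo (0 : ℝ) r,
        ‖u p - v p.1‖ₑ) / ENNReal.ofReal r ≤ ENNReal.ofReal (√r) * (V + A) := by
    intro r hr
    have hθ : 0 < √r := Real.sqrt_pos.2 hr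
    refine ENNReal.div_le_of_le_mul' ?_
    rw [Measure.volume_eq_prod, ← Measure.prod_restrict, lintegral_prod_symm _
      (aestronglyMeasurable_sub_trace hw.1 hvi.aestronglyMeasurable).enorm]
    calc ∫⁻ t in Ioo 0 r, ∫⁻ x in Metric.ball 0 R, ‖u (x, t) - v x‖ₑ
        ≤ ∫⁻ t in Ioo 0 r, ENNReal.ofReal (√r) * (V + A) := by
          refine lintegral_mono_ae ?_
          filter_upwards [ae_restrict_mem measurableSet_Ioo, ae_restrict_of_ae hDae] with t ht htD
          calc ∫⁻ x in Metric.ball 0 R, ‖u (x, t) - v x‖ₑ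
              ≤ ∫⁻ x in Metric.ball 0 R, (ENNReal.ofReal (√r) +
                  ENNReal.ofReal (1 / √r) * ENNReal.ofReal ((u (x, t) - v x) ^ 2)) := by
                -- Pointwise |d| ≤ √r + d² / √r. The weight √r balances the volume term against the
                -- slice bound t · A ≤ r · A, so both are of order √r.
                refine lintegral_mono fun x => ?_
                rw [← ofReal_norm, ← ENNReal.ofReal_mul (by positivity),
                  ← ENNReal.ofReal_add (by positivity) (by positivity)]
                refine ENNReal.ofReal_le_ofReal ?_
                rw [Real.norm_eq_abs, ← sq_abs (u (x, t) - v x)]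
                have h2 := abs_nonneg (u (x, t) - v x)
                field_simp
                nlinarith [sq_nonneg (√r - |u (x, t) - v x|), mul_nonneg hθ.le h2]
            _ ≤ ENNReal.ofReal (√r) * V + ENNReal.ofReal (1 / √r) * (ENNReal.ofReal t * A) := by
                rw [lintegral_add_left measurable_const, setLIntegral_const,
                  lintegral_const_mul' _ _ ENNReal.ofReal_ne_top]
                gcongr
                exact (setLIntegral_le_lintegral _ _).trans (hdiff t htD ht.1)
            _ ≤ ENNReal.ofReal (√r) * (V + A) := by
                rw [mul_add, ← mul_assoc, ← ENNReal.ofReal_mul (by positivity)]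
                gcongr
                rw [one_div, inv_mul_le_iff₀ hθ, Real.mul_self_sqrt hr.le]
                exact ht.2.le
      _ = ENNReal.ofReal r * (ENNReal.ofReal (√r) * (V + A)) := by
          rw [setLIntegral_const, Real.volume_Ioo, sub_zero, mul_comm]
  refine tendsto_of_tendsto_of_tendsto_of_le_of_le' (g := fun _ => 0)
    (h := fun r => ENNReal.ofReal (√r) * (V + A)) tendsto_const_nhds ?_
    (Eventually.of_forall fun r => zero_le) ?_
  · have h1 : Tendsto (fun r : ℝ => ENNReal.ofReal (√r)) (𝓝[>] 0) (𝓝 0) := by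
      have := ENNReal.tendsto_ofReal ((Real.continuous_sqrt.tendsto 0).mono_left
        (nhdsWithin_le_nhds (s := Ioi 0)))
      simpa using this
    have := ENNReal.Tendsto.mul_const h1 (Or.inr (ENNReal.add_ne_top.2 ⟨hVtop, hAtop⟩))
    simpa using this
  · filter_upwards [self_mem_nhdsWithin] with r hr using hbound r hr

end Slices

/-! ### The inequality on compactly supported smooth functions and its extension -/

section Tools

/-- Fatou for a boundary and a bulk integral sharing one bound. Each liminf is written as a supremum
of tail infima, so that a single large index controls both. -/
lemma lintegral_add_le_of_tendsto_ae {α β : Type*} [MeasurableSpace α] [MeasurableSpace β]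
    {ν : Measure α} {ρ : Measure β} {f : ℕ → α → ENNReal} {f' : α → ENNReal}
    {g : ℕ → β → ENNReal} {g' : β → ENNReal} {A : ℕ → ENNReal} {B c : ENNReal}
    (hf : ∀ k, AEMeasurable (f k) ν) (hg : ∀ k, AEMeasurable (g k) ρ)
    (hflim : ∀ᵐ x ∂ν, Tendsto (fun k => f k x) atTop (𝓝 (f' x)))
    (hglim : ∀ᵐ x ∂ρ, Tendsto (fun k => g k x) atTop (𝓝 (g' x)))
    (hA : ∀ k, ∫⁻ x, f k x ∂ν + c * ∫⁻ x, g k x ∂ρ ≤ A k) (hB : Tendsto A atTop (𝓝 B)) :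
    ∫⁻ x, f' x ∂ν + c * ∫⁻ x, g' x ∂ρ ≤ B := by
  have h1 : ∫⁻ x, f' x ∂ν ≤ ⨆ i, ⨅ k ≥ i, ∫⁻ x, f k x ∂ν := by
    rw [← liminf_eq_iSup_iInf_of_nat]
    exact (lintegral_congr_ae (hflim.mono fun _ hx => hx.liminf_eq.symm)).trans_le
      (lintegral_liminf_le' hf)
  have h2 : ∫⁻ x, g' x ∂ρ ≤ ⨆ i, ⨅ k ≥ i, ∫⁻ x, g k x ∂ρ := by
    rw [← liminf_eq_iSup_iInf_of_nat]
    exact (lintegral_congr_ae (hglim.mono fun _ hx => hx.liminf_eq.symm)).trans_le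
      (lintegral_liminf_le' hg)
  refine (add_le_add h1 (mul_le_mul_right h2 c)).trans ?_
  rw [ENNReal.mul_iSup]
  refine ENNReal.iSup_add_iSup_le fun i j => ge_of_tendsto hB ?_
  filter_upwards [eventually_ge_atTop (max i j)] with k hk
  refine le_trans (add_le_add ?_ (mul_le_mul_right ?_ c)) (hA k)
  · exact iInf₂_le k (le_of_max_le_left hk)
  · exact iInf₂_le k (le_of_max_le_right hk)

/-- A family of bounded smooth truncations, vanishing near zero and converging to the identity. -/
lemma exists_truncation : ∃ T : ℕ → ℝ → ℝ, (∀ j, ContDiff ℝ 1 (T j)) ∧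
    (∀ j s, |deriv (T j) s| ≤ 1) ∧ (∀ j, ∃ M δ : ℝ, 0 < δ ∧ ∀ s, |T j s| ≤ M ∧ (|s| ≤ δ → T j s = 0)) ∧
    ∀ s, Tendsto (fun j => T j s) atTop (𝓝 s) := by
  let c : ℝ → ℝ := fun x => max 0 (min 1 x)
  have hc : Continuous c := by fun_prop
  have hc0 : ∀ x, 0 ≤ c x := fun x => le_max_left _ _
  have hc1 : ∀ x, c x ≤ 1 := fun x => max_le zero_le_one (min_le_left _ _)
  have hcz : ∀ x, x ≤ 0 → c x = 0 := fun x hx => max_eq_left ((min_le_right _ _).trans hx)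
  have hco : ∀ x, 1 ≤ x → c x = 1 := fun x hx => by simp [c, min_eq_left hx]
  -- The truncation is the primitive of this weight, which is 0 for |σ| ≤ 1/(j+1) and |σ| ≥ 2(j+1),
  -- and 1 for 2/(j+1) ≤ |σ| ≤ j+1.
  let w : ℕ → ℝ → ℝ := fun j σ => c ((j + 1) * |σ| - 1) * c (2 - |σ| / (j + 1))
  have hw : ∀ j, Continuous (w j) := fun j => by
    refine (hc.comp (by fun_prop)).mul (hc.comp (by fun_prop))
  have hw0 : ∀ j σ, 0 ≤ w j σ := fun j σ => mul_nonneg (hc0 _) (hc0 _)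
  have hw1 : ∀ j σ, w j σ ≤ 1 := fun j σ => mul_le_one₀ (hc1 _) (hc0 _) (hc1 _)
  have hwn : ∀ j σ, ‖w j σ‖ ≤ 1 := fun j σ => by
    rw [Real.norm_of_nonneg (hw0 j σ)]; exact hw1 j σ
  have hder : ∀ j s, HasDerivAt (fun s => ∫ σ in (0 : ℝ)..s, w j σ) (w j s) s := fun j s =>
    (hw j).integral_hasStrictDerivAt 0 s |>.hasDerivAt
  refine ⟨fun j s => ∫ σ in (0 : ℝ)..s, w j σ, fun j => ?_, fun j s => ?_, fun j => ?_, fun s => ?_⟩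
  · rw [contDiff_one_iff_deriv]
    refine ⟨fun s => (hder j s).differentiableAt, ?_⟩
    rw [show deriv (fun s => ∫ σ in (0 : ℝ)..s, w j σ) = w j from funext fun s => (hder j s).deriv]
    exact hw j
  · rw [(hder j s).deriv]
    exact hwn j s
  · have hj : (0 : ℝ) < j + 1 := by positivity
    have hcs : HasCompactSupport (w j) := by
      refine HasCompactSupport.intro (isCompact_closedBall 0 (2 * ((j : ℝ) + 1))) fun σ hσ => ?_
      rw [mem_closedBall_zero_iff, not_le, Real.norm_eq_abs] at hσ
      have : c (2 - |σ| / (j + 1)) = 0 := hcz _ (by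
        rw [sub_nonpos, le_div_iff₀ hj]; exact hσ.le)
      simp [w, this]
    refine ⟨∫ σ, ‖w j σ‖, 1 / (j + 1), by positivity, fun s => ⟨?_, fun hs => ?_⟩⟩
    · show ‖∫ σ in (0 : ℝ)..s, w j σ‖ ≤ _
      refine intervalIntegral.norm_integral_le_integral_norm_uIoc.trans ?_
      exact setIntegral_le_integral ((hw j).integrable_of_hasCompactSupport hcs).norm
        (ae_of_all _ fun _ => norm_nonneg _)
    · refine intervalIntegral.integral_zero_ae (ae_of_all _ fun σ hσ => ?_)
      have h1 : |σ| ≤ |s| := by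
        rcases abs_cases s with h | h <;> rcases abs_cases σ with h' | h' <;>
        rcases Set.mem_uIoc.1 hσ with h'' | h'' <;> linarith
      have h2 : c ((j + 1) * |σ| - 1) = 0 := hcz _ (by
        have := h1.trans hs
        rw [le_div_iff₀ hj] at this
        linarith)
      simp [w, h2]
  · have h1 : Tendsto (fun j => ∫ σ in (0 : ℝ)..s, w j σ) atTop (𝓝 (∫ _ in (0 : ℝ)..s, (1 : ℝ))) := by
      refine intervalIntegral.tendsto_integral_filter_of_dominated_convergence (fun _ => 1)
        (Eventually.of_forall fun j => (hw j).aestronglyMeasurable)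
        (Eventually.of_forall fun j => ae_of_all _ fun σ _ => hwn j σ)
        intervalIntegrable_const ?_
      have hne : ∀ᵐ σ : ℝ, σ ≠ 0 := by simp [ae_iff]
      filter_upwards [hne] with σ hσ _
      have hpos := abs_pos.2 hσ
      refine tendsto_const_nhds.congr' ?_
      obtain ⟨N, hN⟩ := exists_nat_gt (max |σ| (2 / |σ|))
      filter_upwards [eventually_ge_atTop N] with j hj
      have hj' : (N : ℝ) ≤ j := by exact_mod_cast hj
      have h2 : |σ| ≤ j + 1 := by linarith [(le_max_left |σ| (2 / |σ|)).trans_lt hN]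
      have h3 : 2 / |σ| ≤ j + 1 := by linarith [(le_max_right |σ| (2 / |σ|)).trans_lt hN]
      have h4 : 2 ≤ (j + 1) * |σ| := by rwa [div_le_iff₀ hpos] at h3
      have h5 : |σ| / (j + 1) ≤ 1 := div_le_one_of_le₀ h2 (by positivity)
      show 1 = c ((j + 1) * |σ| - 1) * c (2 - |σ| / (j + 1))
      rw [hco _ (by linarith), hco _ (by linarith), one_mul]
    simpa using h1

lemma sqLen_smul {V : Type*} [NormedAddCommGroup V] [NormedSpace ℝ V] (r : ℝ) (v : V × ℝ) :
    sqLen (r • v) = r ^ 2 * sqLen v := by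
  simp only [sqLen, Prod.smul_fst, Prod.smul_snd, norm_smul, mul_pow, Real.norm_eq_abs, sq_abs,
    smul_eq_mul]
  ring

lemma sqLen_add_le {V : Type*} [NormedAddCommGroup V] {θ : ℝ} (hθ : 0 < θ) (v w : V × ℝ) :
    sqLen (v + w) ≤ (1 + θ) * sqLen v + (1 + 1 / θ) * sqLen w := by
  have key : ∀ a b : ℝ, (a + b) ^ 2 ≤ (1 + θ) * a ^ 2 + (1 + 1 / θ) * b ^ 2 := fun a b => by
    have h1 : 2 * a * b ≤ θ * a ^ 2 + 1 / θ * b ^ 2 := by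
      have : θ * a ^ 2 + 1 / θ * b ^ 2 - 2 * a * b = (θ * a - b) ^ 2 / θ := by field_simp; ring
      have := div_nonneg (sq_nonneg (θ * a - b)) hθ.le
      linarith
    nlinarith
  have h1 : ‖v.1 + w.1‖ ^ 2 ≤ (‖v.1‖ + ‖w.1‖) ^ 2 := by
    gcongr; exact norm_add_le _ _
  have h2 := key ‖v.1‖ ‖w.1‖
  have h3 := key v.2 w.2
  simp only [sqLen, Prod.fst_add, Prod.snd_add]
  linarith

variable {m : ℕ}

lemma grad_mul {f g : EuclideanSpace ℝ (Fin m) × ℝ → ℝ} {p : EuclideanSpace ℝ (Fin m) × ℝ}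
    (hf : DifferentiableAt ℝ f p) (hg : DifferentiableAt ℝ g p) :
    grad (fun p => f p * g p) p = f p • grad g p + g p • grad f p := by
  have h := (hf.hasFDerivAt.fun_mul hg.hasFDerivAt).fderiv
  unfold grad
  rw [h]
  simp [ContinuousLinearMap.add_comp, ContinuousLinearMap.smul_comp]

lemma grad_comp {T : ℝ → ℝ} {f : EuclideanSpace ℝ (Fin m) × ℝ → ℝ}
    {p : EuclideanSpace ℝ (Fin m) × ℝ} (hT : DifferentiableAt ℝ T (f p))
    (hf : DifferentiableAt ℝ f p) :
    grad (fun p => T (f p)) p = deriv T (f p) • grad f p := by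
  have h := (hT.hasDerivAt.comp_hasFDerivAt p hf.hasFDerivAt).fderiv
  unfold grad
  rw [show (fun p => T (f p)) = T ∘ f from rfl, h]
  simp [ContinuousLinearMap.smul_comp]

lemma sqLen_grad_le (f : EuclideanSpace ℝ (Fin m) × ℝ → ℝ) (p : EuclideanSpace ℝ (Fin m) × ℝ) :
    sqLen (grad f p) ≤ 2 * ‖fderiv ℝ f p‖ ^ 2 := by
  have h1 : ‖(grad f p).1‖ ≤ ‖fderiv ℝ f p‖ := by
    simp only [grad, LinearIsometryEquiv.norm_map]
    refine (ContinuousLinearMap.opNorm_comp_le _ _).trans (mul_le_of_le_one_right (norm_nonneg _) ?_)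
    exact ContinuousLinearMap.opNorm_le_bound _ zero_le_one fun x => by simp [Prod.norm_def]
  have h2 : |(grad f p).2| ≤ ‖fderiv ℝ f p‖ := by
    have := (fderiv ℝ f p).le_opNorm (0, 1)
    simpa [Prod.norm_def, grad] using this
  unfold sqLen
  nlinarith [norm_nonneg (grad f p).1, abs_nonneg (grad f p).2, sq_abs (grad f p).2]

/-- Cutoff functions at scale `R` with gradient of size `1 / R`. -/
lemma exists_cutoff (m : ℕ) : ∃ (χ : ℕ → EuclideanSpace ℝ (Fin m) × ℝ → ℝ) (C : ℝ), 0 ≤ C ∧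
    (∀ R, ContDiff ℝ 1 (χ R)) ∧ (∀ R, HasCompactSupport (χ R)) ∧ (∀ R p, |χ R p| ≤ 1) ∧
    (∀ R p, sqLen (grad (χ R) p) ≤ C / (R + 1) ^ 2) ∧
    ∀ p, Tendsto (fun R => χ R p) atTop (𝓝 1) := by
  let b : ContDiffBump (0 : EuclideanSpace ℝ (Fin m) × ℝ) := ⟨1, 2, one_pos, one_lt_two⟩
  have hb : ContDiff ℝ 1 b := b.contDiff
  obtain ⟨C, hC⟩ := (b.hasCompactSupport.fderiv (𝕜 := ℝ)).exists_bound_of_continuous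
    (hb.continuous_fderiv one_ne_zero)
  have hR : ∀ R : ℕ, ((R : ℝ) + 1)⁻¹ ≠ 0 := fun R => by positivity
  refine ⟨fun R p => b (((R : ℝ) + 1)⁻¹ • p), 2 * C ^ 2, by positivity, fun R => ?_, fun R => ?_,
    fun R p => ?_, fun R p => ?_, fun p => ?_⟩
  · exact hb.comp (contDiff_const_smul _)
  · exact b.hasCompactSupport.comp_smul (hR R)
  · rw [abs_of_nonneg b.nonneg]; exact b.le_one
  · refine (sqLen_grad_le _ _).trans ?_
    have h1 : fderiv ℝ (fun p => b (((R : ℝ) + 1)⁻¹ • p)) p =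
        ((R : ℝ) + 1)⁻¹ • fderiv ℝ b (((R : ℝ) + 1)⁻¹ • p) := fderiv_comp_smul _
    rw [h1, norm_smul, mul_pow, norm_inv, inv_pow, Real.norm_of_nonneg (by positivity), mul_left_comm,
      inv_mul_eq_div]
    gcongr
    exact hC _
  · refine tendsto_const_nhds.congr' ?_
    obtain ⟨N, hN⟩ := exists_nat_gt ‖p‖
    filter_upwards [eventually_ge_atTop N] with R hR'
    have h2 : (N : ℝ) ≤ R := by exact_mod_cast hR'
    refine (b.one_of_mem_closedBall ?_).symm
    rw [mem_closedBall_zero_iff, norm_smul, norm_inv, Real.norm_of_nonneg (by positivity)]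
    show _ ≤ (1 : ℝ)
    rw [inv_mul_le_iff₀ (by positivity)]; linarith

end Tools

/-! ### The inequality above a positive height. -/

section LowerBound

namespace IsGreenTest

variable {m : ℕ} {z : EuclideanSpace ℝ (Fin m) × ℝ → ℝ} {a μ τ : ℝ}

/-- The Hardy trace inequality for test functions, at height `τ`. -/
lemma lintegral_le (h : IsGreenTest τ z) (ha : 0 < a) (haμ : a < 2 * μ)
    (hm : (m : ℝ) = 2 * μ + 1) :
    (∫⁻ x, ENNReal.ofReal (z (x, τ) ^ 2 * verticalCoeff a μ (x, τ))) +
      ENNReal.ofReal ((μ - a) ^ 2) *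
        (∫⁻ p in aboveHeight m τ, ENNReal.ofReal (z p ^ 2 / sqLen p)) ≤
      ∫⁻ p in aboveHeight m τ, ENNReal.ofReal (sqLen (grad z p)) := by
  obtain ⟨h1, h2⟩ := h.integral_grad ha haμ hm
  have n1 : ∀ x, 0 ≤ z (x, τ) ^ 2 * verticalCoeff a μ (x, τ) := fun x =>
    mul_nonneg (sq_nonneg _) (verticalCoeff_nonneg ha haμ h.nonneg)
  have n2 : ∀ p, 0 ≤ z p ^ 2 / sqLen p := fun p => div_nonneg (sq_nonneg _) (sqLen_nonneg _)
  rw [← ofReal_integral_eq_lintegral_ofReal (h.integrable_boundary ha haμ) (ae_of_all _ n1),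
    ← ofReal_integral_eq_lintegral_ofReal h.integrableOn_sq_div (ae_of_all _ n2),
    ← ofReal_integral_eq_lintegral_ofReal h.integrableOn_grad
      (ae_of_all _ fun p => sqLen_nonneg _), ← ENNReal.ofReal_mul (sq_nonneg _),
    ← ENNReal.ofReal_add (integral_nonneg n1)
      (mul_nonneg (sq_nonneg _) (integral_nonneg n2)), h2]
  refine ENNReal.ofReal_le_ofReal ?_
  have : 0 ≤ ∫ p in aboveHeight m τ, sqLen (grad z p + z p • calibration a μ p) :=
    integral_nonneg fun p => sqLen_nonneg _
  linarith

end IsGreenTest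

variable {n : ℕ} {u : SplitSpace n → ℝ} {G : SplitSpace n → SplitSpace n}

lemma aboveHeight_mono {m : ℕ} {s t : ℝ} (hst : s ≤ t) : aboveHeight m t ⊆ aboveHeight m s :=
  fun _ hp => lt_of_le_of_lt hst hp

/-- `u` is approximated at height `τ` by smooth functions whose energy is at most `A`. -/
def IsApproximable (u : SplitSpace n → ℝ) (τ : ℝ) (A : ENNReal) : Prop :=
  ∃ w : ℕ → SplitSpace n → ℝ, (∀ k, ContDiff ℝ 1 (w k)) ∧
    (∀ᵐ p ∂(volume.restrict (aboveHeight (n - 1) τ)), Tendsto (fun k => w k p) atTop (𝓝 (u p))) ∧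
    (∀ᵐ x, Tendsto (fun k => w k (x, τ)) atTop (𝓝 (u (x, τ)))) ∧
    ∀ k, ∫⁻ p in aboveHeight (n - 1) τ, ENNReal.ofReal (sqLen (grad (w k) p)) ≤ A

lemma ae_isApproximable (h : IsWeakGradient n u G)
    (hG : MemLp G 2 (volume.restrict (halfSpace n))) :
    ∀ᵐ τ : ℝ, 0 < τ →
      IsApproximable u τ (∫⁻ p in halfSpace n, ENNReal.ofReal (sqLen (G p))) := by
  have hpos : ∀ k : ℕ, (0 : ℝ) < 1 / (k + 1) := fun k => Nat.one_div_pos_of_nat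
  choose w hw hlim hbound using fun k : ℕ => exists_smooth_approximation h hG (hpos k)
  filter_upwards [ae_all_iff.2 fun k => ae_ae_slice (hlim k)] with τ hτ hτ0
  obtain ⟨k, hk⟩ := exists_nat_one_div_lt hτ0
  refine ⟨w k, hw k, ?_, ?_, fun j => ?_⟩
  · refine (ae_restrict_iff' (measurableSet_aboveHeight τ)).2 ?_
    filter_upwards [hlim k] with p hp (hpτ : τ < p.2) using hp (hk.trans hpτ)
  · filter_upwards [hτ k] with x hx using hx hk
  · exact (lintegral_mono_set (aboveHeight_mono hk.le)).trans (hbound k j)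

variable {a μ τ : ℝ} {A : ENNReal}

lemma continuous_verticalCoeff_slice {m : ℕ} (ha : 0 < a) (haμ : a < 2 * μ) (hτ : 0 < τ) :
    Continuous fun x : EuclideanSpace ℝ (Fin m) => verticalCoeff a μ (x, τ) :=
  continuous_iff_continuousAt.2 fun x =>
    (contDiffAt_verticalCoeff ha haμ (p := (x, τ)) (fun h => hτ.ne' (congrArg Prod.snd h))
      hτ.le).continuousAt.comp (f := fun x => (x, τ)) (by fun_prop)

/-- Green's identity is applied to χ T(w k), whose support above height τ > 0 avoids the origin.
Young's inequality with weight θ separates (1 + θ)|∇w k|² from (1 + 1/θ) T(w k)² |∇χ|². The error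
passes to the limit by dominated convergence, since T is bounded and ∇χ has compact support; the
left side passes by Fatou. -/
lemma truncated_inequality (hu : IsApproximable u τ A) (ha : 0 < a) (haμ : a < 2 * μ)
    (hm : ((n - 1 : ℕ) : ℝ) = 2 * μ + 1) (hτ : 0 < τ) {T : ℝ → ℝ} (hT : ContDiff ℝ 1 T)
    (hT1 : ∀ s, |deriv T s| ≤ 1) {M : ℝ} (hM : ∀ s, |T s| ≤ M) {χ : SplitSpace n → ℝ}
    (hχ : ContDiff ℝ 1 χ) (hχc : HasCompactSupport χ) (hχ1 : ∀ p, |χ p| ≤ 1) {K : ℝ}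
    (hK : ∀ p, sqLen (grad χ p) ≤ K) {θ : ℝ} (hθ : 0 < θ) :
    (∫⁻ x, ENNReal.ofReal ((χ (x, τ) * T (u (x, τ))) ^ 2 * verticalCoeff a μ (x, τ))) +
      ENNReal.ofReal ((μ - a) ^ 2) * (∫⁻ p in aboveHeight (n - 1) τ,
        ENNReal.ofReal ((χ p * T (u p)) ^ 2 / sqLen p)) ≤
      ENNReal.ofReal (1 + θ) * A + ENNReal.ofReal ((1 + 1 / θ) * K) *
        ∫⁻ p in halfSpace n, ENNReal.ofReal (T (u p) ^ 2) := by
  obtain ⟨w, hw, hlim, hlimτ, hbound⟩ := hu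
  have hK0 : 0 ≤ K := (sqLen_nonneg _).trans (hK 0)
  have hz : ∀ k, ContDiff ℝ 1 fun p => χ p * T (w k p) := fun k => hχ.mul (hT.comp (hw k))
  have hcg : Continuous fun p => sqLen (grad χ p) := (contDiff_sqLen (k := 0)).continuous.comp
    (continuous_iff_continuousAt.2 fun p => continuousAt_grad hχ.contDiffAt)
  have hTw : ∀ k, Continuous fun p => T (w k p) := fun k => hT.continuous.comp (hw k).continuous
  have hgreen : ∀ k, IsGreenTest τ fun p => χ p * T (w k p) := fun k =>
    ⟨hτ.le, hχc.mul_right, fun p _ => (hz k).contDiffAt, fun p _ hp h0 => by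
      rw [h0] at hp; exact absurd hp (not_le.2 hτ)⟩
  have hgrad : ∀ k p, sqLen (grad (fun p => χ p * T (w k p)) p) ≤
      (1 + θ) * sqLen (grad (w k) p) + (1 + 1 / θ) * (T (w k p) ^ 2 * sqLen (grad χ p)) := by
    intro k p
    have hd := (hw k).differentiable one_ne_zero p
    have hTd := hT.differentiable one_ne_zero (w k p)
    have hTwd : DifferentiableAt ℝ (fun p => T (w k p)) p := hTd.comp p hd
    rw [grad_mul (hχ.differentiable one_ne_zero p) hTwd, grad_comp hTd hd, smul_smul]
    refine (sqLen_add_le hθ _ _).trans ?_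
    rw [sqLen_smul, sqLen_smul]
    gcongr ?_ + _
    refine mul_le_mul_of_nonneg_left (mul_le_of_le_one_left (sqLen_nonneg _) ?_) (by positivity)
    rw [← sq_abs, abs_mul]
    exact pow_le_one₀ (by positivity) (mul_le_one₀ (hχ1 p) (abs_nonneg _) (hT1 _))
  set E : ℕ → ENNReal := fun k => ∫⁻ p in aboveHeight (n - 1) τ,
    ENNReal.ofReal (T (w k p) ^ 2 * sqLen (grad χ p)) with hE
  have hElim : Tendsto E atTop (𝓝 (∫⁻ p in aboveHeight (n - 1) τ,
      ENNReal.ofReal (T (u p) ^ 2 * sqLen (grad χ p)))) := by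
    refine tendsto_lintegral_of_dominated_convergence
      (fun p => ENNReal.ofReal (M ^ 2 * sqLen (grad χ p)))
      (fun k => (((hTw k).pow 2).mul hcg).measurable.ennreal_ofReal)
      (fun k => ae_of_all _ fun p => ENNReal.ofReal_le_ofReal ?_) ?_ ?_
    · refine mul_le_mul_of_nonneg_right ?_ (sqLen_nonneg _)
      exact sq_le_sq.2 ((hM _).trans (le_abs_self M))
    · have hi : Integrable fun p => M ^ 2 * sqLen (grad χ p) := by
        refine (hcg.integrable_of_hasCompactSupport (hχc.mono' fun p hp => ?_)).const_mul _
        by_contra h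
        exact hp (by simp [grad_eq_zero_of_notMem h, sqLen])
      rw [← ofReal_integral_eq_lintegral_ofReal hi.integrableOn
        (ae_of_all _ fun p => mul_nonneg (sq_nonneg _) (sqLen_nonneg _))]
      exact ENNReal.ofReal_ne_top
    · filter_upwards [hlim] with p hp
      exact ENNReal.tendsto_ofReal (((hT.continuous.tendsto _).comp hp |>.pow 2).mul_const _)
  have hElim_le : ∫⁻ p in aboveHeight (n - 1) τ, ENNReal.ofReal (T (u p) ^ 2 * sqLen (grad χ p)) ≤
      ENNReal.ofReal K * ∫⁻ p in halfSpace n, ENNReal.ofReal (T (u p) ^ 2) := by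
    rw [← lintegral_const_mul' _ _ ENNReal.ofReal_ne_top]
    refine (lintegral_mono_set (aboveHeight_mono (m := n - 1) hτ.le)).trans
      (lintegral_mono fun p => ?_)
    rw [← ENNReal.ofReal_mul hK0, mul_comm K]
    exact ENNReal.ofReal_le_ofReal (mul_le_mul_of_nonneg_left (hK p) (sq_nonneg _))
  have hE' : Tendsto (fun k => ENNReal.ofReal (1 + θ) * A + ENNReal.ofReal (1 + 1 / θ) * E k) atTop
      (𝓝 (ENNReal.ofReal (1 + θ) * A + ENNReal.ofReal (1 + 1 / θ) *
        ∫⁻ p in aboveHeight (n - 1) τ, ENNReal.ofReal (T (u p) ^ 2 * sqLen (grad χ p)))) :=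
    tendsto_const_nhds.add (ENNReal.Tendsto.const_mul hElim (Or.inr ENNReal.ofReal_ne_top))
  refine (lintegral_add_le_of_tendsto_ae
    (f := fun k x => ENNReal.ofReal ((χ (x, τ) * T (w k (x, τ))) ^ 2 * verticalCoeff a μ (x, τ)))
    (g := fun k p => ENNReal.ofReal ((χ p * T (w k p)) ^ 2 / sqLen p))
    (fun k => ?_) (fun k => ?_) ?_ ?_ (fun k => ?_) hE').trans ?_
  · have h1 : Continuous fun x : EuclideanSpace ℝ (Fin (n - 1)) => χ (x, τ) * T (w k (x, τ)) :=
      (hz k).continuous.comp (by fun_prop)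
    exact ((h1.pow 2).mul (continuous_verticalCoeff_slice ha haμ hτ)).measurable.ennreal_ofReal.aemeasurable
  · exact (((hz k).continuous.pow 2).measurable.div
      (contDiff_sqLen (k := 0)).continuous.measurable).ennreal_ofReal.aemeasurable
  · filter_upwards [hlimτ] with x hx
    exact ENNReal.tendsto_ofReal ((((hT.continuous.tendsto _).comp hx).const_mul _ |>.pow 2).mul_const _)
  · filter_upwards [hlim] with p hp
    exact ENNReal.tendsto_ofReal ((((hT.continuous.tendsto _).comp hp).const_mul _ |>.pow 2).div_const _)
  · refine ((hgreen k).lintegral_le ha haμ hm).trans ?_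
    calc ∫⁻ p in aboveHeight (n - 1) τ, ENNReal.ofReal (sqLen (grad (fun p => χ p * T (w k p)) p))
        ≤ ∫⁻ p in aboveHeight (n - 1) τ, (ENNReal.ofReal (1 + θ) * ENNReal.ofReal (sqLen (grad (w k) p))
            + ENNReal.ofReal (1 + 1 / θ) * ENNReal.ofReal (T (w k p) ^ 2 * sqLen (grad χ p))) := by
          refine lintegral_mono fun p => ?_
          rw [← ENNReal.ofReal_mul (by positivity), ← ENNReal.ofReal_mul (by positivity),
            ← ENNReal.ofReal_add (mul_nonneg (by positivity) (sqLen_nonneg _))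
            (mul_nonneg (by positivity) (mul_nonneg (sq_nonneg _) (sqLen_nonneg _)))]
          exact ENNReal.ofReal_le_ofReal (hgrad k p)
      _ = ENNReal.ofReal (1 + θ) * (∫⁻ p in aboveHeight (n - 1) τ, ENNReal.ofReal (sqLen (grad (w k) p)))
            + ENNReal.ofReal (1 + 1 / θ) * E k := by
          rw [lintegral_add_right, lintegral_const_mul' _ _ ENNReal.ofReal_ne_top,
            lintegral_const_mul' _ _ ENNReal.ofReal_ne_top]
          exact (((hTw k).pow 2).mul hcg).measurable.ennreal_ofReal.const_mul _
      _ ≤ _ := by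
          gcongr
          exact hbound k
  · rw [ENNReal.ofReal_mul (by positivity), mul_assoc]
    exact add_le_add_right (mul_le_mul_right hElim_le _) _

/-- Vanishing at infinity enters here: T(u) is bounded and lives on {|u| > δ}, a set of finite
measure. This is why the truncations must vanish near zero. -/
lemma lintegral_truncation_lt_top (hv : VanishesAtInfinity n u) {T : ℝ → ℝ} {M δ : ℝ} (hδ : 0 < δ)
    (hT : ∀ s, |T s| ≤ M ∧ (|s| ≤ δ → T s = 0)) :
    ∫⁻ p in halfSpace n, ENNReal.ofReal (T (u p) ^ 2) < ⊤ := by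
  set S : Set (SplitSpace n) := {p | p ∈ halfSpace n ∧ δ < |u p|} with hS
  calc ∫⁻ p in halfSpace n, ENNReal.ofReal (T (u p) ^ 2)
      ≤ ∫⁻ p in halfSpace n, S.indicator (fun _ => ENNReal.ofReal (M ^ 2)) p := by
        refine setLIntegral_mono' measurableSet_halfSpace fun p hp => ?_
        by_cases hpS : p ∈ S
        · rw [indicator_of_mem hpS]
          exact ENNReal.ofReal_le_ofReal (sq_le_sq.2 ((hT _).1.trans (le_abs_self M)))
        · have : |u p| ≤ δ := not_lt.1 fun h => hpS ⟨hp, h⟩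
          rw [(hT _).2 this]; simp
    _ ≤ ∫⁻ p, S.indicator (fun _ => ENNReal.ofReal (M ^ 2)) p := setLIntegral_le_lintegral _ _
    _ ≤ ENNReal.ofReal (M ^ 2) * volume S := lintegral_indicator_const_le _ _
    _ < ⊤ := ENNReal.mul_lt_top ENNReal.ofReal_lt_top (hv δ hδ)

lemma inequality_at_height (hu : IsApproximable u τ A) (hv : VanishesAtInfinity n u) (ha : 0 < a)
    (haμ : a < 2 * μ) (hm : ((n - 1 : ℕ) : ℝ) = 2 * μ + 1) (hτ : 0 < τ) (hA : A ≠ ⊤) :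
    (∫⁻ x, ENNReal.ofReal (u (x, τ) ^ 2 * verticalCoeff a μ (x, τ))) +
      ENNReal.ofReal ((μ - a) ^ 2) *
        (∫⁻ p in aboveHeight (n - 1) τ, ENNReal.ofReal (u p ^ 2 / sqLen p)) ≤ A := by
  obtain ⟨T, hT, hT1, hTb, hTlim⟩ := exists_truncation
  obtain ⟨χ, C, hC, hχ, hχc, hχ1, hχK, hχlim⟩ := exists_cutoff (n - 1)
  have hu' := hu
  obtain ⟨w, hw, hlim, hlimτ, -⟩ := hu'
  have hm1 : AEMeasurable (fun x : EuclideanSpace ℝ (Fin (n - 1)) => u (x, τ)) :=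
    aemeasurable_of_tendsto_metrizable_ae atTop (f := fun k x => w k (x, τ))
      (fun k => ((hw k).continuous.comp (by fun_prop)).measurable.aemeasurable) hlimτ
  have hm2 : AEMeasurable u (volume.restrict (aboveHeight (n - 1) τ)) :=
    aemeasurable_of_tendsto_metrizable_ae atTop (f := fun k p => w k p)
      (fun k => (hw k).continuous.measurable.aemeasurable) hlim
  have hB := (continuous_verticalCoeff_slice (m := n - 1) ha haμ hτ).measurable
  have hN : Measurable (sqLen : SplitSpace n → ℝ) := (contDiff_sqLen (k := 0)).continuous.measurable
  -- remove the spatial cutoff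
  have step : ∀ j, (∫⁻ x, ENNReal.ofReal (T j (u (x, τ)) ^ 2 * verticalCoeff a μ (x, τ))) +
      ENNReal.ofReal ((μ - a) ^ 2) * (∫⁻ p in aboveHeight (n - 1) τ,
        ENNReal.ofReal (T j (u p) ^ 2 / sqLen p)) ≤ A := by
    intro j
    obtain ⟨M, δ, hδ, hTj⟩ := hTb j
    set Q := ∫⁻ p in halfSpace n, ENNReal.ofReal (T j (u p) ^ 2) with hQ
    have hQtop : Q ≠ ⊤ := (lintegral_truncation_lt_top hv hδ hTj).ne
    have hTm := (hT j).continuous.measurable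
    refine lintegral_add_le_of_tendsto_ae
      (f := fun R x => ENNReal.ofReal ((χ R (x, τ) * T j (u (x, τ))) ^ 2 *
        verticalCoeff a μ (x, τ)))
      (g := fun R p => ENNReal.ofReal ((χ R p * T j (u p)) ^ 2 / sqLen p))
      -- The choice θ = 1/(R+1) sends 1 + θ to 1, while the error factor (1 + 1/θ) C/(R+1)² is still
      -- O(1/R).
      (A := fun R => ENNReal.ofReal (1 + 1 / (R + 1)) * A +
        ENNReal.ofReal ((1 + 1 / (1 / ((R : ℝ) + 1))) * (C / (R + 1) ^ 2)) * Q)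
      (fun R => ?_) (fun R => ?_) (ae_of_all _ fun x => ?_) (ae_of_all _ fun p => ?_)
      (fun R => truncated_inequality hu ha haμ hm hτ (hT j) (hT1 j) (fun s => (hTj s).1) (hχ R)
        (hχc R) (hχ1 R) (hχK R) (by positivity)) ?_
    · have h1 : Measurable fun x : EuclideanSpace ℝ (Fin (n - 1)) => χ R (x, τ) :=
        ((hχ R).continuous.comp (by fun_prop)).measurable
      exact (((h1.aemeasurable.mul (hTm.comp_aemeasurable hm1)).pow_const 2).mul
        hB.aemeasurable).ennreal_ofReal
    · exact ((((hχ R).continuous.measurable.aemeasurable.mul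
        (hTm.comp_aemeasurable hm2)).pow_const 2).div hN.aemeasurable).ennreal_ofReal
    · refine ENNReal.tendsto_ofReal (Tendsto.mul_const _ ?_)
      simpa using ((hχlim (x, τ)).mul_const (T j (u (x, τ)))).pow 2
    · refine ENNReal.tendsto_ofReal (Tendsto.div_const ?_ _)
      simpa using ((hχlim p).mul_const (T j (u p))).pow 2
    · have e1 := tendsto_one_div_add_atTop_nhds_zero_nat (𝕜 := ℝ)
      have h1 : Tendsto (fun R : ℕ => ENNReal.ofReal (1 + 1 / ((R : ℝ) + 1))) atTop (𝓝 1) := by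
        simpa using ENNReal.tendsto_ofReal (e1.const_add 1)
      have h2 : Tendsto (fun R : ℕ => ENNReal.ofReal ((1 + 1 / (1 / ((R : ℝ) + 1))) *
          (C / (R + 1) ^ 2))) atTop (𝓝 0) := by
        have e2 := ((e1.pow 2).const_mul C).add (e1.const_mul C)
        have : ∀ R : ℕ, (1 + 1 / (1 / ((R : ℝ) + 1))) * (C / (R + 1) ^ 2) =
            C * (1 / ((R : ℝ) + 1)) ^ 2 + C * (1 / ((R : ℝ) + 1)) := fun R => by
          have : (R : ℝ) + 1 ≠ 0 := by positivity
          field_simp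
        simp_rw [this]
        simpa using ENNReal.tendsto_ofReal e2
      simpa using (ENNReal.Tendsto.mul_const h1 (Or.inr hA)).add
        (ENNReal.Tendsto.mul_const h2 (Or.inr hQtop))
  refine lintegral_add_le_of_tendsto_ae
    (f := fun j x => ENNReal.ofReal (T j (u (x, τ)) ^ 2 * verticalCoeff a μ (x, τ)))
    (g := fun j p => ENNReal.ofReal (T j (u p) ^ 2 / sqLen p))
    (fun j => ?_) (fun j => ?_) (ae_of_all _ fun x => ?_) (ae_of_all _ fun p => ?_) step
    tendsto_const_nhds
  · exact ((((hT j).continuous.measurable.comp_aemeasurable hm1).pow_const 2).mul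
      hB.aemeasurable).ennreal_ofReal
  · exact ((((hT j).continuous.measurable.comp_aemeasurable hm2).pow_const 2).div
      hN.aemeasurable).ennreal_ofReal
  · exact ENNReal.tendsto_ofReal (((hTlim _).pow 2).mul_const _)
  · exact ENNReal.tendsto_ofReal (((hTlim _).pow 2).div_const _)

end LowerBound

/-! ### Letting the height tend to zero. -/

section BoundaryLimit

variable {n : ℕ} {u : SplitSpace n → ℝ} {G : SplitSpace n → SplitSpace n}
  {v : EuclideanSpace ℝ (Fin (n - 1)) → ℝ}

/-- An averaging argument: if every good slice in (0, r) were more than ε away from the trace, the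
mean in the definition of `IsTrace` would be at least ε. -/
lemma exists_height_close_to_trace (hu : LocallyIntegrableOn u (halfSpace n)) (hv : IsTrace n u v)
    {P : ℝ → Prop} (hP : ∀ᵐ t, P t) (R : ℝ) {ε : ENNReal} (hε : 0 < ε) {b : ℝ} (hb : 0 < b) :
    ∃ t ∈ Ioo 0 b, P t ∧
      ∫⁻ x in Metric.ball (0 : EuclideanSpace ℝ (Fin (n - 1))) R, ‖u (x, t) - v x‖ₑ ≤ ε := by
  have hIoo : ∀ᶠ r in 𝓝[>] (0 : ℝ), r ∈ Ioo 0 b := Ioo_mem_nhdsGT hb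
  obtain ⟨r, ⟨hr0, hrb⟩, hr⟩ := (hIoo.and ((hv.2 R).eventually_lt_const hε)).exists
  by_contra! hcon
  refine hr.not_ge ?_
  have hr' : ENNReal.ofReal r ≠ 0 := by simpa using hr0
  rw [ENNReal.le_div_iff_mul_le (Or.inl hr') (Or.inl ENNReal.ofReal_ne_top)]
  rw [Measure.volume_eq_prod, ← Measure.prod_restrict, lintegral_prod_symm _
      (aestronglyMeasurable_sub_trace hu hv.1.aestronglyMeasurable).enorm]
  calc ε * ENNReal.ofReal r = ∫⁻ _ in Ioo 0 r, ε := by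
        rw [setLIntegral_const, Real.volume_Ioo, sub_zero]
    _ ≤ _ := by
        refine lintegral_mono_ae ?_
        filter_upwards [ae_restrict_mem measurableSet_Ioo, ae_restrict_of_ae hP] with t ht hPt
        exact (hcon t ⟨ht.1, ht.2.trans hrb⟩ hPt).le

/-- The j-th slice is taken within 2⁻ʲ of the trace in L¹ of the ball of radius j. On a fixed ball
the errors are summable, which forces almost everywhere convergence. -/
lemma exists_heights_tendsto_trace (hu : LocallyIntegrableOn u (halfSpace n)) (hv : IsTrace n u v)
    {P : ℝ → Prop} (hP : ∀ᵐ t, P t)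
    (hm : ∀ t, P t → 0 < t → AEStronglyMeasurable (fun x => u (x, t)) volume) :
    ∃ t : ℕ → ℝ, (∀ j, 0 < t j) ∧ (∀ j, P (t j)) ∧ Tendsto t atTop (𝓝 0) ∧
      ∀ᵐ x, Tendsto (fun j => u (x, t j)) atTop (𝓝 (v x)) := by
  have hε : ∀ j : ℕ, (0 : ENNReal) < (1 / 2) ^ j := fun j => by
    rw [pos_iff_ne_zero]; simp
  choose t ht htP hti using fun j : ℕ => exists_height_close_to_trace hu hv hP j (hε j)
    (Nat.one_div_pos_of_nat (α := ℝ) (n := j))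
  refine ⟨t, fun j => (ht j).1, htP, squeeze_zero (fun j => (ht j).1.le) (fun j => (ht j).2.le)
    tendsto_one_div_add_atTop_nhds_zero_nat, ?_⟩
  have hN : ∀ N : ℕ, ∀ᵐ x ∂(volume.restrict (Metric.ball 0 N)),
      Tendsto (fun j => u (x, t j)) atTop (𝓝 (v x)) := by
    intro N
    have hmeas : ∀ j, AEMeasurable (fun x => ‖u (x, t (j + N)) - v x‖ₑ)
        (volume.restrict (Metric.ball (0 : EuclideanSpace ℝ (Fin (n - 1))) N)) := fun j =>
      ((hm _ (htP _) (ht _).1).sub hv.1.aestronglyMeasurable).enorm.restrict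
    have hsum : ∫⁻ x in Metric.ball (0 : EuclideanSpace ℝ (Fin (n - 1))) N,
        ∑' j, ‖u (x, t (j + N)) - v x‖ₑ ≠ ⊤ := by
      rw [lintegral_tsum hmeas]
      have h1 : ∑' j : ℕ, (1 / 2 : ENNReal) ^ j ≠ ⊤ := by simp
      refine ne_top_of_le_ne_top h1 (ENNReal.tsum_le_tsum fun j => ?_)
      refine (lintegral_mono_set (Metric.ball_subset_ball ?_)).trans ((hti (j + N)).trans ?_)
      · push_cast; linarith [Nat.cast_nonneg (α := ℝ) j]
      · exact pow_le_pow_of_le_one zero_le (by simp) (Nat.le_add_right j N)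
    filter_upwards [ae_lt_top' (AEMeasurable.tsum hmeas) hsum] with x hx
    have h2 := ENNReal.tendsto_atTop_zero_of_tsum_ne_top hx.ne
    rw [← tendsto_add_atTop_iff_nat N, tendsto_iff_edist_tendsto_0]
    simpa [edist_eq_enorm_sub] using h2
  have hall := ae_all_iff.2 fun N : ℕ => (ae_restrict_iff' Metric.isOpen_ball.measurableSet).1 (hN N)
  filter_upwards [hall] with x hx
  obtain ⟨N, hN⟩ := exists_nat_gt ‖x‖
  exact hx N (by simpa using hN)

/-- The Hardy trace inequality. -/
theorem hardy_trace_inequality {a μ : ℝ} (h : IsAdmissible n u G) (hv : IsTrace n u v) (ha : 0 < a)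
    (haμ : a < 2 * μ) (hm : ((n - 1 : ℕ) : ℝ) = 2 * μ + 1) (hn : 2 ≤ n) :
    ENNReal.ofReal (profileRatio a μ 0) * (∫⁻ x, ENNReal.ofReal (v x ^ 2 / ‖x‖)) +
      ENNReal.ofReal ((μ - a) ^ 2) *
        (∫⁻ p in halfSpace n, ENNReal.ofReal (u p ^ 2 / sqLen p)) ≤
      ∫⁻ p in halfSpace n, ENNReal.ofReal (sqLen (G p)) := by
  obtain ⟨hw, hG, hvan⟩ := h
  obtain ⟨D, hDae, hDm, -⟩ := exists_good_heights hw hG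
  set A := ∫⁻ p in halfSpace n, ENNReal.ofReal (sqLen (G p)) with hA
  have hAtop : A ≠ ⊤ := by
    rw [hA, ← ofReal_integral_eq_lintegral_ofReal (integrableOn_sqLen_of_memLp hG)
      (ae_of_all _ fun p => sqLen_nonneg _)]
    exact ENNReal.ofReal_ne_top
  obtain ⟨t, ht0, htP, htlim, htv⟩ := exists_heights_tendsto_trace hw.1 hv
    (hDae.and (ae_isApproximable hw hG)) fun t ht => hDm t ht.1
  have hum : AEMeasurable u (volume.restrict (halfSpace n)) := hw.1.aestronglyMeasurable.aemeasurable
  have hN : Measurable (sqLen : SplitSpace n → ℝ) := (contDiff_sqLen (k := 0)).continuous.measurable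
  have hq : 0 ≤ profileRatio a μ 0 := (profileRatio_pos ha haμ (by norm_num)).le
  have hne : ∀ᵐ x : EuclideanSpace ℝ (Fin (n - 1)), x ≠ 0 := by
    have : Nonempty (Fin (n - 1)) := ⟨⟨0, by omega⟩⟩
    have : Nontrivial (EuclideanSpace ℝ (Fin (n - 1))) := inferInstance
    exact compl_mem_ae_iff.2 (measure_singleton 0)
  rw [← lintegral_const_mul' _ _ ENNReal.ofReal_ne_top]
  refine lintegral_add_le_of_tendsto_ae
    (f := fun j x => ENNReal.ofReal (u (x, t j) ^ 2 * verticalCoeff a μ (x, t j)))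
    (g := fun j => (aboveHeight (n - 1) (t j)).indicator
      fun p => ENNReal.ofReal (u p ^ 2 / sqLen p))
    (fun j => ?_) (fun j => ?_) ?_ ?_ (fun j => ?_) (tendsto_const_nhds (x := A))
  · exact (((hDm _ (htP j).1 (ht0 j)).aemeasurable.pow_const 2).mul
      (continuous_verticalCoeff_slice ha haμ (ht0 j)).measurable.aemeasurable).ennreal_ofReal
  · exact (((hum.pow_const 2).div hN.aemeasurable).ennreal_ofReal).indicator
      (measurableSet_aboveHeight _)
  · filter_upwards [htv, hne] with x hx hx0
    rw [← ENNReal.ofReal_mul hq]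
    refine ENNReal.tendsto_ofReal ?_
    -- Away from the origin the vertical coefficient is continuous up to the boundary, where it
    -- equals H / |x|.
    have hp : ((x, 0) : EuclideanSpace ℝ (Fin (n - 1)) × ℝ) ≠ 0 := fun h => hx0 (congrArg Prod.fst h)
    have h1 := (contDiffAt_verticalCoeff ha haμ hp le_rfl).continuousAt.tendsto
    rw [verticalCoeff_boundary] at h1
    have h2 := h1.comp ((tendsto_const_nhds (x := x)).prodMk_nhds htlim)
    have h3 := (hx.pow 2).mul h2
    rwa [show v x ^ 2 * (profileRatio a μ 0 / ‖x‖) = profileRatio a μ 0 * (v x ^ 2 / ‖x‖) by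
      ring] at h3
  · filter_upwards [ae_restrict_mem measurableSet_halfSpace] with p hp
    refine tendsto_const_nhds.congr' ?_
    filter_upwards [htlim.eventually_lt_const hp] with j hj
    rw [indicator_of_mem (show p ∈ aboveHeight (n - 1) (t j) from hj)]
  · have h1 := inequality_at_height ((htP j).2 (ht0 j)) hvan ha haμ hm (ht0 j) hAtop
    refine (add_le_add_right (mul_le_mul_right ?_ _) _).trans h1
    rw [lintegral_indicator (measurableSet_aboveHeight _),
      Measure.restrict_restrict (measurableSet_aboveHeight _)]
    exact lintegral_mono_set inter_subset_left

end BoundaryLimit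

/-! ### Smooth test functions are admissible -/

namespace IsGreenTest

variable {n : ℕ} {z : SplitSpace n → ℝ}

lemma contDiffAt (h : IsGreenTest 0 z) {p : SplitSpace n} (hp : p ∈ halfSpace n) :
    ContDiffAt ℝ 1 z p := h.smooth p (le_of_lt hp)

/-- The product zφ is C¹ on the whole space because φ is supported inside the half-space; its
directional derivative integrates to zero. -/
lemma isWeakGradient (h : IsGreenTest 0 z) : IsWeakGradient n z (grad z) := by
  have hopen : IsOpen (halfSpace n) := isOpen_halfSpace
  refine ⟨?_, ?_, fun φ hφ hφc hφs e => ?_⟩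
  · exact ContinuousOn.locallyIntegrableOn
      (fun p hp => (h.contDiffAt hp).continuousAt.continuousWithinAt) hopen.measurableSet
  · exact ContinuousOn.locallyIntegrableOn
      (fun p hp => (continuousAt_grad (h.contDiffAt hp)).continuousWithinAt) hopen.measurableSet
  have hφ1 : ContDiff ℝ 1 φ := hφ.of_le (by exact_mod_cast le_top)
  have hprod : ContDiff ℝ 1 fun p => z p * φ p := by
    rw [contDiff_iff_contDiffAt]
    intro p
    by_cases hp : p ∈ tsupport φ
    · exact (h.contDiffAt (hφs hp)).mul hφ1.contDiffAt
    · refine (contDiffAt_const (c := (0 : ℝ))).congr_of_eventuallyEq ?_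
      filter_upwards [notMem_tsupport_iff_eventuallyEq.1 hp] with x hx
      simp [hx]
  have hzero := integral_fderiv_apply_eq_zero (ν := (volume : Measure (SplitSpace n))) hprod
    hφc.mul_left e
  have hcz : ContinuousOn z (halfSpace n) := fun p hp =>
    (h.contDiffAt hp).continuousAt.continuousWithinAt
  have hcg : ContinuousOn (fun p => fderiv ℝ z p e) (halfSpace n) := fun p hp =>
    ((h.contDiffAt hp).continuousAt_fderiv_apply continuousAt_const).continuousWithinAt
  have hcφ : Continuous fun p => fderiv ℝ φ p e :=
    (hφ1.continuous_fderiv one_ne_zero).clm_apply continuous_const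
  have hK : IsCompact (tsupport φ) := hφc
  have i1 : IntegrableOn (fun p => z p * fderiv ℝ φ p e) (halfSpace n) :=
    IntegrableOn.of_forall_sdiff_eq_zero
      (((hcz.mono hφs).mul hcφ.continuousOn).integrableOn_compact hK) hopen.measurableSet
      fun p hp => by
        have : fderiv ℝ φ p = 0 := by
          rw [(notMem_tsupport_iff_eventuallyEq.1 hp.2).fderiv_eq]
          exact fderiv_const_apply (0 : ℝ)
        simp [this]
  have i2 : IntegrableOn (fun p => fderiv ℝ z p e * φ p) (halfSpace n) :=
    IntegrableOn.of_forall_sdiff_eq_zero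
      (((hcg.mono hφs).mul hφ1.continuous.continuousOn).integrableOn_compact hK) hopen.measurableSet
      fun p hp => by simp [image_eq_zero_of_notMem_tsupport hp.2]
  have hsplit : ∫ p, fderiv ℝ (fun p => z p * φ p) p e =
      ∫ p in halfSpace n, (z p * fderiv ℝ φ p e + fderiv ℝ z p e * φ p) := by
    rw [← integral_indicator hopen.measurableSet]
    refine integral_congr_ae (ae_of_all _ fun p => ?_)
    by_cases hp : p ∈ halfSpace n
    · simp only [indicator_of_mem hp]
      have hd := ((h.contDiffAt hp).differentiableAt one_ne_zero).hasFDerivAt.fun_mul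
        (hφ1.differentiable one_ne_zero p).hasFDerivAt
      rw [hd.fderiv]
      simp [mul_comm]
    · simp only [indicator_of_notMem hp]
      have hp' : p ∉ tsupport φ := fun h => hp (hφs h)
      have : (fun p => z p * φ p) =ᶠ[𝓝 p] fun _ => (0 : ℝ) := by
        filter_upwards [notMem_tsupport_iff_eventuallyEq.1 hp'] with x hx
        simp [hx]
      rw [this.fderiv_eq, fderiv_const_apply]; rfl
  rw [hsplit, integral_add i1 i2] at hzero
  simp_rw [← fderiv_eq_grad]
  linarith

lemma isAdmissible (h : IsGreenTest 0 z) : IsAdmissible n z (grad z) := by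
  refine ⟨h.isWeakGradient, ?_, fun c hc => ?_⟩
  · have hm : AEStronglyMeasurable (grad z) (volume.restrict (halfSpace n)) :=
      ContinuousOn.aestronglyMeasurable
        (fun p hp => (continuousAt_grad (h.contDiffAt hp)).continuousWithinAt)
        measurableSet_halfSpace
    rw [memLp_two_iff_integrable_sq_norm hm]
    refine Integrable.mono' h.integrableOn_grad (hm.norm.pow 2) (ae_of_all _ fun p => ?_)
    rw [Real.norm_of_nonneg (sq_nonneg _)]
    exact norm_sq_le_sqLen _
  · refine (measure_mono fun p hp => ?_).trans_lt (IsCompact.measure_lt_top h.compact)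
    by_contra hp'
    have := hp.2
    rw [image_eq_zero_of_notMem_tsupport hp', abs_zero] at this
    linarith

lemma isTrace (h : IsGreenTest 0 z) : IsTrace n z fun x => z (x, 0) := by
  have hcont : Continuous fun x : EuclideanSpace ℝ (Fin (n - 1)) => z (x, 0) :=
    continuous_iff_continuousAt.2 fun x => (h.smooth (x, 0) le_rfl).continuousAt.comp
      (f := fun x => (x, 0)) (by fun_prop)
  refine ⟨hcont.locallyIntegrable, fun R => ?_⟩
  set V := volume (Metric.ball (0 : EuclideanSpace ℝ (Fin (n - 1))) R) with hV
  have hVtop : V ≠ ⊤ := measure_ball_lt_top.ne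
  have huc : UniformContinuousOn z
      (Metric.closedBall (0 : EuclideanSpace ℝ (Fin (n - 1))) R ×ˢ Icc (0 : ℝ) 1) :=
    ((isCompact_closedBall _ _).prod isCompact_Icc).uniformContinuousOn_of_continuous
      fun p hp => (h.smooth p hp.2.1).continuousAt.continuousWithinAt
  have hV0 := ENNReal.toReal_nonneg (a := V)
  rw [ENNReal.tendsto_nhds_zero]
  intro ε hε
  rcases eq_or_ne ε ⊤ with rfl | hεtop
  · exact Eventually.of_forall fun _ => le_top
  -- The `+ 1` keeps the denominator positive when the ball is empty.
  set δ := ε.toReal / (V.toReal + 1) with hδ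
  have hδ0 : 0 < δ := div_pos (ENNReal.toReal_pos hε.ne' hεtop) (by linarith)
  obtain ⟨r₀, hr₀, hr₀'⟩ := Metric.uniformContinuousOn_iff.1 huc δ hδ0
  have hIoo : ∀ᶠ r in 𝓝[>] (0 : ℝ), r ∈ Ioo 0 (min r₀ 1) := Ioo_mem_nhdsGT (lt_min hr₀ one_pos)
  filter_upwards [hIoo] with r hr
  refine ENNReal.div_le_of_le_mul ?_
  calc ∫⁻ p in Metric.ball (0 : EuclideanSpace ℝ (Fin (n - 1))) R ×ˢ Ioo (0 : ℝ) r,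
        ‖z p - z (p.1, 0)‖ₑ
      ≤ ∫⁻ p in Metric.ball (0 : EuclideanSpace ℝ (Fin (n - 1))) R ×ˢ Ioo (0 : ℝ) r,
        ENNReal.ofReal δ := by
        refine setLIntegral_mono' (Metric.isOpen_ball.measurableSet.prod measurableSet_Ioo)
          fun p hp => ?_
        have h1 := Metric.ball_subset_closedBall hp.1
        have h2 : p.2 ≤ 1 := (hp.2.2.trans (hr.2.trans_le (min_le_right _ _))).le
        have h3 : p.2 < r₀ := hp.2.2.trans (hr.2.trans_le (min_le_left _ _))
        have h4 := hr₀' p ⟨h1, hp.2.1.le, h2⟩ (p.1, 0) ⟨h1, le_rfl, zero_le_one⟩ (by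
          rw [Prod.dist_eq, dist_self, Real.dist_eq, sub_zero, abs_of_pos hp.2.1]
          exact max_lt hr₀ h3)
        rw [← ofReal_norm, ← dist_eq_norm]
        exact ENNReal.ofReal_le_ofReal h4.le
    _ = ENNReal.ofReal δ * (V * ENNReal.ofReal r) := by
        rw [setLIntegral_const, Measure.volume_eq_prod, Measure.prod_prod, Real.volume_Ioo, sub_zero]
    _ ≤ ε * ENNReal.ofReal r := by
        rw [← mul_assoc]
        gcongr
        rw [← ENNReal.ofReal_toReal hVtop, ← ENNReal.ofReal_mul hδ0.le, hδ]
        refine ENNReal.ofReal_le_of_le_toReal ?_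
        rw [div_mul_eq_mul_div, div_le_iff₀ (by linarith)]
        nlinarith [ENNReal.toReal_nonneg (a := ε)]

end IsGreenTest

/-! ### The virtual ground state and optimality -/

/-! ### Logarithmic mass of shells. -/

section Shell

variable {E : Type*} [NormedAddCommGroup E] [NormedSpace ℝ E] [FiniteDimensional ℝ E]
  [Nontrivial E] [MeasurableSpace E] [BorelSpace E] (ν : Measure E) [ν.IsAddHaarMeasure]

lemma eqOn_pow_mul_indicator_inv_pow {r s : ℝ} (hr : 0 < r) {d : ℕ} (hd : d ≠ 0) :
    (fun y : ℝ => y ^ (d - 1) • (Icc r s).indicator (fun y => (y ^ d)⁻¹) y) =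
      (Icc r s).indicator fun y => y⁻¹ := by
  funext y
  by_cases hy : y ∈ Icc r s
  · have hy0 : 0 < y := hr.trans_le hy.1
    obtain ⟨k, rfl⟩ := Nat.exists_eq_succ_of_ne_zero hd
    simp only [indicator_of_mem hy, smul_eq_mul, Nat.succ_eq_add_one, Nat.add_sub_cancel]
    field_simp
    rw [pow_succ]
  · simp [hy]

lemma integrable_shell {r s : ℝ} (hr : 0 < r) :
    Integrable (fun x : E =>
      (Icc r s).indicator (fun y => (y ^ Module.finrank ℝ E)⁻¹) ‖x‖) ν := by
  rw [integrable_fun_norm_addHaar ν, eqOn_pow_mul_indicator_inv_pow hr Module.finrank_pos.ne']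
  refine IntegrableOn.integrable_indicator ?_ measurableSet_Icc |>.integrableOn
  exact (continuousOn_inv₀.mono fun y hy => (hr.trans_le hy.1).ne').integrableOn_Icc

/-- In polar coordinates y^(d-1) y^(-d) = 1/y, whence the logarithm. An arbitrary norm is allowed
because the built-in norm of `SplitSpace` is a maximum. -/
lemma integral_shell {r s : ℝ} (hr : 0 < r) (hrs : r ≤ s) :
    ∫ x : E, (Icc r s).indicator (fun y => (y ^ Module.finrank ℝ E)⁻¹) ‖x‖ ∂ν =
      Module.finrank ℝ E * ν.real (Metric.ball 0 1) * Real.log (s / r) := by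
  rw [integral_fun_norm_addHaar ν, eqOn_pow_mul_indicator_inv_pow hr Module.finrank_pos.ne',
    setIntegral_indicator measurableSet_Icc,
    inter_eq_right.2 (show Icc r s ⊆ Ioi 0 from fun y hy => hr.trans_le hy.1), integral_Icc_eq_integral_Ioc,
    ← intervalIntegral.integral_of_le hrs, integral_inv_of_pos hr (hr.trans_le hrs)]
  simp [mul_assoc]

end Shell

/-! ### The ground state and its gradient. -/

section GroundState

variable {m : ℕ} {a μ : ℝ} {p : EuclideanSpace ℝ (Fin m) × ℝ}

/-- The virtual ground state, homogeneous of degree `-μ`. -/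
noncomputable def groundState (a μ : ℝ) (p : EuclideanSpace ℝ (Fin m) × ℝ) : ℝ :=
  sqLen p ^ (-μ / 2) * gegenbauerIntegral a μ (cosAngle p)

lemma grad_eq_of_fderiv {z : EuclideanSpace ℝ (Fin m) × ℝ → ℝ}
    {w : EuclideanSpace ℝ (Fin m) × ℝ}
    (h : ∀ e, fderiv ℝ z p e = inner ℝ w.1 e.1 + w.2 * e.2) : grad z p = w := by
  refine Prod.ext (ext_inner_right ℝ fun x => ?_) ?_
  · rw [inner_grad_fst, h]; simp
  · refine (h (0, 1)).trans ?_
    simp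

lemma hasDerivAt_sqLen_line (p e : EuclideanSpace ℝ (Fin m) × ℝ) :
    HasDerivAt (fun l : ℝ => sqLen (p + l • e)) (2 * (inner ℝ p.1 e.1 + p.2 * e.2)) 0 := by
  have h1 : (fun l : ℝ => sqLen (p + l • e)) = fun l =>
      sqLen p + l * (2 * (inner ℝ p.1 e.1 + p.2 * e.2)) + l ^ 2 * sqLen e := by
    funext l
    simp only [sqLen, Prod.fst_add, Prod.snd_add, Prod.smul_fst, Prod.smul_snd, smul_eq_mul]
    rw [norm_add_sq_real, inner_smul_right, norm_smul, mul_pow, Real.norm_eq_abs, sq_abs]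
    ring
  rw [h1]
  have h2 := (((hasDerivAt_id' (0 : ℝ)).mul_const (2 * (inner ℝ p.1 e.1 + p.2 * e.2))).const_add
    (sqLen p)).fun_add (((hasDerivAt_id' (0 : ℝ)).fun_pow 2).mul_const (sqLen e))
  simpa using h2

lemma hasDerivAt_line (p e : EuclideanSpace ℝ (Fin m) × ℝ) :
    HasDerivAt (fun l : ℝ => p + l • e) e 0 := by
  simpa using ((hasDerivAt_id (0 : ℝ)).smul_const e).const_add p

lemma hasDerivAt_comp_line {z : EuclideanSpace ℝ (Fin m) × ℝ → ℝ} (hz : DifferentiableAt ℝ z p)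
    (e : EuclideanSpace ℝ (Fin m) × ℝ) :
    HasDerivAt (fun l : ℝ => z (p + l • e)) (fderiv ℝ z p e) 0 := by
  refine HasFDerivAt.comp_hasDerivAt (l := z) (f := fun l : ℝ => p + l • e) 0 ?_
    (hasDerivAt_line p e)
  simpa using hz.hasFDerivAt

lemma grad_sqLen (p : EuclideanSpace ℝ (Fin m) × ℝ) : grad sqLen p = (2 : ℝ) • p := by
  refine grad_eq_of_fderiv fun e => ?_
  have h := (hasDerivAt_comp_line
    ((contDiff_sqLen (k := 1)).contDiffAt.differentiableAt one_ne_zero) e).unique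
    (hasDerivAt_sqLen_line p e)
  rw [h]
  simp only [Prod.smul_fst, Prod.smul_snd, inner_smul_left, smul_eq_mul]
  simp
  ring

variable (ha : 0 < a) (haμ : a < 2 * μ)
include ha haμ

lemma contDiffAt_groundState (hp : p ≠ 0) (ht : 0 ≤ p.2) : ContDiffAt ℝ 1 (groundState a μ) p := by
  have hs : -1 < cosAngle p := by linarith [cosAngle_nonneg ht]
  exact (contDiff_sqLen.contDiffAt.rpow_const_of_ne (sqLen_pos hp).ne').mul
    (((contDiffAt_gegenbauerIntegral ha haμ hs 1).comp p (contDiffAt_cosAngle hp)))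

lemma grad_groundState (hp : p ≠ 0) (ht : 0 ≤ p.2) :
    grad (groundState a μ) p = -(groundState a μ p • calibration a μ p) := by
  have hs : -1 < cosAngle p := by linarith [cosAngle_nonneg ht]
  have hN := sqLen_pos hp
  have hρ := Real.sqrt_pos.2 hN
  have hg := gegenbauerIntegral_pos ha haμ hs
  refine grad_eq_of_fderiv fun e => ?_
  have hN1 := hasDerivAt_sqLen_line p e
  have hT1 : HasDerivAt (fun l : ℝ => (p + l • e).2) e.2 0 := by
    simpa using ((hasDerivAt_id' (0 : ℝ)).mul_const e.2).const_add p.2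
  have hs1 : HasDerivAt (fun l : ℝ => cosAngle (p + l • e)) _ 0 :=
    hasDerivAt_cosAngle_line hN1 hT1 (by simpa using hN)
  have hq : HasDerivAt (gegenbauerIntegral a μ)
      (-(2 * μ) * gegenbauerIntegral (a + 1) (μ + 1) (cosAngle p))
      (cosAngle (p + (0 : ℝ) • e)) := by
    simpa using hasDerivAt_gegenbauerIntegral ha haμ hs
  have hφ := (hN1.rpow_const (p := -μ / 2) (Or.inl (by simpa using hN.ne'))).fun_mul
    (hq.comp 0 hs1)
  rw [(hasDerivAt_comp_line ((contDiffAt_groundState ha haμ hp ht).differentiableAt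
    one_ne_zero) e).unique hφ]
  have hg' : 2 * μ * gegenbauerIntegral (a + 1) (μ + 1) (cosAngle p) =
      profileRatio a μ (cosAngle p) * gegenbauerIntegral a μ (cosAngle p) := by
    unfold profileRatio; field_simp
  have ht2 : p.2 = √(sqLen p) * cosAngle p := by unfold cosAngle; field_simp
  simp only [zero_smul, add_zero, Function.comp, groundState, calibration, Prod.fst_neg,
    Prod.snd_neg, Prod.smul_fst, Prod.smul_snd, inner_neg_left, inner_smul_left, smul_eq_mul,
    horizontalCoeff, verticalCoeff, RCLike.conj_to_real]
  rw [neg_mul, hg', Real.rpow_sub_one hN.ne', ht2]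
  generalize profileRatio a μ (cosAngle p) = q
  generalize gegenbauerIntegral a μ (cosAngle p) = g at *
  generalize sqLen p ^ (-μ / 2) = w
  generalize cosAngle p = s
  generalize inner ℝ p.1 e.1 = i
  have hρ2 : sqLen p = √(sqLen p) ^ 2 := (Real.sq_sqrt hN.le).symm
  rw [hρ2]
  simp only [Real.sqrt_sq hρ.le]
  generalize √(sqLen p) = ρ at *
  field_simp
  ring

/-- On t ≥ 0 the cosine is nonnegative, where the profile is largest at 0. -/
lemma groundState_sq_le (ht : 0 ≤ p.2) :
    groundState a μ p ^ 2 ≤ gegenbauerIntegral a μ 0 ^ 2 * sqLen p ^ (-μ) := by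
  have hs := cosAngle_nonneg ht
  have h0 := gegenbauerIntegral_pos ha haμ (s := cosAngle p) (by linarith)
  have h1 := gegenbauerIntegral_antitoneOn ha haμ hs
  have hN := sqLen_nonneg p
  rw [groundState, mul_pow, ← Real.rpow_natCast (sqLen p ^ (-μ / 2)), ← Real.rpow_mul hN,
    mul_comm]
  push_cast
  rw [div_mul_cancel₀ _ two_ne_zero]
  gcongr

omit ha haμ in
lemma groundState_boundary_sq (x : EuclideanSpace ℝ (Fin m)) :
    groundState a μ (x, 0) ^ 2 = gegenbauerIntegral a μ 0 ^ 2 * ‖x‖ ^ (-(2 * μ)) := by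
  have h1 : sqLen (x, (0 : ℝ)) = ‖x‖ ^ (2 : ℝ) := by simp [sqLen]
  have h2 : cosAngle (x, (0 : ℝ)) = 0 := by simp [cosAngle]
  rw [groundState, mul_pow, h1, h2, ← Real.rpow_natCast (_ ^ (-μ / 2)),
    ← Real.rpow_mul (norm_nonneg x), ← Real.rpow_mul (norm_nonneg x), mul_comm]
  congr 2
  push_cast
  ring

end GroundState

/-! ### Logarithmic cutoff of the ground state. -/

section Cutoff

variable {m : ℕ} {a μ L : ℝ} {p : EuclideanSpace ℝ (Fin m) × ℝ}

/-- A smooth bump, equal to one on `[-1, 1]` and supported in `[-2, 2]`. -/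
noncomputable def logBump : ContDiffBump (0 : ℝ) := ⟨1, 2, one_pos, one_lt_two⟩

/-- Cutoff to the logarithmic shell `|log (‖x‖² + t²)| ≤ 2 L`. -/
noncomputable def logCutoff (L : ℝ) (p : EuclideanSpace ℝ (Fin m) × ℝ) : ℝ :=
  logBump (Real.log (sqLen p) * L⁻¹)

/-- The virtual ground state cut off to a logarithmic shell. -/
noncomputable def cutGroundState (a μ L : ℝ) (p : EuclideanSpace ℝ (Fin m) × ℝ) : ℝ :=
  logCutoff L p * groundState a μ p

/-- The logarithmic shell `exp (-2 L) ≤ ‖x‖² + t² ≤ exp (2 L)`. -/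
def logShell (m : ℕ) (L : ℝ) : Set (EuclideanSpace ℝ (Fin m) × ℝ) :=
  {p | sqLen p ∈ Icc (Real.exp (-(2 * L))) (Real.exp (2 * L))}

lemma isCompact_logShell : IsCompact (logShell m L) := by
  refine Metric.isCompact_of_isClosed_isBounded
    (isClosed_Icc.preimage (contDiff_sqLen (k := 0)).continuous) ?_
  refine (Metric.isBounded_closedBall (x := 0) (r := Real.exp L)).subset fun p hp => ?_
  rw [mem_closedBall_zero_iff]
  refine le_of_abs_le (abs_le_of_sq_le_sq ((norm_sq_le_sqLen p).trans (hp.2.trans_eq ?_)) (Real.exp_pos L).le)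
  rw [← Real.exp_nat_mul]; simp

lemma mem_logShell (hL : 0 < L) (hp : p ≠ 0) (h : |Real.log (sqLen p) * L⁻¹| ≤ 2) :
    p ∈ logShell m L := by
  have hN := sqLen_pos hp
  rw [← div_eq_mul_inv, abs_le, le_div_iff₀ hL, div_le_iff₀ hL] at h
  exact ⟨(Real.le_log_iff_exp_le hN).1 (by linarith), (Real.log_le_iff_le_exp hN).1 h.2⟩

lemma contDiffAt_logCutoff (hp : p ≠ 0) : ContDiffAt ℝ 1 (logCutoff L) p := by
  refine (logBump.contDiff (n := 1)).contDiffAt.comp p ?_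
  exact (contDiff_sqLen.contDiffAt.log (sqLen_pos hp).ne').mul contDiffAt_const

lemma grad_logCutoff (hp : p ≠ 0) : grad (logCutoff L) p =
    (deriv logBump (Real.log (sqLen p) * L⁻¹) * (L⁻¹ * (sqLen p)⁻¹ * 2)) • p := by
  have hN := sqLen_pos hp
  have hT : HasDerivAt (fun N => logBump (Real.log N * L⁻¹))
      (deriv logBump (Real.log (sqLen p) * L⁻¹) * ((sqLen p)⁻¹ * L⁻¹)) (sqLen p) :=
    HasDerivAt.comp (h₂ := logBump) (sqLen p)
      ((logBump.contDiff (n := 1)).differentiable one_ne_zero _).hasDerivAt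
      ((Real.hasDerivAt_log hN.ne').mul_const _)
  have h := grad_comp (f := sqLen) hT.differentiableAt
    ((contDiff_sqLen (k := 1)).contDiffAt.differentiableAt one_ne_zero)
  rw [hT.deriv, grad_sqLen, smul_smul] at h
  rw [show logCutoff L = fun p => logBump (Real.log (sqLen p) * L⁻¹) from rfl, h]
  congr 1; ring

lemma mem_logShell_of_cutGroundState_ne_zero (hμ : 0 < μ) (hL : 0 < L)
    (h : cutGroundState a μ L p ≠ 0) : p ∈ logShell m L := by
  -- The origin is excluded by the ground state, not by the cutoff: `Real.log 0 = 0` makes the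
  -- cutoff equal to 1 there, whereas 0 to the nonzero power -μ/2 is 0 in `Real.rpow`.
  have hp : p ≠ 0 := by
    rintro rfl
    refine h ?_
    simp [cutGroundState, groundState, sqLen, Real.zero_rpow (show -μ / 2 ≠ 0 by linarith)]
  refine mem_logShell hL hp (not_lt.1 fun h2 => h ?_)
  have : logCutoff L p = 0 := logBump.zero_of_le_dist (by simpa [logBump] using h2.le)
  simp [cutGroundState, this]

lemma tsupport_cutGroundState_subset (hμ : 0 < μ) (hL : 0 < L) :
    tsupport (cutGroundState a μ L) ⊆ logShell m L :=
  closure_minimal (fun _ hp => mem_logShell_of_cutGroundState_ne_zero hμ hL hp)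
    isCompact_logShell.isClosed

lemma ne_zero_of_mem_logShell (hp : p ∈ logShell m L) : p ≠ 0 := by
  rintro rfl
  have h := (Real.exp_pos _).trans_le hp.1
  simp [sqLen] at h

variable (ha : 0 < a) (haμ : a < 2 * μ) (hL : 0 < L)
include ha haμ

/-- With F = -∇U / U the terms χ∇U and χUF cancel, so only the gradient of the cutoff contributes to
the defect in Green's identity. -/
lemma grad_cutGroundState_add (hp : p ≠ 0) (ht : 0 ≤ p.2) :
    grad (cutGroundState a μ L) p + cutGroundState a μ L p • calibration a μ p =
      groundState a μ p • grad (logCutoff L) p := by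
  have h := grad_mul ((contDiffAt_logCutoff (L := L) hp).differentiableAt one_ne_zero)
    ((contDiffAt_groundState ha haμ hp ht).differentiableAt one_ne_zero)
  rw [show cutGroundState a μ L = fun p => logCutoff L p * groundState a μ p from rfl, h,
    grad_groundState ha haμ hp ht]
  simp only [smul_neg, smul_smul]
  abel

include hL

lemma isGreenTest_cutGroundState : IsGreenTest (m := m) 0 (cutGroundState a μ L) := by
  have hsub := tsupport_cutGroundState_subset (m := m) (a := a) (show 0 < μ by linarith) hL
  refine ⟨le_rfl, isCompact_logShell.of_isClosed_subset (isClosed_tsupport _) hsub,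
    fun p ht => ?_, fun p hp _ => ne_zero_of_mem_logShell (hsub hp)⟩
  by_cases hp : p = 0
  · refine (contDiffAt_const (c := (0 : ℝ))).congr_of_eventuallyEq
      (notMem_tsupport_iff_eventuallyEq.1 fun h => ?_)
    exact ne_zero_of_mem_logShell (hsub h) hp
  · exact (contDiffAt_logCutoff hp).mul (contDiffAt_groundState ha haμ hp ht)

/-- U² is at most g(0)² ρ^(-2μ) and |∇χ|² at most 4C² / (L²ρ²). The product carries the critical
power ρ^(-(m+1)), which is bounded by the same power of the maximum norm. -/
lemma sqLen_grad_cutGroundState_add_le {C : ℝ} (hC : ∀ t, |deriv logBump t| ≤ C)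
    (hm : (m : ℝ) = 2 * μ + 1) (hp : p ≠ 0) (ht : 0 ≤ p.2) :
    sqLen (grad (cutGroundState a μ L) p + cutGroundState a μ L p • calibration a μ p) ≤
      4 * gegenbauerIntegral a μ 0 ^ 2 * C ^ 2 / L ^ 2 *
        (Icc (Real.exp (-L - 1)) (Real.exp L)).indicator (fun y => (y ^ (m + 1))⁻¹) ‖p‖ := by
  have hN := sqLen_pos hp
  have hn : 0 < ‖p‖ := norm_pos_iff.2 hp
  rw [grad_cutGroundState_add ha haμ hp ht, grad_logCutoff hp, sqLen_smul, sqLen_smul]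
  by_cases hb : |Real.log (sqLen p) * L⁻¹| ≤ 2
  · have hsh := mem_logShell hL hp hb
    have hmem : ‖p‖ ∈ Icc (Real.exp (-L - 1)) (Real.exp L) := by
      constructor
      -- The maximum norm satisfies ρ² ≤ 2‖p‖²; the extra -1 in the exponent absorbs this factor 2.
      · refine le_of_abs_le (abs_le_of_sq_le_sq ?_ hn.le)
        have h1 := hsh.1.trans (sqLen_le_two_mul_norm_sq p)
        have h2 : Real.exp (-L - 1) ^ 2 = Real.exp (-(2 * L)) * Real.exp (-2) := by
          rw [← Real.exp_nat_mul, ← Real.exp_add]; congr 1; push_cast; ring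
        have h3 : Real.exp (-2) ≤ 1 / 2 := by
          rw [Real.exp_neg, inv_le_comm₀ (Real.exp_pos _) (by norm_num)]
          linarith [Real.add_one_le_exp (2 : ℝ)]
        rw [h2]
        nlinarith [Real.exp_pos (-(2 * L))]
      · refine le_of_abs_le (abs_le_of_sq_le_sq ((norm_sq_le_sqLen p).trans (hsh.2.trans_eq ?_)) (Real.exp_pos L).le)
        rw [← Real.exp_nat_mul]; simp
    rw [indicator_of_mem hmem]
    have hpow : sqLen p ^ (-μ) * (sqLen p)⁻¹ ≤ (‖p‖ ^ (m + 1))⁻¹ := by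
      have e1 : sqLen p ^ (-μ) * (sqLen p)⁻¹ = sqLen p ^ (-(μ + 1)) := by
        rw [← Real.rpow_neg_one (sqLen p), ← Real.rpow_add hN]; congr 1; ring
      have e2 : (‖p‖ ^ (m + 1))⁻¹ = (‖p‖ ^ 2) ^ (-(μ + 1)) := by
        rw [← Real.rpow_natCast, ← Real.rpow_natCast, ← Real.rpow_neg hn.le,
          ← Real.rpow_mul hn.le]
        congr 1; push_cast; rw [hm]; ring
      rw [e1, e2]
      exact Real.rpow_le_rpow_of_nonpos (by positivity) (norm_sq_le_sqLen p) (by linarith)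
    have hd : deriv logBump (Real.log (sqLen p) * L⁻¹) ^ 2 ≤ C ^ 2 :=
      sq_le_sq' (abs_le.1 (hC _)).1 (abs_le.1 (hC _)).2
    calc _ = groundState a μ p ^ 2 * (sqLen p)⁻¹ *
          (4 * deriv logBump (Real.log (sqLen p) * L⁻¹) ^ 2 / L ^ 2) := by
            field_simp
            ring
      _ ≤ gegenbauerIntegral a μ 0 ^ 2 * sqLen p ^ (-μ) * (sqLen p)⁻¹ * (4 * C ^ 2 / L ^ 2) := by
          have := groundState_sq_le ha haμ ht
          gcongr
      _ ≤ gegenbauerIntegral a μ 0 ^ 2 * (‖p‖ ^ (m + 1))⁻¹ * (4 * C ^ 2 / L ^ 2) := by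
          rw [mul_assoc (_ ^ 2)]
          gcongr
      _ = _ := by ring
  · have h0 : deriv logBump (Real.log (sqLen p) * L⁻¹) = 0 := by
      have : Real.log (sqLen p) * L⁻¹ ∉ tsupport logBump := by
        rw [logBump.tsupport_eq, mem_closedBall_zero_iff]
        simpa [logBump] using hb
      rw [(notMem_tsupport_iff_eventuallyEq.1 this).deriv_eq]
      exact deriv_const _ (0 : ℝ)
    rw [h0]
    have h1 : 0 ≤ (Icc (Real.exp (-L - 1)) (Real.exp L)).indicator
        (fun y => (y ^ (m + 1))⁻¹) ‖p‖ := indicator_nonneg (fun y hy => by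
          have := (Real.exp_pos _).trans_le hy.1
          positivity) _
    simp only [zero_mul, ne_eq, OfNat.ofNat_ne_zero, not_false_eq_true, zero_pow, mul_zero]
    positivity

omit ha haμ in
-- The cutoff is 1 where |log |x|²| ≤ L, that is |log |x|| ≤ L/2; there U² / |x| = g(0)² |x|^(-2μ-1)
-- is the critical power |x|^(-m).
lemma le_cutGroundState_boundary (hm : (m : ℝ) = 2 * μ + 1) (x : EuclideanSpace ℝ (Fin m)) :
    gegenbauerIntegral a μ 0 ^ 2 *
      (Icc (Real.exp (-(L / 2))) (Real.exp (L / 2))).indicator (fun y => (y ^ m)⁻¹) ‖x‖ ≤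
      cutGroundState a μ L (x, 0) ^ 2 / ‖x‖ := by
  by_cases hx : ‖x‖ ∈ Icc (Real.exp (-(L / 2))) (Real.exp (L / 2))
  · have h0 : 0 < ‖x‖ := (Real.exp_pos _).trans_le hx.1
    have h1 : logCutoff L (x, (0 : ℝ)) = 1 := by
      refine logBump.one_of_mem_closedBall ?_
      have e : sqLen (x, (0 : ℝ)) = ‖x‖ ^ 2 := by simp [sqLen]
      rw [mem_closedBall_zero_iff, Real.norm_eq_abs, e, Real.log_pow, ← div_eq_mul_inv]
      change _ ≤ (1 : ℝ)
      have h2 := (Real.le_log_iff_exp_le h0).2 hx.1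
      have h3 := (Real.log_le_iff_le_exp h0).2 hx.2
      rw [abs_le, le_div_iff₀ hL, div_le_iff₀ hL]
      push_cast
      constructor <;> linarith
    rw [indicator_of_mem hx, cutGroundState, h1, one_mul, groundState_boundary_sq, mul_div_assoc,
      ← Real.rpow_natCast _ m, ← Real.rpow_neg h0.le, ← Real.rpow_sub_one h0.ne', hm]
    refine le_of_eq ?_
    congr 2; ring
  · rw [indicator_of_notMem hx, mul_zero]
    positivity

end Cutoff

/-! ### Sharpness of the constant. -/

section Optimality

variable {n : ℕ} {a μ L : ℝ}

/-- The shell has logarithmic width 2L + 1, against the factor L⁻² from the cutoff: the defect is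
O(1/L). -/
lemma integral_sqLen_cutGroundState_le (ha : 0 < a) (haμ : a < 2 * μ) (hL : 0 < L)
    (hn : 2 ≤ n) (hm : ((n - 1 : ℕ) : ℝ) = 2 * μ + 1) {C : ℝ} (hC : ∀ t, |deriv logBump t| ≤ C) :
    ∫ p in aboveHeight (n - 1) 0,
      sqLen (grad (cutGroundState a μ L) p + cutGroundState a μ L p • calibration a μ p) ≤
      4 * gegenbauerIntegral a μ 0 ^ 2 * C ^ 2 / L ^ 2 *
        (n * (volume : Measure (SplitSpace n)).real (Metric.ball 0 1) * (2 * L + 1)) := by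
  have hd : Module.finrank ℝ (SplitSpace n) = n - 1 + 1 := by simp
  have hd' : (Module.finrank ℝ (SplitSpace n) : ℝ) = n := by rw [hd, Nat.sub_add_cancel (by omega)]
  have hI := integrable_shell (volume : Measure (SplitSpace n)) (s := Real.exp L)
    (Real.exp_pos (-L - 1))
  have hJ := integral_shell (volume : Measure (SplitSpace n)) (s := Real.exp L)
    (Real.exp_pos (-L - 1)) (Real.exp_le_exp.2 (by linarith))
  rw [hd', Real.log_div (Real.exp_pos _).ne' (Real.exp_pos _).ne', Real.log_exp, Real.log_exp,
    show L - (-L - 1) = 2 * L + 1 by ring] at hJ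
  rw [← hJ, ← integral_const_mul]
  have hI' := hI.const_mul (4 * gegenbauerIntegral a μ 0 ^ 2 * C ^ 2 / L ^ 2)
  refine (setIntegral_mono_on ((isGreenTest_cutGroundState ha haμ hL).integral_grad ha haμ hm).1
    hI'.integrableOn (measurableSet_aboveHeight 0) fun p (hp : 0 < p.2) => ?_).trans
    (setIntegral_le_integral hI' (ae_of_all _ fun p => ?_))
  · rw [hd]
    exact sqLen_grad_cutGroundState_add_le ha haμ hL hC hm
      (by rintro rfl; exact lt_irrefl _ hp) hp.le
  · refine mul_nonneg (by positivity) (indicator_nonneg (fun y hy => ?_) _)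
    have := (Real.exp_pos _).trans_le hy.1
    positivity

lemma le_integral_cutGroundState_boundary (hL : 0 < L) (hn : 2 ≤ n)
    (hm : ((n - 1 : ℕ) : ℝ) = 2 * μ + 1)
    (hI : Integrable fun x : EuclideanSpace ℝ (Fin (n - 1)) =>
      cutGroundState a μ L (x, 0) ^ 2 / ‖x‖) :
    gegenbauerIntegral a μ 0 ^ 2 * ((2 * μ + 1) *
      (volume : Measure (EuclideanSpace ℝ (Fin (n - 1)))).real (Metric.ball 0 1) * L) ≤
      ∫ x : EuclideanSpace ℝ (Fin (n - 1)), cutGroundState a μ L (x, 0) ^ 2 / ‖x‖ := by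
  have : Nonempty (Fin (n - 1)) := ⟨⟨0, by omega⟩⟩
  have hS := integrable_shell (volume : Measure (EuclideanSpace ℝ (Fin (n - 1))))
    (s := Real.exp (L / 2)) (Real.exp_pos (-(L / 2)))
  have hJ := integral_shell (volume : Measure (EuclideanSpace ℝ (Fin (n - 1))))
    (s := Real.exp (L / 2)) (Real.exp_pos (-(L / 2))) (Real.exp_le_exp.2 (by linarith))
  simp only [finrank_euclideanSpace, Fintype.card_fin] at hS hJ
  rw [hm, Real.log_div (Real.exp_pos _).ne' (Real.exp_pos _).ne', Real.log_exp, Real.log_exp,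
    show L / 2 - -(L / 2) = L by ring] at hJ
  rw [← hJ, ← integral_const_mul]
  exact integral_mono (hS.const_mul _) hI fun x => le_cutGroundState_boundary hL hm x

lemma exists_abs_deriv_logBump_le : ∃ C, ∀ t, |deriv logBump t| ≤ C := by
  have h1 : Continuous (deriv logBump) :=
    (logBump.contDiff (n := 1)).continuous_deriv le_rfl
  have h2 : HasCompactSupport (deriv logBump) := logBump.hasCompactSupport.deriv
  simpa using h2.exists_bound_of_continuous h1

/-- Testing the Hardy inequality on a Green test function bounds its constant. -/
lemma mul_integral_boundary_le {C : ℝ} {z : SplitSpace n → ℝ} (hz : IsGreenTest 0 z) (ha : 0 < a)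
    (haμ : a < 2 * μ) (hm : ((n - 1 : ℕ) : ℝ) = 2 * μ + 1) (hC0 : 0 ≤ C)
    (hI : Integrable fun x : EuclideanSpace ℝ (Fin (n - 1)) => z (x, 0) ^ 2 / ‖x‖)
    (hC : ENNReal.ofReal C * (∫⁻ x : EuclideanSpace ℝ (Fin (n - 1)),
        ENNReal.ofReal (z (x, 0) ^ 2 / ‖x‖)) +
      ENNReal.ofReal ((μ - a) ^ 2) *
        (∫⁻ p in halfSpace n, ENNReal.ofReal (z p ^ 2 / sqLen p)) ≤
      ∫⁻ p in halfSpace n, ENNReal.ofReal (sqLen (grad z p))) :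
    (C - profileRatio a μ 0) * ∫ x : EuclideanSpace ℝ (Fin (n - 1)), z (x, 0) ^ 2 / ‖x‖ ≤
      ∫ p in aboveHeight (n - 1) 0, sqLen (grad z p + z p • calibration a μ p) := by
  have hB := integral_nonneg (μ := volume) (f := fun x : EuclideanSpace ℝ (Fin (n - 1)) =>
    z (x, 0) ^ 2 / ‖x‖) fun x => by positivity
  have hQ0 : ∀ p, 0 ≤ z p ^ 2 / sqLen p := fun p => div_nonneg (sq_nonneg _) (sqLen_nonneg p)
  have hQ : 0 ≤ ∫ p in halfSpace n, z p ^ 2 / sqLen p := integral_nonneg hQ0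
  have hG := (hz.integral_grad ha haμ hm).2
  have hIq : IntegrableOn (fun p => z p ^ 2 / sqLen p) (halfSpace n) := hz.integrableOn_sq_div
  have hIg : IntegrableOn (fun p => sqLen (grad z p)) (halfSpace n) := hz.integrableOn_grad
  rw [← ofReal_integral_eq_lintegral_ofReal hI (ae_of_all _ fun x => by positivity),
    ← ofReal_integral_eq_lintegral_ofReal hIq (ae_of_all _ hQ0),
    ← ofReal_integral_eq_lintegral_ofReal hIg
      (ae_of_all _ fun p => sqLen_nonneg _),
    ← ENNReal.ofReal_mul hC0, ← ENNReal.ofReal_mul (sq_nonneg _),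
    ← ENNReal.ofReal_add (mul_nonneg hC0 hB) (mul_nonneg (sq_nonneg _) hQ),
    ENNReal.ofReal_le_ofReal_iff (integral_nonneg fun p => sqLen_nonneg _)] at hC
  have e1 : ∫ x, z (x, 0) ^ 2 * verticalCoeff a μ (x, 0) =
      profileRatio a μ 0 * ∫ x : EuclideanSpace ℝ (Fin (n - 1)), z (x, 0) ^ 2 / ‖x‖ := by
    rw [← integral_const_mul]
    congr 1; funext x
    rw [verticalCoeff_boundary]; ring
  rw [e1] at hG
  change _ ≤ ∫ p in aboveHeight (n - 1) 0, sqLen (grad z p) at hC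
  change C * _ + (μ - a) ^ 2 * (∫ p in aboveHeight (n - 1) 0, z p ^ 2 / sqLen p) ≤ _ at hC
  rw [hG] at hC
  linarith

/-- No constant larger than `profileRatio a μ 0` is admissible in the Hardy trace inequality. -/
theorem le_profileRatio_of_hardy {C : ℝ} (ha : 0 < a) (haμ : a < 2 * μ)
    (hm : ((n - 1 : ℕ) : ℝ) = 2 * μ + 1) (hn : 2 ≤ n)
    (hC : ∀ (u : SplitSpace n → ℝ) (G : SplitSpace n → SplitSpace n)
      (v : EuclideanSpace ℝ (Fin (n - 1)) → ℝ), IsAdmissible n u G → IsTrace n u v →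
      ENNReal.ofReal C * (∫⁻ x, ENNReal.ofReal (v x ^ 2 / ‖x‖)) + ENNReal.ofReal ((μ - a) ^ 2) *
        (∫⁻ p in halfSpace n, ENNReal.ofReal (u p ^ 2 / sqLen p)) ≤
      ∫⁻ p in halfSpace n, ENNReal.ofReal (sqLen (G p))) :
    C ≤ profileRatio a μ 0 := by
  -- The negation also gives C > 0, so that `ENNReal.ofReal C` loses nothing.
  by_contra! hlt
  have hH := profileRatio_pos ha haμ (s := 0) (by norm_num)
  have hg := gegenbauerIntegral_pos ha haμ (s := 0) (by norm_num)
  obtain ⟨M, hM⟩ := exists_abs_deriv_logBump_le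
  set K₁ := gegenbauerIntegral a μ 0 ^ 2 * ((2 * μ + 1) *
    (volume : Measure (EuclideanSpace ℝ (Fin (n - 1)))).real (Metric.ball 0 1)) with hK₁
  set K₂ := 4 * gegenbauerIntegral a μ 0 ^ 2 * M ^ 2 *
    (n * (volume : Measure (SplitSpace n)).real (Metric.ball 0 1)) with hK₂
  have hK₁0 : 0 < K₁ := by
    have h1 : 0 < (volume : Measure (EuclideanSpace ℝ (Fin (n - 1)))).real (Metric.ball 0 1) :=
      ENNReal.toReal_pos (Metric.measure_ball_pos _ _ one_pos).ne' measure_ball_lt_top.ne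
    have : 0 < μ := by linarith
    positivity
  have hK₂0 : 0 ≤ K₂ := by positivity
  -- The boundary integral is at least K₁L and the defect at most K₂(2L + 1)/L² ≤ 3K₂; a bound
  -- uniform in L is enough for a contradiction.
  have key : ∀ L : ℝ, 1 ≤ L → (C - profileRatio a μ 0) * (K₁ * L) ≤ 3 * K₂ := by
    intro L hL1
    have hL : 0 < L := by linarith
    have hz := isGreenTest_cutGroundState (m := n - 1) ha haμ hL
    have hI : Integrable fun x : EuclideanSpace ℝ (Fin (n - 1)) =>
        cutGroundState a μ L (x, 0) ^ 2 / ‖x‖ := by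
      refine ((hz.integrable_boundary ha haμ).const_mul (profileRatio a μ 0)⁻¹).congr
        (ae_of_all _ fun x => ?_)
      simp only [verticalCoeff_boundary]
      field_simp
    have h1 := mul_integral_boundary_le hz ha haμ hm (hH.le.trans hlt.le) hI
      (hC _ _ _ hz.isAdmissible hz.isTrace)
    have h2 := integral_sqLen_cutGroundState_le ha haμ hL hn hm hM
    have h3 := mul_le_mul_of_nonneg_left (le_integral_cutGroundState_boundary hL hn hm hI)
      (sub_pos.2 hlt).le
    have h4 : 4 * gegenbauerIntegral a μ 0 ^ 2 * M ^ 2 / L ^ 2 *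
        (n * (volume : Measure (SplitSpace n)).real (Metric.ball 0 1) * (2 * L + 1)) =
        K₂ * ((2 * L + 1) / L ^ 2) := by rw [hK₂]; ring
    have h5 : (2 * L + 1) / L ^ 2 ≤ 3 := by
      rw [div_le_iff₀ (by positivity)]; nlinarith
    have h6 := mul_le_mul_of_nonneg_left h5 hK₂0
    calc _ = (C - profileRatio a μ 0) * (gegenbauerIntegral a μ 0 ^ 2 * ((2 * μ + 1) *
          (volume : Measure (EuclideanSpace ℝ (Fin (n - 1)))).real (Metric.ball 0 1) * L)) := by
            rw [hK₁]; ring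
      _ ≤ K₂ * ((2 * L + 1) / L ^ 2) := (h3.trans h1).trans (h2.trans_eq h4)
      _ ≤ _ := by linarith
  have hpos : 0 < (C - profileRatio a μ 0) * K₁ := mul_pos (sub_pos.2 hlt) hK₁0
  -- This L makes the left side of `key` exceed 3K₂ by exactly (C - H)K₁ > 0.
  have h := key (3 * K₂ / ((C - profileRatio a μ 0) * K₁) + 1)
    (le_add_of_nonneg_left (by positivity))
  rw [← mul_assoc, mul_add, mul_div_cancel₀ _ hpos.ne'] at h
  linarith

end Optimality

/-- For `n ≥ 3` and `2 ≤ β < n`: `H(n, β)` is positive, every admissible function has a trace, and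
`H(n, β)` is the largest constant for which the inequality holds for all admissible functions.
All integrals are integrals of nonnegative functions with values in `[0, ∞]`; the right-hand side
is finite for admissible `u`. -/
theorem theorem1p1 (n : ℕ) (hn : 3 ≤ n) (β : ℝ) (hβ : 2 ≤ β) (hβn : β < (n : ℝ)) :
    0 < hardyTraceConst n β ∧
    (∀ (u : SplitSpace n → ℝ) (G : SplitSpace n → SplitSpace n),
      IsAdmissible n u G → ∃ v, IsTrace n u v) ∧
    IsGreatest
      {C : ℝ | ∀ (u : SplitSpace n → ℝ) (G : SplitSpace n → SplitSpace n)
        (v : EuclideanSpace ℝ (Fin (n - 1)) → ℝ), IsAdmissible n u G → IsTrace n u v →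
        ENNReal.ofReal C * (∫⁻ x, ENNReal.ofReal (v x ^ 2 / ‖x‖)) +
          ENNReal.ofReal ((β - 2) ^ 2 / 4) *
            (∫⁻ p in halfSpace n, ENNReal.ofReal (u p ^ 2 / (‖p.1‖ ^ 2 + p.2 ^ 2))) ≤
          ∫⁻ p in halfSpace n, ENNReal.ofReal (‖(G p).1‖ ^ 2 + (G p).2 ^ 2)}
      (hardyTraceConst n β) := by
  have hn3 : (3 : ℝ) ≤ n := by exact_mod_cast hn
  have ha : 0 < ((n : ℝ) + β) / 2 - 2 := by linarith
  have haμ : ((n : ℝ) + β) / 2 - 2 < 2 * (((n : ℝ) - 2) / 2) := by linarith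
  have hm : ((n - 1 : ℕ) : ℝ) = 2 * (((n : ℝ) - 2) / 2) + 1 := by
    rw [Nat.cast_sub (by omega)]; push_cast; ring
  have hsq : (β - 2) ^ 2 / 4 = (((n : ℝ) - 2) / 2 - (((n : ℝ) + β) / 2 - 2)) ^ 2 := by ring
  rw [← profileRatio_eq_hardyTraceConst hn hβ hβn, hsq]
  exact ⟨profileRatio_pos ha haμ (by norm_num), fun u G h => exists_trace h,
    fun u G v h hv => hardy_trace_inequality h hv ha haμ hm (by omega),
    fun C hC => le_profileRatio_of_hardy ha haμ hm (by omega) hC⟩
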